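/- Let $r\ge1$, $p\in[1,\infty)$, let $q$ be an $r\times r$ matrix function with entries in $L_p(-1,1)$, and let $U$ be a unitary $2r\times2r$ matrix. Below, absolutely continuous (AC) functions on a closed interval are the elements of the Sobolev space $W_1^1$, and differential equations hold almost everywhere. For $n\ge1$ put $$J_n=\frac1{\mathrm i}\begin{pmatrix}I_n&0\\0&-I_n\end{pmatrix},\qquad \mathcal Q_W=\begin{pmatrix}0&W\\W^*&0\end{pmatrix}$$ for an $n\times n$ matrix function $W$. **The operator $T_{q,U}$.** Let $P_1=\mathrm{diag}(I_r,0)$, $P_2=\mathrm{diag}(0,I_r)$, $A_U=P_2-UP_1$, $B_U=P_1-UP_2$. In $L_2((-1,1),\mathbb C^{2r})$, $T_{q,U}y=J_ry'+\mathcal Q_qy$ on the domain of all AC functions $y$ on $[-1,1]$ with $J_ry'+\mathcal Q_qy\in L_2$ and $A_Uy(-1)+B_Uy(1)=0$. Let $\lambda_j$, $j\in\mathbb Z$, be its pairwise distinct eigenvalues, listed in increasing order so that $\lambda_0<0\le\lambda_1$. Let $Y(\cdot,\lambda)$ be the AC $2r\times 2r$ solution of $J_rY'+\mathcal Q_qY=\lambda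 Y$ on $[-1,1]$, $Y(0,\lambda)=I_{2r}$. Let $$M_j=\tfrac12\int_{-1}^1Y(s,\lambda_j)^*Y(s,\lambda_j)\,ds,$$ let $P_j$ be the orthogonal projector of $\mathbb C^{2r}$ onto $\mathcal E_j=\ker[A_UY(-1,\lambda_j)+B_UY(1,\lambda_j)]$, let $B_j=(P_jM_jP_j)|_{\mathcal E_j}:\mathcal E_j\to\mathcal E_j$ (which is invertible), and let $A_j=B_j^{-1}P_j$. The sequence $((\lambda_j,A_j))_{j\in\mathbb Z}$ is the spectral data of $T_{q,U}$. **The operator $S_{V,U}$.** For a $2r\times2r$ matrix function $V$ with entries in $L_p(0,1)$, in $L_2((0,1),\mathbb C^{4r})$ let $S_{V,U}f=J_{2r}f'+\mathcal Q_Vf$ on the domain of all AC functions $f=(f_1,f_2)^\top$ on $[0,1]$ ($f_1,f_2$ with values in $\mathbb C^{2r}$) with $J_{2r}f'+\mathcal Q_Vf\in L_2$, $f_1(0)=f_2(0)$ and $f_1(1)=Uf_2(1)$. Let $\zeta_j$, $j\in\mathbb Z$, be its pairwise distinct eigenvalues, listed in increasing order so that $\zeta_0<0\le\zeta_1$. Let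 $a=\frac1{\sqrt2}(I_{2r},\,-I_{2r})$ and $b_U=\frac1{\sqrt2}(U^{-1/2},\,-U^{1/2})$, where $U^{1/2}$ is the square root of $U$ whose eigenvalues are the numbers $e^{\mathrm i\gamma}$, $\gamma\in[0,\pi)$, for which $e^{2\mathrm i\gamma}$ is an eigenvalue of $U$. Let $\varphi(\cdot,\zeta),\psi(\cdot,\zeta)$ be the AC $4r\times2r$ solutions of $J_{2r}\varphi'+\mathcal Q_V\varphi=\zeta\varphi$, $\varphi(0,\zeta)=J_{2r}a^*$, and $J_{2r}\psi'+\mathcal Q_V\psi=\zeta\psi$, $\psi(0,\zeta)=a^*$. The Weyl–Titchmarsh function is $$M_{V,U}(\zeta)=-\big(b_U\varphi(1,\zeta)\big)^{-1}b_U\psi(1,\zeta),$$ and with $C_j=-\operatorname{res}_{\zeta=\zeta_j}M_{V,U}(\zeta)$ the sequence $((\zeta_j,C_j))_{j\in\mathbb Z}$ is the spectral data of $S_{V,U}$. **Lemma.** Let $$V(x)=\begin{pmatrix}0&q(x)\\q(-x)^*&0\end{pmatrix},\qquad x\in(0,1).$$ Then $T_{q,U}$ is unitarily equivalent to $S_{V,U}$: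 the folding map $$(\mathcal Vy)(x)=\big(y_1(x),\,y_2(-x),\,y_1(-x),\,y_2(x)\big)^\top,\qquad x\in(0,1),$$ where $y_1$, $y_2$ are the first $r$ and the last $r$ components of $y$, is a unitary map from $L_2((-1,1),\mathbb C^{2r})$ onto $L_2((0,1),\mathbb C^{4r})$, and $T_{q,U}=\mathcal V^{-1}S_{V,U}\mathcal V$. Moreover, the spectral data of both operators are well defined (each operator has exactly one such sequence), and they coincide: $\lambda_j=\zeta_j$ and $A_j=C_j$ for every $j\in\mathbb Z$. -/

import Mathlib

open MeasureTheory Set Filter Topology Matrix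

noncomputable section

namespace DiracFolding

/-! ### Absolutely continuous functions and the operators -/

/-- `g` is absolutely continuous on `[a,b]` (i.e. `g ∈ W¹₁(a,b)`) with a.e. derivative
`h ∈ L₁(a,b)`: it is an indefinite Lebesgue integral of `h`. -/
def IsPrimitiveOn (a b : ℝ) (g h : ℝ → ℂ) : Prop :=
  IntervalIntegrable h volume a b ∧ ∀ x ∈ Icc a b, g x = g a + ∫ t in a..x, h t

/-- The Hilbert space `L₂((a,b), ℂⁿ)`. -/
abbrev L2 (a b : ℝ) (n : Type) [Fintype n] : Type :=
  Lp (EuclideanSpace ℂ n) 2 (volume.restrict (Ioo a b))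

variable {n : Type} [Fintype n]

theorem IsPrimitiveOn.add {a b : ℝ} {g₁ g₂ h₁ h₂ : ℝ → ℂ} (H₁ : IsPrimitiveOn a b g₁ h₁)
    (H₂ : IsPrimitiveOn a b g₂ h₂) :
    IsPrimitiveOn a b (fun x => g₁ x + g₂ x) (fun x => h₁ x + h₂ x) := by
  refine ⟨H₁.1.add H₂.1, fun x hx => ?_⟩
  have hsub : uIcc a x ⊆ uIcc a b := by
    rw [uIcc_of_le hx.1, uIcc_of_le (hx.1.trans hx.2)]
    exact Icc_subset_Icc le_rfl hx.2
  beta_reduce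
  rw [intervalIntegral.integral_add (H₁.1.mono_set hsub) (H₂.1.mono_set hsub), H₁.2 x hx,
    H₂.2 x hx]
  ring

theorem IsPrimitiveOn.const_mul {a b : ℝ} {g h : ℝ → ℂ} (c : ℂ) (H : IsPrimitiveOn a b g h) :
    IsPrimitiveOn a b (fun x => c * g x) (fun x => c * h x) := by
  refine ⟨H.1.const_mul c, fun x hx => ?_⟩
  beta_reduce
  rw [intervalIntegral.integral_const_mul, H.2 x hx]
  ring

theorem IsPrimitiveOn.zero (a b : ℝ) : IsPrimitiveOn a b (fun _ => 0) (fun _ => 0) :=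
  ⟨intervalIntegrable_const, fun x _ => by simp⟩

/-- An absolutely continuous function that vanishes a.e. vanishes identically, and so does
(a.e.) its derivative. -/
theorem IsPrimitiveOn.eq_zero {a b : ℝ} (hab : a < b) {g h : ℝ → ℂ} (H : IsPrimitiveOn a b g h)
    (h0 : ∀ᵐ x ∂volume.restrict (Ioo a b), g x = 0) :
    ∀ᵐ x ∂volume.restrict (Ioo a b), g x = 0 ∧ h x = 0 := by
  have hcont : ContinuousOn g (Icc a b) := by
    have h1 : ContinuousOn (fun x => ∫ t in a..x, h t) (Icc a b) := by
      have := intervalIntegral.continuousOn_primitive_interval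
        (a := a) (b := b) (f := h) (μ := volume)
        ((intervalIntegrable_iff_integrableOn_Icc_of_le hab.le).1 H.1 |>.mono_set
          (by rw [uIcc_of_le hab.le]))
      rwa [uIcc_of_le hab.le] at this
    exact (continuousOn_const.add h1).congr fun x hx => H.2 x hx
  have hzero : ∀ x ∈ Ioo a b, g x = 0 := by
    have := Measure.eqOn_open_of_ae_eq (μ := volume) (U := Ioo a b) (f := g) (g := fun _ => 0)
      h0 isOpen_Ioo (hcont.mono Ioo_subset_Icc_self) continuousOn_const
    exact fun x hx => this hx
  rw [ae_restrict_iff' measurableSet_Ioo]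
  filter_upwards [H.1.ae_hasDerivAt_integral] with x hx hxab
  refine ⟨hzero x hxab, ?_⟩
  have h2 := hx (by rw [uIcc_of_le hab.le]; exact Ioo_subset_Icc_self hxab) a
    (by rw [uIcc_of_le hab.le]; exact left_mem_Icc.2 hab.le)
  have h3 : HasDerivAt (fun y => ∫ t in a..y, h t) 0 x := by
    refine (hasDerivAt_const x (-g a)).congr_of_eventuallyEq ?_
    filter_upwards [isOpen_Ioo.mem_nhds hxab] with y hy
    have := H.2 y (Ioo_subset_Icc_self hy)
    rw [hzero y hy] at this
    linear_combination -this
  exact h2.unique h3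

/-- The graph of the operator `y ↦ J y' + Q y` in `L₂((a,b), ℂⁿ)`, on the domain of all (classes of)
absolutely continuous `g` on `[a,b]` with `J g' + Q g ∈ L₂` and with boundary values
`(g(a), g(b)) ∈ bc`. -/
def diracGraph (a b : ℝ) (J : Matrix n n ℂ) (Q : ℝ → Matrix n n ℂ)
    (bc : Submodule ℂ ((n → ℂ) × (n → ℂ))) : Submodule ℂ (L2 a b n × L2 a b n) where
  carrier := {p | ∃ g g' : ℝ → n → ℂ,
    (∀ i, IsPrimitiveOn a b (fun x => g x i) (fun x => g' x i)) ∧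
    (∀ᵐ x ∂volume.restrict (Ioo a b), (p.1 x : EuclideanSpace ℂ n) = WithLp.toLp 2 (g x)) ∧
    (∀ᵐ x ∂volume.restrict (Ioo a b),
      (p.2 x : EuclideanSpace ℂ n) = WithLp.toLp 2 (J *ᵥ g' x + Q x *ᵥ g x)) ∧
    (g a, g b) ∈ bc}
  add_mem' := by
    rintro ⟨y₁, z₁⟩ ⟨y₂, z₂⟩ ⟨g₁, h₁, hp₁, hy₁, hz₁, hb₁⟩ ⟨g₂, h₂, hp₂, hy₂, hz₂, hb₂⟩
    refine ⟨g₁ + g₂, h₁ + h₂, fun i => (hp₁ i).add (hp₂ i), ?_, ?_, bc.add_mem hb₁ hb₂⟩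
    · filter_upwards [hy₁, hy₂, Lp.coeFn_add y₁ y₂] with x e₁ e₂ e
      change (y₁ + y₂ : L2 a b n) x = _
      rw [e, Pi.add_apply, e₁, e₂]; rfl
    · filter_upwards [hz₁, hz₂, Lp.coeFn_add z₁ z₂] with x e₁ e₂ e
      change (z₁ + z₂ : L2 a b n) x = _
      rw [e, Pi.add_apply, e₁, e₂, Pi.add_apply, Pi.add_apply, mulVec_add, mulVec_add,
        ← WithLp.toLp_add]
      congr 1
      abel
  zero_mem' := by
    refine ⟨0, 0, fun i => IsPrimitiveOn.zero a b, ?_, ?_, bc.zero_mem⟩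
    · filter_upwards [Lp.coeFn_zero (EuclideanSpace ℂ n) 2 (volume.restrict (Ioo a b))] with x e
      change (0 : L2 a b n) x = _
      rw [e]; rfl
    · filter_upwards [Lp.coeFn_zero (EuclideanSpace ℂ n) 2 (volume.restrict (Ioo a b))] with x e
      change (0 : L2 a b n) x = _
      rw [e]; simp
  smul_mem' := by
    rintro c ⟨y, z⟩ ⟨g, h, hp, hy, hz, hb⟩
    refine ⟨c • g, c • h, fun i => (hp i).const_mul c, ?_, ?_, bc.smul_mem c hb⟩
    · filter_upwards [hy, Lp.coeFn_smul c y] with x e₁ e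
      change (c • y : L2 a b n) x = _
      rw [e, Pi.smul_apply, e₁]; rfl
    · filter_upwards [hz, Lp.coeFn_smul c z] with x e₁ e
      change (c • z : L2 a b n) x = _
      rw [e, Pi.smul_apply, e₁, Pi.smul_apply, Pi.smul_apply, mulVec_smul, mulVec_smul,
        ← smul_add]
      rfl

/-- The unbounded operator `y ↦ J y' + Q y` in `L₂((a,b), ℂⁿ)` with boundary condition `bc`. -/
def diracOperator (a b : ℝ) (J : Matrix n n ℂ) (Q : ℝ → Matrix n n ℂ)
    (bc : Submodule ℂ ((n → ℂ) × (n → ℂ))) : L2 a b n →ₗ.[ℂ] L2 a b n :=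
  (diracGraph a b J Q bc).toLinearPMap

/-- The graph above is single-valued, so that it is indeed the graph of the operator. -/
theorem graph_diracOperator {a b : ℝ} (hab : a < b) (J : Matrix n n ℂ) (Q : ℝ → Matrix n n ℂ)
    (bc : Submodule ℂ ((n → ℂ) × (n → ℂ))) :
    (diracOperator a b J Q bc).graph = diracGraph a b J Q bc := by
  refine Submodule.toLinearPMap_graph_eq _ ?_
  rintro ⟨y, z⟩ ⟨g, h, hp, hy, hz, -⟩ (rfl : y = 0)
  change z = 0
  have hg : ∀ᵐ x ∂volume.restrict (Ioo a b), g x = 0 := by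
    filter_upwards [hy, Lp.coeFn_zero (EuclideanSpace ℂ n) 2 (volume.restrict (Ioo a b))]
      with x e₁ e
    rw [e] at e₁
    exact congrArg WithLp.ofLp e₁.symm
  have hgh : ∀ᵐ x ∂volume.restrict (Ioo a b), ∀ i, g x i = 0 ∧ h x i = 0 :=
    ae_all_iff.2 fun i => (hp i).eq_zero hab (hg.mono fun x hx => by rw [hx]; rfl)
  refine Lp.ext ?_
  filter_upwards [hgh, hz, Lp.coeFn_zero (EuclideanSpace ℂ n) 2 (volume.restrict (Ioo a b))]
    with x e₁ e₂ e
  have hg0 : g x = 0 := funext fun i => (e₁ i).1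
  have hh0 : h x = 0 := funext fun i => (e₁ i).2
  rw [e]
  change z x = _
  rw [show z x = _ from e₂, hg0, hh0]
  simp

/-- `z` is an eigenvalue of the unbounded operator `T`. -/
def IsEigenvalue {H : Type} [AddCommGroup H] [Module ℂ H] (T : H →ₗ.[ℂ] H) (z : ℂ) : Prop :=
  ∃ y : T.domain, (y : H) ≠ 0 ∧ T y = z • (y : H)

/-- `lam : ℤ → ℝ` lists the pairwise distinct eigenvalues of `T` (all of which are then real)
in increasing order, labelled so that `lam 0 < 0 ≤ lam 1`. -/
structure IsEigenvalueLabelling {H : Type} [AddCommGroup H] [Module ℂ H] (T : H →ₗ.[ℂ] H)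
    (lam : ℤ → ℝ) : Prop where
  strictMono : StrictMono lam
  isEigenvalue_iff : ∀ z : ℂ, IsEigenvalue T z ↔ ∃ j, z = (lam j : ℂ)
  zero_neg : lam 0 < 0
  one_nonneg : 0 ≤ lam 1

variable [DecidableEq n]

/-- The matrix `(1/i) diag(I, -I)`. -/
def diracJ (n : Type) [DecidableEq n] : Matrix (n ⊕ n) (n ⊕ n) ℂ :=
  (1 / Complex.I) • fromBlocks 1 0 0 (-1)

/-- The matrix function `x ↦ [[0, V(x)], [V(x)*, 0]]`. -/
def diracPotential (V : ℝ → Matrix n n ℂ) (x : ℝ) : Matrix (n ⊕ n) (n ⊕ n) ℂ :=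
  fromBlocks 0 (V x) (V x)ᴴ 0

/-- `Y` is an absolutely continuous solution on `[a,b]` of the Cauchy problem
`J Y' + Q Y = z Y`, `Y(x₀) = Y₀`. -/
def IsCauchySolution {m : Type} (a b x₀ : ℝ) (J : Matrix n n ℂ) (Q : ℝ → Matrix n n ℂ) (z : ℂ)
    (Y₀ : Matrix n m ℂ) (Y : ℝ → Matrix n m ℂ) : Prop :=
  (∃ Y' : ℝ → Matrix n m ℂ,
    (∀ i k, IsPrimitiveOn a b (fun x => Y x i k) (fun x => Y' x i k)) ∧
    ∀ᵐ x ∂volume.restrict (Ioo a b), J * Y' x + Q x * Y x = z • Y x) ∧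
  Y x₀ = Y₀

/-! ### The operator `T` on `(-1,1)` and its spectral data; here `2r` is `Fin r ⊕ Fin r` -/

variable {r : ℕ}

/-- The matrix `A_U = P₂ - U P₁`. -/
def matA (U : Matrix (Fin r ⊕ Fin r) (Fin r ⊕ Fin r) ℂ) :
    Matrix (Fin r ⊕ Fin r) (Fin r ⊕ Fin r) ℂ :=
  fromBlocks 0 0 0 1 - U * fromBlocks 1 0 0 0

/-- The matrix `B_U = P₁ - U P₂`. -/
def matB (U : Matrix (Fin r ⊕ Fin r) (Fin r ⊕ Fin r) ℂ) :
    Matrix (Fin r ⊕ Fin r) (Fin r ⊕ Fin r) ℂ :=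
  fromBlocks 1 0 0 0 - U * fromBlocks 0 0 0 1

/-- The boundary condition `A_U y(-1) + B_U y(1) = 0`. -/
def bcT (U : Matrix (Fin r ⊕ Fin r) (Fin r ⊕ Fin r) ℂ) :
    Submodule ℂ ((Fin r ⊕ Fin r → ℂ) × (Fin r ⊕ Fin r → ℂ)) where
  carrier := {p | matA U *ᵥ p.1 + matB U *ᵥ p.2 = 0}
  add_mem' := by
    rintro p p' (h : _ = _) (h' : _ = _)
    change matA U *ᵥ (p.1 + p'.1) + matB U *ᵥ (p.2 + p'.2) = 0
    rw [mulVec_add, mulVec_add, add_add_add_comm, h, h', add_zero]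
  zero_mem' := by simp
  smul_mem' := by
    rintro c p (h : _ = _)
    change matA U *ᵥ (c • p.1) + matB U *ᵥ (c • p.2) = 0
    rw [mulVec_smul, mulVec_smul, ← smul_add, h, smul_zero]

/-- The operator `T_{q,U}` in `L₂((-1,1), ℂ^{2r})`. -/
def opT (q : ℝ → Matrix (Fin r) (Fin r) ℂ) (U : Matrix (Fin r ⊕ Fin r) (Fin r ⊕ Fin r) ℂ) :
    L2 (-1) 1 (Fin r ⊕ Fin r) →ₗ.[ℂ] L2 (-1) 1 (Fin r ⊕ Fin r) :=
  diracOperator (-1) 1 (diracJ (Fin r)) (diracPotential q) (bcT U)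

/-- The matrix `½ ∫_{-1}^1 Y(s)* Y(s) ds`. -/
def gramMatrix (Y : ℝ → Matrix (Fin r ⊕ Fin r) (Fin r ⊕ Fin r) ℂ) :
    Matrix (Fin r ⊕ Fin r) (Fin r ⊕ Fin r) ℂ :=
  Matrix.of fun i k => (1 / 2) * ∫ s in (-1 : ℝ)..1, ((Y s)ᴴ * Y s) i k

/-- `A = B⁻¹ P`, where `P` is the orthogonal projector of `ℂⁿ` onto `E = ker K` and
`B = (P M P)|_E : E → E` (which is required to be invertible). -/
def IsNormingMatrix (K M A : Matrix n n ℂ) : Prop :=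
  ∃ B : (LinearMap.ker (toEuclideanLin K)) ≃ₗ[ℂ] (LinearMap.ker (toEuclideanLin K)),
    (∀ v, B v = (LinearMap.ker (toEuclideanLin K)).orthogonalProjectionOnto
      (toEuclideanLin M (v : EuclideanSpace ℂ n))) ∧
    ∀ v : EuclideanSpace ℂ n, toEuclideanLin A v =
      B.symm ((LinearMap.ker (toEuclideanLin K)).orthogonalProjectionOnto v)

/-- `(λ_j, A_j)_{j ∈ ℤ}` is the spectral data of `T_{q,U}`: the `λ_j` are its eigenvalues and the
`A_j` its norming matrices, built from the solution `Y` of the Cauchy problem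
`J Y' + Q Y = λ_j Y`, `Y(0) = I`. -/
def IsSpectralDataT (q : ℝ → Matrix (Fin r) (Fin r) ℂ)
    (U : Matrix (Fin r ⊕ Fin r) (Fin r ⊕ Fin r) ℂ)
    (d : ℤ → ℝ × Matrix (Fin r ⊕ Fin r) (Fin r ⊕ Fin r) ℂ) : Prop :=
  IsEigenvalueLabelling (opT q U) (fun j => (d j).1) ∧
  ∀ j, ∃ Y : ℝ → Matrix (Fin r ⊕ Fin r) (Fin r ⊕ Fin r) ℂ,
    IsCauchySolution (-1) 1 0 (diracJ (Fin r)) (diracPotential q) ((d j).1 : ℂ) 1 Y ∧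
    IsNormingMatrix (matA U * Y (-1) + matB U * Y 1) (gramMatrix Y) (d j).2

/-! ### The operator `S` on `(0,1)`, its Weyl function and its spectral data -/

/-- The boundary condition `f₁(0) = f₂(0)`, `f₁(1) = U f₂(1)`. -/
def bcS (U : Matrix n n ℂ) : Submodule ℂ ((n ⊕ n → ℂ) × (n ⊕ n → ℂ)) where
  carrier := {p | (p.1 ∘ Sum.inl = p.1 ∘ Sum.inr) ∧ (p.2 ∘ Sum.inl = U *ᵥ (p.2 ∘ Sum.inr))}
  add_mem' := by
    rintro p p' ⟨h₁, h₂⟩ ⟨h₁', h₂'⟩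
    refine ⟨?_, ?_⟩
    · change p.1 ∘ Sum.inl + p'.1 ∘ Sum.inl = p.1 ∘ Sum.inr + p'.1 ∘ Sum.inr
      rw [h₁, h₁']
    · change p.2 ∘ Sum.inl + p'.2 ∘ Sum.inl = U *ᵥ (p.2 ∘ Sum.inr + p'.2 ∘ Sum.inr)
      rw [mulVec_add, h₂, h₂']
  zero_mem' := by
    refine ⟨rfl, ?_⟩
    change (0 : n → ℂ) = U *ᵥ 0
    rw [mulVec_zero]
  smul_mem' := by
    rintro c p ⟨h₁, h₂⟩
    refine ⟨?_, ?_⟩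
    · change c • (p.1 ∘ Sum.inl) = c • (p.1 ∘ Sum.inr)
      rw [h₁]
    · change c • (p.2 ∘ Sum.inl) = U *ᵥ (c • (p.2 ∘ Sum.inr))
      rw [mulVec_smul, h₂]

/-- The operator `S_{V,U}` in `L₂((0,1), ℂ^{2n})`. -/
def opS (V : ℝ → Matrix n n ℂ) (U : Matrix n n ℂ) : L2 0 1 (n ⊕ n) →ₗ.[ℂ] L2 0 1 (n ⊕ n) :=
  diracOperator 0 1 (diracJ n) (diracPotential V) (bcS U)

/-- The matrix `a = (1/√2) (I, -I)`. -/
def mata (n : Type) [DecidableEq n] : Matrix n (n ⊕ n) ℂ :=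
  ((1 / Real.sqrt 2 : ℝ) : ℂ) • fromCols 1 (-1)

/-- `R = U^{1/2}`: the square root of `U` whose eigenvalues are the numbers `e^{iγ}`, `γ ∈ [0,π)`,
for which `e^{2iγ}` is an eigenvalue of `U`. -/
def IsHalfPower (U R : Matrix n n ℂ) : Prop :=
  R * R = U ∧ spectrum ℂ R = {w | ∃ γ ∈ Ico 0 Real.pi,
    w = Complex.exp (γ * Complex.I) ∧ Complex.exp (2 * γ * Complex.I) ∈ spectrum ℂ U}

/-- The matrix `b_U = (1/√2) (U^{-1/2}, -U^{1/2})` in terms of `R = U^{1/2}`. -/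
def matb (R : Matrix n n ℂ) : Matrix n (n ⊕ n) ℂ :=
  ((1 / Real.sqrt 2 : ℝ) : ℂ) • fromCols R⁻¹ (-R)

/-- `M` is the Weyl–Titchmarsh function of `S_{V,U}`: `M(ζ) = -s(ζ)⁻¹ c(ζ)` wherever `s(ζ)` is
invertible, with `s(ζ) = b_U φ(1,ζ)` and `c(ζ) = b_U ψ(1,ζ)`, where `φ`, `ψ` solve the Dirac system
with initial values `φ(0,ζ) = J a*`, `ψ(0,ζ) = a*`. -/
def IsWeylFunction (V : ℝ → Matrix n n ℂ) (U : Matrix n n ℂ) (M : ℂ → Matrix n n ℂ) : Prop :=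
  ∃ (R : Matrix n n ℂ) (φ ψ : ℂ → ℝ → Matrix (n ⊕ n) n ℂ), IsHalfPower U R ∧
    (∀ ζ, IsCauchySolution 0 1 0 (diracJ n) (diracPotential V) ζ (diracJ n * (mata n)ᴴ) (φ ζ)) ∧
    (∀ ζ, IsCauchySolution 0 1 0 (diracJ n) (diracPotential V) ζ (mata n)ᴴ (ψ ζ)) ∧
    ∀ ζ, IsUnit (matb R * φ ζ 1) → M ζ = -((matb R * φ ζ 1)⁻¹ * (matb R * ψ ζ 1))

/-- The matrix-valued function `M` is meromorphic at `z` with residue `C` there: entrywise,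
`(2πi)⁻¹ ∮_{|ζ-z|=ε} M(ζ) dζ = C` for all small `ε > 0`. -/
def HasResidueAt (M : ℂ → Matrix n n ℂ) (z : ℂ) (C : Matrix n n ℂ) : Prop :=
  ∀ i k, MeromorphicAt (fun ζ => M ζ i k) z ∧
    ∀ᶠ ε in 𝓝[>] (0 : ℝ),
      (2 * Real.pi * Complex.I)⁻¹ * circleIntegral (fun ζ => M ζ i k) z ε = C i k

/-- `(ζ_j, C_j)_{j ∈ ℤ}` is the spectral data of `S_{V,U}`: the `ζ_j` are its eigenvalues and
`-C_j` is the residue at `ζ_j` of its Weyl–Titchmarsh function. -/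
def IsSpectralDataS (V : ℝ → Matrix n n ℂ) (U : Matrix n n ℂ) (d : ℤ → ℝ × Matrix n n ℂ) : Prop :=
  IsEigenvalueLabelling (opS V U) (fun j => (d j).1) ∧
  ∃ M, IsWeylFunction V U M ∧ ∀ j, HasResidueAt M ((d j).1 : ℂ) (-(d j).2)

/-! ### Folding -/

/-- The folded potential `V(x) = [[0, q(x)], [q(-x)*, 0]]`. -/
def foldPotential (q : ℝ → Matrix (Fin r) (Fin r) ℂ) (x : ℝ) :
    Matrix (Fin r ⊕ Fin r) (Fin r ⊕ Fin r) ℂ :=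
  fromBlocks 0 (q x) (q (-x))ᴴ 0

/-- The folding `(y₁(x), y₂(-x), y₁(-x), y₂(x))ᵀ` of a function `y = (y₁, y₂)ᵀ` on `(-1,1)`. -/
def fold (y : ℝ → EuclideanSpace ℂ (Fin r ⊕ Fin r)) (x : ℝ) :
    EuclideanSpace ℂ ((Fin r ⊕ Fin r) ⊕ (Fin r ⊕ Fin r)) :=
  WithLp.toLp 2 (Sum.elim
    (Sum.elim (fun i => y x (Sum.inl i)) (fun i => y (-x) (Sum.inr i)))
    (Sum.elim (fun i => y (-x) (Sum.inl i)) (fun i => y x (Sum.inr i))))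

end DiracFolding

end

noncomputable section

namespace DiracFolding

/-! The fold cuts a function on (-1,1) at 0 and reflects its left half onto (0,1). Reflection
changes the sign of derivatives, but the reflected components are placed where `J_{2r}` has the sign
opposite to that of `J_r`; the signs cancel and the Dirac expression keeps its form, with potential
V (`dirac_foldV`). The condition f₁(0) = f₂(0) says that the two halves join continuously at 0, and
f₁(1) = U f₂(1) is the boundary condition of T. Hence the fold matches the graphs of the two
operators (`mem_graph_opT_iff`), and so their eigenvalues.

For the matrix parts, write J a* = κ (I, I)ᵀ with κ = 1/(i√2). Since Y(0) = I folds to (I, I)ᵀ, the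
fold of Y is κ⁻¹φ. The boundary matrix of T is therefore κ⁻¹ times K = (I, -U)φ(1,λ), and the Gram
matrix M_j equals G = ∫₀¹ φ*φ. Let C be minus the residue of the Weyl function. Two equations
suffice: K C = 0, and v*GC = v* for every v in E = ker K. They say that C maps into E and that PGC =
P, so PG is onto as a map E → E, hence invertible there, and C is its inverse times P
(`isNormingMatrix_iff`).

The analytic work shows that the data of S exist and satisfy these equations. Lagrange's identity
for the Weyl solution χ = ψ + φM gives M(z) - M(w)* = (z - w̄)∫χ(w)*χ(z) (`weylM_sub`). Together
with a two-sided Grönwall bound that depends on z only through |Im z|, it makes the real poles of M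
simple, and makes the arctangent of a real diagonal entry of M grow at a fixed minimal rate between
poles, so that gaps between eigenvalues are bounded. Lagrange's identity for φv excludes non-real
eigenvalues; the zeros of the entire function det K are then isolated, and the eigenvalues can be
labelled by ℤ. Lagrange's identity between φv and χ, passed to the limit at a pole, is the second
equation for C (`phiGram_mul_residue`). -/

/-! ### Indefinite integrals with values in a Banach space -/

/-- A function whose increments are dominated by those of an absolutely continuous function is
absolutely continuous. -/
theorem _root_.AbsolutelyContinuousOnInterval.of_dist_le {X Y : Type*} [PseudoMetricSpace X]
    [PseudoMetricSpace Y] {a b K : ℝ} {f : ℝ → X} {g : ℝ → Y}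
    (hf : AbsolutelyContinuousOnInterval f a b)
    (h : ∀ x ∈ uIcc a b, ∀ y ∈ uIcc a b, dist (g x) (g y) ≤ K * dist (f x) (f y)) :
    AbsolutelyContinuousOnInterval g a b := by
  have h0 := Tendsto.const_mul K hf
  rw [mul_zero] at h0
  refine squeeze_zero' (Eventually.of_forall fun E => Finset.sum_nonneg fun _ _ => dist_nonneg)
    ?_ h0
  have : AbsolutelyContinuousOnInterval.disjWithin a b ∈
      AbsolutelyContinuousOnInterval.totalLengthFilter ⊓
        𝓟 (AbsolutelyContinuousOnInterval.disjWithin a b) :=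
    mem_inf_of_right (mem_principal_self _)
  filter_upwards [this] with E hE
  rw [Finset.mul_sum]
  exact Finset.sum_le_sum fun i hi => h _ (hE.1 i hi).1 _ (hE.1 i hi).2

section Primitives

variable {F : Type*} [NormedAddCommGroup F] [NormedSpace ℝ F]

/-- `g` is the indefinite Lebesgue integral of `h` on `[a,b]`. -/
def IsPrimOn (a b : ℝ) (g h : ℝ → F) : Prop :=
  IntervalIntegrable h volume a b ∧ ∀ x ∈ Icc a b, g x = g a + ∫ t in a..x, h t

theorem isPrimitiveOn_iff {a b : ℝ} {g h : ℝ → ℂ} : IsPrimitiveOn a b g h ↔ IsPrimOn a b g h :=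
  Iff.rfl

theorem intervalIntegrable_congr_ae_Ioo {F : Type*} [NormedAddCommGroup F] {a b : ℝ} (hab : a ≤ b)
    {h h' : ℝ → F} (hh : ∀ᵐ x ∂volume.restrict (Ioo a b), h x = h' x)
    (H : IntervalIntegrable h volume a b) : IntervalIntegrable h' volume a b := by
  rw [intervalIntegrable_iff_integrableOn_Ioo_of_le hab] at *
  exact Integrable.congr H hh

theorem intervalIntegral_congr_ae_Ioo {a b x : ℝ} (hx : x ∈ Icc a b) {h h' : ℝ → F}
    (hh : ∀ᵐ x ∂volume.restrict (Ioo a b), h x = h' x) :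
    ∫ t in a..x, h t = ∫ t in a..x, h' t := by
  rw [intervalIntegral.integral_of_le hx.1, intervalIntegral.integral_of_le hx.1,
    integral_Ioc_eq_integral_Ioo, integral_Ioc_eq_integral_Ioo]
  exact integral_congr_ae (ae_restrict_of_ae_restrict_of_subset (Ioo_subset_Ioo_right hx.2) hh)

/-- Increments of the integral of h are dominated by those of the real integral of ‖h‖, for which
absolute continuity is known. -/
theorem _root_.IntervalIntegrable.absolutelyContinuousOnInterval_add_integral {a b : ℝ}
    {h : ℝ → F} (H : IntervalIntegrable h volume a b) (c : F) :
    AbsolutelyContinuousOnInterval (fun x => c + ∫ t in a..x, h t) a b := by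
  refine (H.norm.absolutelyContinuousOnInterval_intervalIntegral
    (c := a) left_mem_uIcc).of_dist_le (K := 1) fun x hx y hy => ?_
  have hi : ∀ z ∈ uIcc a b, IntervalIntegrable h volume a z := fun z hz =>
    H.mono_set (uIcc_subset_uIcc_left hz)
  rw [dist_add_left, dist_eq_norm, dist_eq_norm,
    intervalIntegral.integral_interval_sub_left (hi x hx) (hi y hy),
    intervalIntegral.integral_interval_sub_left (hi x hx).norm (hi y hy).norm, one_mul]
  exact intervalIntegral.norm_integral_le_abs_integral_norm

namespace IsPrimOn

variable {a b : ℝ} {g h : ℝ → F}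

theorem congr_deriv (hab : a ≤ b) (H : IsPrimOn a b g h) {h' : ℝ → F}
    (hh : ∀ᵐ x ∂volume.restrict (Ioo a b), h x = h' x) : IsPrimOn a b g h' :=
  ⟨intervalIntegrable_congr_ae_Ioo hab hh H.1, fun x hx => by
    rw [H.2 x hx, intervalIntegral_congr_ae_Ioo hx hh]⟩

theorem congr (hab : a ≤ b) (H : IsPrimOn a b g h) {g' : ℝ → F}
    (hg : ∀ x ∈ Icc a b, g x = g' x) : IsPrimOn a b g' h :=
  ⟨H.1, fun x hx => by
    rw [← hg x hx, ← hg a (left_mem_Icc.2 hab)]; exact H.2 x hx⟩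

theorem ac (hab : a ≤ b) (H : IsPrimOn a b g h) : AbsolutelyContinuousOnInterval g a b := by
  refine (H.1.absolutelyContinuousOnInterval_add_integral (g a)).of_dist_le (K := 1)
    fun x hx y hy => ?_
  rw [uIcc_of_le hab] at hx hy
  rw [one_mul, ← H.2 x hx, ← H.2 y hy]

theorem continuousOn (hab : a ≤ b) (H : IsPrimOn a b g h) : ContinuousOn g (Icc a b) := by
  have := (H.ac hab).continuousOn
  rwa [uIcc_of_le hab] at this

theorem of_const (c : F) : IsPrimOn a b (fun _ => c) (fun _ => 0) :=
  ⟨intervalIntegrable_const, fun x _ => by simp⟩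

theorem add {g₁ g₂ h₁ h₂ : ℝ → F} (hab : a ≤ b) (H₁ : IsPrimOn a b g₁ h₁)
    (H₂ : IsPrimOn a b g₂ h₂) : IsPrimOn a b (fun x => g₁ x + g₂ x) (fun x => h₁ x + h₂ x) := by
  refine ⟨H₁.1.add H₂.1, fun x hx => ?_⟩
  have hs : uIcc a x ⊆ uIcc a b := uIcc_subset_uIcc_left (by rwa [uIcc_of_le hab])
  beta_reduce
  rw [intervalIntegral.integral_add (H₁.1.mono_set hs) (H₂.1.mono_set hs), H₁.2 x hx, H₂.2 x hx]
  abel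

theorem sum {ι : Type*} (s : Finset ι) {g h : ι → ℝ → F} (hab : a ≤ b)
    (H : ∀ i ∈ s, IsPrimOn a b (g i) (h i)) :
    IsPrimOn a b (fun x => ∑ i ∈ s, g i x) (fun x => ∑ i ∈ s, h i x) := by
  classical
  induction s using Finset.induction_on with
  | empty => simpa using of_const (0 : F)
  | insert i s hi ih =>
    simp only [Finset.sum_insert hi]
    exact (H i (Finset.mem_insert_self i s)).add hab
      (ih fun j hj => H j (Finset.mem_insert_of_mem hj))

variable [CompleteSpace F]

theorem ae_hasDerivAt (hab : a ≤ b) (H : IsPrimOn a b g h) :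
    ∀ᵐ x ∂volume.restrict (Ioo a b), HasDerivAt g (h x) x := by
  rw [ae_restrict_iff' measurableSet_Ioo]
  filter_upwards [H.1.ae_hasDerivAt_integral] with x hx hxab
  rw [uIcc_of_le hab] at hx
  refine ((hx (Ioo_subset_Icc_self hxab) a (left_mem_Icc.2 hab)).const_add (g a)).congr_of_eventuallyEq ?_
  filter_upwards [isOpen_Ioo.mem_nhds hxab] with y hy
  exact H.2 y (Ioo_subset_Icc_self hy)

/-- The difference of g and the integral of h is absolutely continuous with derivative zero almost
everywhere, hence constant. Products and exponentials of primitives are recognised as primitives by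
this criterion. -/
theorem of_ac (hab : a ≤ b) (hg : AbsolutelyContinuousOnInterval g a b)
    (hh : IntervalIntegrable h volume a b)
    (hd : ∀ᵐ x ∂volume.restrict (Ioo a b), HasDerivAt g (h x) x) : IsPrimOn a b g h := by
  refine ⟨hh, ?_⟩
  have h1 := hg.sub (hh.absolutelyContinuousOnInterval_add_integral 0)
  obtain ⟨C, hC⟩ := h1.const_of_ae_hasDerivAt_zero (by
    rw [uIcc_of_le hab]
    rw [Measure.restrict_congr_set Ioo_ae_eq_Icc, ae_restrict_iff' measurableSet_Icc] at hd
    filter_upwards [hd, hh.ae_hasDerivAt_integral] with x hx hx' hxab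
    have h2 := hx' (by rwa [uIcc_of_le hab]) a left_mem_uIcc
    simpa using (hx hxab).sub (h2.const_add 0))
  rw [uIcc_of_le hab] at hC
  intro x hx
  have e1 := hC x hx
  have e2 := hC a (left_mem_Icc.2 hab)
  simp only [Pi.sub_apply, zero_add, intervalIntegral.integral_same, sub_zero] at e1 e2
  rw [e2, ← e1]; abel

theorem clm_comp {G : Type*} [NormedAddCommGroup G] [NormedSpace ℝ G] [CompleteSpace G]
    (hab : a ≤ b) (H : IsPrimOn a b g h)
    (L : F →L[ℝ] G) : IsPrimOn a b (fun x => L (g x)) (fun x => L (h x)) := by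
  refine ⟨⟨L.integrable_comp H.1.1, L.integrable_comp H.1.2⟩, fun x hx => ?_⟩
  have hi : IntervalIntegrable h volume a x := H.1.mono_set (uIcc_subset_uIcc_left (by
    rwa [uIcc_of_le hab]))
  rw [L.intervalIntegral_comp_comm hi, ← map_add, ← H.2 x hx]

theorem smul {𝕜 : Type*} [RCLike 𝕜] [NormedSpace 𝕜 F]
    [IsScalarTower ℝ 𝕜 F] {f k : ℝ → 𝕜} (hab : a ≤ b) (H₁ : IsPrimOn a b f k)
    (H₂ : IsPrimOn a b g h) :
    IsPrimOn a b (fun x => f x • g x) (fun x => f x • h x + k x • g x) := by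
  have hc₁ : ContinuousOn f (uIcc a b) := by rw [uIcc_of_le hab]; exact H₁.continuousOn hab
  have hc₂ : ContinuousOn g (uIcc a b) := by rw [uIcc_of_le hab]; exact H₂.continuousOn hab
  refine of_ac hab ((H₁.ac hab).fun_smul (H₂.ac hab))
    ((H₂.1.continuousOn_smul hc₁).add (H₁.1.smul_continuousOn hc₂)) ?_
  filter_upwards [H₁.ae_hasDerivAt hab, H₂.ae_hasDerivAt hab] with x h1 h2
  exact h1.smul h2

theorem mul {𝕜 : Type*} [RCLike 𝕜] {f k g h : ℝ → 𝕜} (hab : a ≤ b) (H₁ : IsPrimOn a b f k)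
    (H₂ : IsPrimOn a b g h) :
    IsPrimOn a b (fun x => f x * g x) (fun x => f x * h x + k x * g x) :=
  H₁.smul hab H₂

/-- A bound C for f confines its values to (-∞, C], where the exponential is Lipschitz with constant
e^C. -/
theorem exp {f k : ℝ → ℝ} (hab : a ≤ b) (H : IsPrimOn a b f k) :
    IsPrimOn a b (fun x => Real.exp (f x)) (fun x => Real.exp (f x) * k x) := by
  obtain ⟨C, hC⟩ := (H.ac hab).exists_bound
  have hL : ∀ x ∈ Iic C, ∀ y ∈ Iic C, dist (Real.exp x) (Real.exp y) ≤ Real.exp C * dist x y := by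
    intro x hx y hy
    rw [dist_eq_norm, dist_eq_norm]
    exact (convex_Iic C).norm_image_sub_le_of_norm_hasDerivWithin_le
      (fun z _ => (Real.hasDerivAt_exp z).hasDerivWithinAt)
      (fun z hz => by rw [Real.norm_of_nonneg (Real.exp_pos z).le]; exact Real.exp_le_exp.2 hz)
      hy hx
  have hc : ContinuousOn f (uIcc a b) := by rw [uIcc_of_le hab]; exact H.continuousOn hab
  refine of_ac hab ((H.ac hab).of_dist_le fun x hx y hy => hL _ ((le_abs_self _).trans (hC x hx)) _
    ((le_abs_self _).trans (hC y hy))) (H.1.continuousOn_mul (Real.continuous_exp.comp_continuousOn hc)) ?_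
  filter_upwards [H.ae_hasDerivAt hab] with x h1
  exact h1.exp

theorem apply_left_le {g h : ℝ → ℝ} (H : IsPrimOn a b g h)
    (hh : ∀ᵐ x ∂volume.restrict (Ioo a b), 0 ≤ h x) (x : ℝ) (hx : x ∈ Icc a b) : g a ≤ g x := by
  rw [H.2 x hx]
  have : 0 ≤ ∫ t in a..x, h t := by
    rw [intervalIntegral.integral_of_le hx.1, integral_Ioc_eq_integral_Ioo]
    exact integral_nonneg_of_ae
      (ae_restrict_of_ae_restrict_of_subset (Ioo_subset_Ioo_right hx.2) hh)
  linarith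

/-- **Grönwall's inequality** with an integrable rate, from above and from below. -/
theorem gronwall {N N' k : ℝ → ℝ} (hab : a ≤ b) (H : IsPrimOn a b N N')
    (hk : IntervalIntegrable k volume a b)
    (hN : ∀ᵐ x ∂volume.restrict (Ioo a b), |N' x| ≤ k x * N x) (x : ℝ) (hx : x ∈ Icc a b) :
    N x ≤ Real.exp (∫ t in a..x, k t) * N a ∧ N a ≤ Real.exp (∫ t in a..x, k t) * N x := by
  -- Integrating factors: with K the primitive of k, e^K N is nondecreasing and e^(-K) N is
  -- nonincreasing; the latter is negated so that `apply_left_le` serves for both.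
  have hK : IsPrimOn a b (fun x => ∫ t in a..x, k t) k := ⟨hk, fun x _ => by simp⟩
  have hK' : IsPrimOn a b (fun x => -∫ t in a..x, k t) (fun x => - k x) :=
    ⟨hk.neg, fun x _ => by simp⟩
  have h1 := (((hK.exp hab).mul hab H).apply_left_le (by
    filter_upwards [hN] with y hy
    have := (abs_le.1 hy).1
    have := mul_nonneg (Real.exp_pos (∫ t in a..y, k t)).le
      (show 0 ≤ N' y + k y * N y by linarith)
    nlinarith)) x hx
  have h2 := ((((hK'.exp hab).mul hab H).clm_comp hab (-(ContinuousLinearMap.id ℝ ℝ))).apply_left_le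
    (by
    filter_upwards [hN] with y hy
    have := (abs_le.1 hy).2
    have := mul_nonneg (Real.exp_pos (-∫ t in a..y, k t)).le
      (show 0 ≤ k y * N y - N' y by linarith)
    simp
    nlinarith)) x hx
  simp only [intervalIntegral.integral_same, neg_zero, Real.exp_zero, one_mul,
    _root_.neg_apply, ContinuousLinearMap.id_apply, neg_le_neg_iff] at h1 h2
  refine ⟨?_, h1⟩
  rw [Real.exp_neg, inv_mul_le_iff₀ (Real.exp_pos _)] at h2
  exact h2

end IsPrimOn
end Primitives

/-! ### Linear differential equations with integrable coefficients -/

theorem IsPrimOn.pow {a b : ℝ} {f k : ℝ → ℝ} (hab : a ≤ b) (H : IsPrimOn a b f k) (n : ℕ) :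
    IsPrimOn a b (fun x => f x ^ (n + 1)) (fun x => (n + 1) * (k x * f x ^ n)) := by
  induction n with
  | zero => simpa using H
  | succ n ih =>
    have := ih.mul hab H
    simp only [← pow_succ] at this
    refine this.congr_deriv hab (ae_of_all _ fun x => ?_)
    push_cast
    ring

/-- The inductive step of the Picard bound: it reproduces the terms of the exponential series even
though k is only integrable. -/
theorem integral_mul_pow_div_factorial {a b : ℝ} {k : ℝ → ℝ} (hab : a ≤ b)
    (hk : IntervalIntegrable k volume a b) (n : ℕ) {x : ℝ} (hx : x ∈ Icc a b) :
    ∫ t in a..x, k t * ((∫ s in a..t, k s) ^ n / n.factorial) =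
      (∫ s in a..x, k s) ^ (n + 1) / (n + 1).factorial := by
  have hK : IsPrimOn a b (fun x => ∫ t in a..x, k t) k := ⟨hk, fun x _ => by simp⟩
  have h1 := (hK.pow hab n).2 x hx
  simp only [intervalIntegral.integral_same, intervalIntegral.integral_const_mul] at h1
  simp only [← mul_div_assoc, intervalIntegral.integral_div]
  rw [h1, Nat.factorial_succ]
  push_cast
  have : (n.factorial : ℝ) ≠ 0 := by positivity
  have : (n + 1 : ℝ) ≠ 0 := by positivity
  field_simp
  ring

section Existence

variable {m : Type} [Fintype m]

/-- The entrywise `ℓ¹` norm of a matrix. -/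
def entryNorm {k : Type} [Fintype k] (A : Matrix m k ℂ) : ℝ := ∑ i, ∑ j, ‖A i j‖

theorem entryNorm_nonneg {k : Type} [Fintype k] (A : Matrix m k ℂ) : 0 ≤ entryNorm A :=
  Finset.sum_nonneg fun _ _ => Finset.sum_nonneg fun _ _ => norm_nonneg _

theorem intervalIntegrable_entryNorm {k : Type} [Fintype k] {a b : ℝ} {A : ℝ → Matrix m k ℂ}
    (hA : ∀ i j, IntervalIntegrable (fun x => A x i j) volume a b) :
    IntervalIntegrable (fun x => entryNorm (A x)) volume a b := by
  unfold entryNorm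
  have := IntervalIntegrable.sum (μ := volume) (a := a) (b := b) Finset.univ
    (f := fun i x => ∑ j, ‖A x i j‖) fun i _ => by
      have := IntervalIntegrable.sum (μ := volume) (a := a) (b := b) Finset.univ
        (f := fun j x => ‖A x i j‖) fun j _ => (hA i j).norm
      simpa only [Finset.sum_fn] using this
  simpa only [Finset.sum_fn] using this

theorem norm_mulVec_le_entryNorm_mul {A : Matrix m m ℂ} {u : m → ℂ} {C : ℝ} (hu : ∀ i, ‖u i‖ ≤ C)
    (i : m) : ‖(A *ᵥ u) i‖ ≤ entryNorm A * C := by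
  have hC : 0 ≤ C := (norm_nonneg _).trans (hu i)
  calc ‖(A *ᵥ u) i‖ ≤ ∑ j, ‖A i j‖ * C := by
        refine (norm_sum_le _ _).trans (Finset.sum_le_sum fun j _ => ?_)
        rw [norm_mul]
        exact mul_le_mul_of_nonneg_left (hu j) (norm_nonneg _)
    _ = (∑ j, ‖A i j‖) * C := by rw [Finset.sum_mul]
    _ ≤ entryNorm A * C := by
        refine mul_le_mul_of_nonneg_right ?_ hC
        exact Finset.single_le_sum (f := fun i => ∑ j, ‖A i j‖)
          (fun i _ => Finset.sum_nonneg fun j _ => norm_nonneg _) (Finset.mem_univ i)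

theorem intervalIntegrable_mulVec {a b : ℝ} (hab : a ≤ b) {A : ℝ → Matrix m m ℂ}
    (hA : ∀ i j, IntervalIntegrable (fun x => A x i j) volume a b) {u : ℝ → m → ℂ}
    (hu : ∀ i, ContinuousOn (fun x => u x i) (Icc a b)) (i : m) :
    IntervalIntegrable (fun t => (A t *ᵥ u t) i) volume a b := by
  have := IntervalIntegrable.sum (μ := volume) (a := a) (b := b) Finset.univ
    (f := fun j x => A x i j * u x j) fun j _ => (hA i j).mul_continuousOn (by
      rw [uIcc_of_le hab]; exact hu j)
  rw [Finset.sum_fn] at this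
  exact this

/-- The Picard iterates of `y' = A y`, `y(a) = v`. -/
def picardTerm (a : ℝ) (A : ℝ → Matrix m m ℂ) (v : m → ℂ) : ℕ → ℝ → m → ℂ
  | 0, _ => v
  | k + 1, x => fun i => ∫ t in a..x, (A t *ᵥ picardTerm a A v k t) i

/-- Integrating the bound of one iterate against the norm of A raises the power and the factorial by
one. Continuity is carried in the same induction because integrability of the next integrand depends
on it. -/
theorem picardTerm_bound {a b : ℝ} (hab : a ≤ b) {A : ℝ → Matrix m m ℂ}
    (hA : ∀ i j, IntervalIntegrable (fun x => A x i j) volume a b) (v : m → ℂ) (k : ℕ) :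
    (∀ i, ContinuousOn (fun x => picardTerm a A v k x i) (Icc a b)) ∧
    ∀ x ∈ Icc a b, ∀ i, ‖picardTerm a A v k x i‖ ≤
      (∫ s in a..x, entryNorm (A s)) ^ k / k.factorial * ∑ j, ‖v j‖ := by
  have hκ := intervalIntegrable_entryNorm hA
  induction k with
  | zero =>
    refine ⟨fun i => continuousOn_const, fun x _ i => ?_⟩
    simpa [picardTerm] using
      Finset.single_le_sum (f := fun i => ‖v i‖) (fun i _ => norm_nonneg _) (Finset.mem_univ i)
  | succ k ih =>
    have hint := intervalIntegrable_mulVec hab hA ih.1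
    have hprim : ∀ i, IsPrimOn a b (fun x => picardTerm a A v (k + 1) x i)
        (fun t => (A t *ᵥ picardTerm a A v k t) i) := fun i =>
      ⟨hint i, fun x _ => by simp [picardTerm]⟩
    refine ⟨fun i => (hprim i).continuousOn hab, fun x hx i => ?_⟩
    have hsub : uIcc a x ⊆ uIcc a b := uIcc_subset_uIcc_left (by rwa [uIcc_of_le hab])
    have hK : IsPrimOn a b (fun x => ∫ t in a..x, entryNorm (A t)) (fun t => entryNorm (A t)) :=
      ⟨hκ, fun x _ => by simp⟩
    rw [← integral_mul_pow_div_factorial hab hκ k hx, ← intervalIntegral.integral_mul_const]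
    refine intervalIntegral.norm_integral_le_of_norm_le hx.1 ?_ ?_
    · refine ae_of_all _ fun t ht => ?_
      rw [mul_assoc]
      exact norm_mulVec_le_entryNorm_mul (ih.2 t ⟨ht.1.le, ht.2.trans hx.2⟩) i
    · refine ((hκ.mono_set hsub).mul_continuousOn ?_).mul_const _
      have := hK.continuousOn hab
      rw [← uIcc_of_le hab] at this
      exact ((this.mono hsub).pow k).div_const _

/-- The linear system `y' = A y` with integrable coefficients has an absolutely continuous solution
with any given initial value. -/
theorem exists_linear_solution {a b : ℝ} (hab : a ≤ b) {A : ℝ → Matrix m m ℂ}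
    (hA : ∀ i j, IntervalIntegrable (fun x => A x i j) volume a b) (v : m → ℂ) :
    ∃ y : ℝ → m → ℂ, (∀ i, IsPrimOn a b (fun x => y x i) (fun x => (A x *ᵥ y x) i)) ∧ y a = v := by
  have hκ := intervalIntegrable_entryNorm hA
  set u := picardTerm a A v with hu
  set D : ℝ := ∫ s in a..b, entryNorm (A s) with hD
  -- A summable majorant of the iterates, uniform on [a,b]; it gives continuity of their sum and
  -- termwise integration.
  set c : ℕ → ℝ := fun k => D ^ k / k.factorial * ∑ j, ‖v j‖ with hc
  have hcs : Summable c := (Real.summable_pow_div_factorial D).mul_right _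
  have hle : ∀ k, ∀ x ∈ Icc a b, ∀ i, ‖u k x i‖ ≤ c k := by
    intro k x hx i
    refine ((picardTerm_bound hab hA v k).2 x hx i).trans ?_
    have h0 : 0 ≤ ∫ s in a..x, entryNorm (A s) :=
      intervalIntegral.integral_nonneg hx.1 fun t _ => entryNorm_nonneg _
    have h1 : ∫ s in a..x, entryNorm (A s) ≤ D :=
      intervalIntegral.integral_mono_interval le_rfl hx.1 hx.2
        (ae_of_all _ fun t => entryNorm_nonneg _) hκ
    have : 0 ≤ ∑ j, ‖v j‖ := Finset.sum_nonneg fun _ _ => norm_nonneg _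
    simp only [hc]
    gcongr
  have hcont : ∀ k i, ContinuousOn (fun x => u k x i) (Icc a b) := fun k i =>
    (picardTerm_bound hab hA v k).1 i
  have hsum : ∀ x ∈ Icc a b, ∀ i, HasSum (fun k => u k x i) (∑' k, u k x i) := fun x hx i =>
    (Summable.of_norm_bounded hcs fun k => hle k x hx i).hasSum
  have hyc : ∀ i, ContinuousOn (fun x => ∑' k, u k x i) (Icc a b) := fun i =>
    continuousOn_tsum (fun k => hcont k i) hcs fun k x hx => hle k x hx i
  have hyint := intervalIntegrable_mulVec hab hA (u := fun x i => ∑' k, u k x i) hyc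
  have key : ∀ x ∈ Icc a b, ∀ i, ∑' k, u k x i =
      v i + ∫ t in a..x, (A t *ᵥ fun i => ∑' k, u k t i) i := by
    intro x hx i
    have hsub : uIcc a x ⊆ uIcc a b := uIcc_subset_uIcc_left (by rwa [uIcc_of_le hab])
    have hI : ∀ t ∈ uIoc a x, t ∈ Icc a b := fun t ht => by
      rw [uIoc_of_le hx.1] at ht
      exact ⟨ht.1.le, ht.2.trans hx.2⟩
    have h1 : HasSum (fun k => ∫ t in a..x, (A t *ᵥ u k t) i)
        (∫ t in a..x, (A t *ᵥ fun i => ∑' k, u k t i) i) := by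
      refine intervalIntegral.hasSum_integral_of_dominated_convergence
        (fun k t => entryNorm (A t) * c k) (fun k => ?_) (fun k => ae_of_all _ fun t ht => ?_)
        (ae_of_all _ fun t _ => hcs.mul_left _) ?_ (ae_of_all _ fun t ht => ?_)
      · exact ((intervalIntegrable_mulVec hab hA (hcont k) i).mono_set
          hsub).def'.aestronglyMeasurable
      · exact norm_mulVec_le_entryNorm_mul (hle k t (hI t ht)) i
      · simp only [tsum_mul_left]
        exact (hκ.mono_set hsub).mul_const _
      · exact hasSum_sum fun j _ => (hsum t (hI t ht) j).mul_left _
    -- Splitting off the zeroth iterate shifts the index and turns the series into the integral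
    -- equation.
    rw [(hsum x hx i).summable.tsum_eq_zero_add, ← h1.tsum_eq]
    rfl
  have ha : ∀ i, ∑' k, u k a i = v i := fun i => by
    simpa using key a (left_mem_Icc.2 hab) i
  refine ⟨fun x i => ∑' k, u k x i, fun i => ⟨hyint i, fun x hx => ?_⟩, funext ha⟩
  beta_reduce
  rw [key x hx i, ha]

end Existence

/-! ### Matrix-valued indefinite integrals -/

section MatPrim

variable {k l m : Type}

/-- The matrix function `Y` is the entrywise indefinite integral of `Y'` on `[a,b]`. -/
def MatPrim (a b : ℝ) (Y Y' : ℝ → Matrix k l ℂ) : Prop :=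
  ∀ i j, IsPrimOn a b (fun x => Y x i j) (fun x => Y' x i j)

namespace MatPrim

variable {a b : ℝ}

theorem congr_deriv {Y Y' Z : ℝ → Matrix k l ℂ} (hab : a ≤ b) (H : MatPrim a b Y Y')
    (h : ∀ᵐ x ∂volume.restrict (Ioo a b), Y' x = Z x) : MatPrim a b Y Z :=
  fun i j => (H i j).congr_deriv hab (h.mono fun x hx => by rw [hx])

theorem of_const (c : Matrix k l ℂ) : MatPrim a b (fun _ => c) (fun _ => 0) :=
  fun i j => IsPrimOn.of_const (c i j)

theorem mul [Fintype l] {Y Y' : ℝ → Matrix k l ℂ} {Z Z' : ℝ → Matrix l m ℂ} (hab : a ≤ b)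
    (H : MatPrim a b Y Y') (H' : MatPrim a b Z Z') :
    MatPrim a b (fun x => Y x * Z x) (fun x => Y x * Z' x + Y' x * Z x) := by
  intro i j
  simp only [Matrix.add_apply, Matrix.mul_apply, ← Finset.sum_add_distrib]
  exact IsPrimOn.sum _ hab fun p _ => (H i p).mul hab (H' p j)

theorem mul_const [Fintype l] {Y Y' : ℝ → Matrix k l ℂ} (hab : a ≤ b) (H : MatPrim a b Y Y')
    (c : Matrix l m ℂ) : MatPrim a b (fun x => Y x * c) (fun x => Y' x * c) := by
  simpa using H.mul hab (of_const c)

theorem const_mul [Fintype k] {Y Y' : ℝ → Matrix k l ℂ} (hab : a ≤ b) (H : MatPrim a b Y Y')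
    (c : Matrix m k ℂ) : MatPrim a b (fun x => c * Y x) (fun x => c * Y' x) := by
  simpa using (of_const c).mul hab H

theorem conjTranspose {Y Y' : ℝ → Matrix k l ℂ} (hab : a ≤ b) (H : MatPrim a b Y Y') :
    MatPrim a b (fun x => (Y x)ᴴ) (fun x => (Y' x)ᴴ) :=
  fun i j => (H j i).clm_comp hab (Complex.conjCLE : ℂ →L[ℝ] ℂ)

theorem add {Y Y' Z Z' : ℝ → Matrix k l ℂ} (hab : a ≤ b) (H : MatPrim a b Y Y')
    (H' : MatPrim a b Z Z') : MatPrim a b (fun x => Y x + Z x) (fun x => Y' x + Z' x) :=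
  fun i j => (H i j).add hab (H' i j)

theorem neg {Y Y' : ℝ → Matrix k l ℂ} (hab : a ≤ b) (H : MatPrim a b Y Y') :
    MatPrim a b (fun x => -Y x) (fun x => -Y' x) :=
  fun i j => (H i j).clm_comp hab (-ContinuousLinearMap.id ℝ ℂ)

end MatPrim

/-- The squared Euclidean norm of the `j`-th column. -/
def colSq [Fintype k] (Y : Matrix k l ℂ) (j : l) : ℝ := ∑ i, ‖Y i j‖ ^ 2

theorem colSq_nonneg [Fintype k] (Y : Matrix k l ℂ) (j : l) : 0 ≤ colSq Y j :=
  Finset.sum_nonneg fun _ _ => by positivity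

theorem norm_sq_le_colSq [Fintype k] (Y : Matrix k l ℂ) (i : k) (j : l) :
    ‖Y i j‖ ^ 2 ≤ colSq Y j :=
  Finset.single_le_sum (f := fun i => ‖Y i j‖ ^ 2) (fun _ _ => by positivity) (Finset.mem_univ i)

theorem conjTranspose_mul_self_diag [Fintype k] (Y : Matrix k l ℂ) (j : l) :
    (Yᴴ * Y) j j = (colSq Y j : ℂ) := by
  simp [Matrix.mul_apply, colSq, ← Complex.conj_mul']

theorem colSq_eq_zero [Fintype k] {Y : Matrix k l ℂ} {j : l} (h : colSq Y j = 0) (i : k) :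
    Y i j = 0 := by
  have := norm_sq_le_colSq Y i j
  rw [h] at this
  simpa using le_antisymm this (by positivity)

theorem norm_conjTranspose_mul_mul_diag_le [Fintype k] (Y : Matrix k l ℂ) (A : Matrix k k ℂ)
    (j : l) : ‖(Yᴴ * A * Y) j j‖ ≤ entryNorm A * colSq Y j := by
  have hle : ∀ p q, ‖Y p j‖ * ‖Y q j‖ ≤ colSq Y j := fun p q => by
    nlinarith [norm_sq_le_colSq Y p j, norm_sq_le_colSq Y q j, sq_nonneg (‖Y p j‖ - ‖Y q j‖)]
  rw [Matrix.mul_assoc, Matrix.mul_apply]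
  simp only [entryNorm, Finset.sum_mul]
  refine (norm_sum_le _ _).trans (Finset.sum_le_sum fun p _ => ?_)
  rw [norm_mul, Matrix.mul_apply]
  refine (mul_le_mul_of_nonneg_left (norm_sum_le _ _) (norm_nonneg _)).trans ?_
  rw [Finset.mul_sum]
  refine Finset.sum_le_sum fun q _ => ?_
  rw [norm_mul, conjTranspose_apply, norm_star]
  nlinarith [mul_le_mul_of_nonneg_left (hle p q) (norm_nonneg (A p q))]

end MatPrim

/-! ### Dirac systems -/

section Dirac

variable {n : Type} [Fintype n] [DecidableEq n] {k l : Type}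

omit [Fintype n] in
theorem diracJ_eq : diracJ n = fromBlocks (-Complex.I • 1) 0 0 (Complex.I • 1) := by
  rw [diracJ, one_div, Complex.inv_I, fromBlocks_smul]
  simp

theorem diracJ_mul_self : diracJ n * diracJ n = -1 := by
  rw [diracJ_eq, fromBlocks_multiply, ← fromBlocks_one, fromBlocks_neg]
  simp [smul_smul]

omit [Fintype n] in
theorem diracJ_conjTranspose : (diracJ n)ᴴ = -diracJ n := by
  rw [diracJ_eq, fromBlocks_conjTranspose, fromBlocks_neg]
  simp

omit [Fintype n] [DecidableEq n] in
theorem diracPotential_conjTranspose (V : ℝ → Matrix n n ℂ) (x : ℝ) :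
    (diracPotential V x)ᴴ = diracPotential V x := by
  simp [diracPotential, fromBlocks_conjTranspose]

/-- `Y` is an absolutely continuous solution of `J Y' + Q Y = z Y` on `[0,1]`. -/
def IsDiracSol (V : ℝ → Matrix n n ℂ) (z : ℂ) (Y : ℝ → Matrix (n ⊕ n) k ℂ) : Prop :=
  MatPrim 0 1 Y fun x => -(diracJ n * (z • Y x - diracPotential V x * Y x))

theorem neg_diracJ_mul_eq_iff {A B : Matrix (n ⊕ n) k ℂ} :
    A = -(diracJ n * B) ↔ diracJ n * A = B := by
  constructor
  · rintro rfl
    rw [Matrix.mul_neg, ← Matrix.mul_assoc, diracJ_mul_self]; simp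
  · rintro rfl
    rw [← Matrix.mul_assoc, diracJ_mul_self]; simp

/-- Since J has inverse -J, the equation determines the derivative almost everywhere, and the
existential over derivatives disappears. -/
theorem isCauchySolution_iff {V : ℝ → Matrix n n ℂ} {z : ℂ} {Y₀ : Matrix (n ⊕ n) k ℂ}
    {Y : ℝ → Matrix (n ⊕ n) k ℂ} :
    IsCauchySolution 0 1 0 (diracJ n) (diracPotential V) z Y₀ Y ↔
      IsDiracSol V z Y ∧ Y 0 = Y₀ := by
  refine and_congr_left fun _ => ⟨?_, fun h => ⟨_, h, ae_of_all _ fun x => ?_⟩⟩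
  · rintro ⟨Y', h, he⟩
    refine MatPrim.congr_deriv zero_le_one h (he.mono fun x hx => ?_)
    rw [neg_diracJ_mul_eq_iff, ← hx, add_sub_cancel_right]
  · rw [neg_diracJ_mul_eq_iff.1 rfl, sub_add_cancel]

namespace IsDiracSol

variable {V : ℝ → Matrix n n ℂ} {z w : ℂ}

theorem mul_const [Fintype k] {Y : ℝ → Matrix (n ⊕ n) k ℂ} (H : IsDiracSol V z Y)
    (c : Matrix k l ℂ) : IsDiracSol V z fun x => Y x * c := by
  have := MatPrim.mul_const zero_le_one H c
  simpa only [IsDiracSol, Matrix.neg_mul, Matrix.mul_assoc, Matrix.sub_mul, Matrix.smul_mul]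
    using this

theorem sub {Y Z : ℝ → Matrix (n ⊕ n) k ℂ} (H : IsDiracSol V z Y) (H' : IsDiracSol V z Z) :
    IsDiracSol V z fun x => Y x - Z x := by
  have := MatPrim.add zero_le_one H (MatPrim.neg zero_le_one H')
  simp only [← sub_eq_add_neg] at this
  refine this.congr_deriv zero_le_one (ae_of_all _ fun x => ?_)
  simp only [Matrix.mul_sub, smul_sub]
  abel

theorem continuousOn {Y : ℝ → Matrix (n ⊕ n) k ℂ} (H : IsDiracSol V z Y) (i : n ⊕ n) (j : k) :
    ContinuousOn (fun x => Y x i j) (Icc 0 1) :=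
  (H i j).continuousOn zero_le_one

/-- **Lagrange's identity.** -/
theorem lagrange {Y : ℝ → Matrix (n ⊕ n) k ℂ} {Z : ℝ → Matrix (n ⊕ n) l ℂ}
    (H : IsDiracSol V z Y) (H' : IsDiracSol V w Z) :
    MatPrim 0 1 (fun x => (Z x)ᴴ * (diracJ n * Y x))
      fun x => (z - star w) • ((Z x)ᴴ * Y x) := by
  refine ((H'.conjTranspose zero_le_one).mul zero_le_one
    (H.const_mul zero_le_one (diracJ n))).congr_deriv zero_le_one (ae_of_all _ fun x => ?_)
  -- The potential is Hermitian and J is skew-Hermitian with square -1, so the potential terms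
  -- cancel and only the spectral parameters remain.
  rw [neg_diracJ_mul_eq_iff.1 rfl, conjTranspose_neg, conjTranspose_mul, conjTranspose_sub,
    conjTranspose_mul, conjTranspose_smul, diracPotential_conjTranspose, diracJ_conjTranspose,
    Matrix.mul_neg, neg_neg, Matrix.mul_assoc, ← Matrix.mul_assoc (diracJ n), diracJ_mul_self]
  simp only [Matrix.mul_sub, Matrix.sub_mul, Matrix.mul_smul, Matrix.smul_mul, Matrix.mul_neg,
    Matrix.neg_mul, Matrix.one_mul, sub_smul, Matrix.mul_assoc]
  abel

end IsDiracSol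

/-- The diagonal of Y*JY is purely imaginary, so only Im z contributes to the real part. This makes
the growth bounds uniform in Re z. -/
theorem re_mul_conjTranspose_diracJ_diag (z : ℂ) (Y : Matrix (n ⊕ n) k ℂ) (j : k) :
    |(z * (Yᴴ * (diracJ n * Y)) j j).re| ≤ |z.im| * colSq Y j := by
  have h : (Yᴴ * (diracJ n * Y)) j j =
      Complex.I * ((∑ i, ‖Y (Sum.inr i) j‖ ^ 2 - ∑ i, ‖Y (Sum.inl i) j‖ ^ 2 : ℝ) : ℂ) := by
    have h1 : ∀ i, (diracJ n * Y) (Sum.inl i) j = -Complex.I * Y (Sum.inl i) j := fun i => by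
      rw [diracJ_eq, ← fromRows_toRows Y, fromBlocks_mul_fromRows]; simp
    have h2 : ∀ i, (diracJ n * Y) (Sum.inr i) j = Complex.I * Y (Sum.inr i) j := fun i => by
      rw [diracJ_eq, ← fromRows_toRows Y, fromBlocks_mul_fromRows]; simp
    rw [Matrix.mul_apply, Fintype.sum_sum_type]
    simp only [h1, h2, conjTranspose_apply]
    push_cast
    simp only [← Complex.conj_mul', mul_sub, Finset.mul_sum]
    rw [sub_eq_add_neg, add_comm, ← Finset.sum_neg_distrib]
    congr 1 <;> refine Finset.sum_congr rfl fun i _ => ?_ <;> simp <;> ring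
  rw [h, ← mul_assoc, Complex.re_mul_ofReal, abs_mul]
  simp only [Complex.mul_re, Complex.I_re, Complex.I_im, mul_zero, mul_one, zero_sub, abs_neg]
  refine mul_le_mul_of_nonneg_left ?_ (abs_nonneg _)
  rw [colSq, Fintype.sum_sum_type]
  have h1 : 0 ≤ ∑ i, ‖Y (Sum.inl i) j‖ ^ 2 := Finset.sum_nonneg fun _ _ => by positivity
  have h2 : 0 ≤ ∑ i, ‖Y (Sum.inr i) j‖ ^ 2 := Finset.sum_nonneg fun _ _ => by positivity
  rw [abs_le]; constructor <;> linarith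

end Dirac

/-! ### Growth, uniqueness, existence, and entire dependence on the spectral parameter -/

section Dirac

variable {n : Type} [Fintype n] [DecidableEq n] {k l : Type} {V : ℝ → Matrix n n ℂ}

/-- The entries of `V` are integrable on `(0,1)`. -/
def PotentialIntegrable (V : ℝ → Matrix n n ℂ) : Prop :=
  ∀ i j, IntervalIntegrable (fun x => V x i j) volume 0 1

omit [Fintype n] [DecidableEq n] in
theorem PotentialIntegrable.intervalIntegrable_diracPotential (hV : PotentialIntegrable V) (i j : n ⊕ n) :
    IntervalIntegrable (fun x => diracPotential V x i j) volume 0 1 := by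
  -- The primitive of V is introduced only so that `clm_comp` delivers integrability of the
  -- conjugate.
  have hs : ∀ i j, IntervalIntegrable (fun x => star (V x i j)) volume 0 1 := fun i j =>
    ((IsPrimOn.clm_comp zero_le_one (g := fun x => ∫ t in (0 : ℝ)..x, V t i j)
      ⟨hV i j, fun x _ => by simp⟩ (Complex.conjCLE : ℂ →L[ℝ] ℂ))).1
  rcases i with i | i <;> rcases j with j | j <;>
    simp only [diracPotential, fromBlocks_apply₁₁, fromBlocks_apply₁₂,
      fromBlocks_apply₂₁, fromBlocks_apply₂₂, Matrix.zero_apply, conjTranspose_apply]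
  · exact intervalIntegrable_const
  · exact hV i j
  · exact hs j i
  · exact intervalIntegrable_const

theorem intervalIntegrable_const_mul {m : Type} [Fintype m] {A : ℝ → Matrix m l ℂ}
    (hA : ∀ i j, IntervalIntegrable (fun x => A x i j) volume 0 1) (c : Matrix k m ℂ) (i : k)
    (j : l) : IntervalIntegrable (fun x => (c * A x) i j) volume 0 1 := by
  have := IntervalIntegrable.sum (μ := volume) (a := 0) (b := 1) Finset.univ
    (f := fun p x => c i p * A x p j) fun p _ => (hA p j).const_mul (c i p)
  rw [Finset.sum_fn] at this
  exact this

theorem PotentialIntegrable.intervalIntegrable_entryNorm (hV : PotentialIntegrable V) :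
    IntervalIntegrable (fun t => entryNorm (diracJ n * diracPotential V t)) volume 0 1 :=
  DiracFolding.intervalIntegrable_entryNorm (intervalIntegrable_const_mul hV.intervalIntegrable_diracPotential _)

/-- The bound for the growth on `[0,1]` of solutions with spectral parameter in `|Im z| ≤ η`. -/
def growthConst (V : ℝ → Matrix n n ℂ) (η : ℝ) : ℝ :=
  Real.exp (2 * (η + ∫ t in (0 : ℝ)..1, entryNorm (diracJ n * diracPotential V t)))

theorem growthConst_pos (V : ℝ → Matrix n n ℂ) (η : ℝ) : 0 < growthConst V η := Real.exp_pos _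

theorem growthConst_mono (V : ℝ → Matrix n n ℂ) {η η' : ℝ} (h : η ≤ η') :
    growthConst V η ≤ growthConst V η' := by
  unfold growthConst; gcongr

/-- The squared length of a column has derivative at most 2(|Im z| + ‖JQ‖) times itself in modulus.
The upper bound gives uniqueness and local boundedness in z; the lower bound keeps ∫|Y|² away from
zero. -/
theorem IsDiracSol.colSq_gronwall (hV : PotentialIntegrable V) {z : ℂ}
    {Y : ℝ → Matrix (n ⊕ n) k ℂ} (H : IsDiracSol V z Y) (j : k) {x : ℝ} (hx : x ∈ Icc (0 : ℝ) 1) :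
    colSq (Y x) j ≤ growthConst V |z.im| * colSq (Y 0) j ∧
      colSq (Y 0) j ≤ growthConst V |z.im| * colSq (Y x) j := by
  have h1 := ((H.conjTranspose zero_le_one).mul zero_le_one H j j).clm_comp zero_le_one
    Complex.reCLM
  simp only [conjTranspose_mul_self_diag, Complex.reCLM_apply, Complex.ofReal_re] at h1
  have hk : IntervalIntegrable
      (fun t => 2 * (|z.im| + entryNorm (diracJ n * diracPotential V t))) volume 0 1 :=
    (intervalIntegrable_const.add hV.intervalIntegrable_entryNorm).const_mul 2
  have hbound := h1.gronwall zero_le_one hk (ae_of_all _ fun t => ?_) x hx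
  · have hexp : Real.exp (∫ t in (0 : ℝ)..x,
        2 * (|z.im| + entryNorm (diracJ n * diracPotential V t))) ≤ growthConst V |z.im| := by
      refine Real.exp_le_exp.2 ?_
      refine (intervalIntegral.integral_mono_interval le_rfl hx.1 hx.2
        (ae_of_all _ fun t => ?_) hk).trans_eq ?_
      · have := entryNorm_nonneg (diracJ n * diracPotential V t)
        have := abs_nonneg z.im
        simp only [Pi.zero_apply]; linarith
      · rw [intervalIntegral.integral_const_mul, intervalIntegral.integral_add
          intervalIntegrable_const hV.intervalIntegrable_entryNorm]
        simp
    exact ⟨hbound.1.trans (mul_le_mul_of_nonneg_right hexp (colSq_nonneg _ _)),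
      hbound.2.trans (mul_le_mul_of_nonneg_right hexp (colSq_nonneg _ _))⟩
  · set Y' := -(diracJ n * (z • Y t - diracPotential V t * Y t)) with hY'
    have e : (Y t)ᴴ * Y' =
        (Y t)ᴴ * (diracJ n * diracPotential V t) * Y t - z • ((Y t)ᴴ * (diracJ n * Y t)) := by
      rw [hY']
      simp only [Matrix.mul_sub, Matrix.mul_smul, Matrix.mul_neg, Matrix.mul_assoc]
      abel
    have e' : (Y'ᴴ * Y t) j j = star (((Y t)ᴴ * Y') j j) := by
      rw [← conjTranspose_apply, conjTranspose_mul, conjTranspose_conjTranspose]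
    have h2 := norm_conjTranspose_mul_mul_diag_le (Y t) (diracJ n * diracPotential V t) j
    have h3 := re_mul_conjTranspose_diracJ_diag z (Y t) j
    have h4 := (Complex.abs_re_le_norm _).trans h2
    rw [Matrix.add_apply, e', e, Matrix.sub_apply, Matrix.smul_apply, smul_eq_mul, Complex.add_re,
      Complex.star_def, Complex.conj_re, Complex.sub_re]
    rw [abs_le] at h3 h4 ⊢
    constructor <;> linarith

/-- Solutions are determined by their initial values. -/
theorem IsDiracSol.unique (hV : PotentialIntegrable V) {z : ℂ} {Y Z : ℝ → Matrix (n ⊕ n) k ℂ}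
    (H : IsDiracSol V z Y) (H' : IsDiracSol V z Z) (h0 : Y 0 = Z 0) {x : ℝ}
    (hx : x ∈ Icc (0 : ℝ) 1) : Y x = Z x := by
  ext i j
  have h1 := ((H.sub H').colSq_gronwall hV j hx).1
  rw [h0, sub_self] at h1
  have h2 : colSq (Y x - Z x) j = 0 :=
    le_antisymm (h1.trans_eq (by simp [colSq])) (colSq_nonneg _ _)
  exact sub_eq_zero.1 (colSq_eq_zero h2 i)

theorem exists_isDiracSol (hV : PotentialIntegrable V) (z : ℂ) (Y₀ : Matrix (n ⊕ n) k ℂ) :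
    ∃ Y, IsDiracSol V z Y ∧ Y 0 = Y₀ := by
  have hA : ∀ i j, IntervalIntegrable
      (fun x => (diracJ n * diracPotential V x - z • diracJ n) i j) volume 0 1 := fun i j =>
    (intervalIntegrable_const_mul hV.intervalIntegrable_diracPotential _ i j).sub intervalIntegrable_const
  choose y hy hy0 using fun j : k => exists_linear_solution zero_le_one hA (fun i => Y₀ i j)
  refine ⟨fun x => Matrix.of fun i j => y j x i, fun i j => ?_, ?_⟩
  · refine (hy j i).congr_deriv zero_le_one (ae_of_all _ fun x => ?_)
    have : ((diracJ n * diracPotential V x - z • diracJ n) *ᵥ y j x) i =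
      ((diracJ n * diracPotential V x - z • diracJ n) * (Matrix.of fun i j => y j x i)) i j := rfl
    rw [this]
    simp only [Matrix.mul_sub, Matrix.sub_mul, Matrix.mul_smul, Matrix.smul_mul, Matrix.mul_assoc,
      neg_sub]
  · ext i j
    exact congrFun (hy0 j) i

open Classical in
/-- The fundamental solution, with value `1` at `0`. -/
def fundSol (V : ℝ → Matrix n n ℂ) (z : ℂ) : ℝ → Matrix (n ⊕ n) (n ⊕ n) ℂ :=
  if hV : PotentialIntegrable V then (exists_isDiracSol hV z 1).choose else 0

theorem isDiracSol_fundSol (hV : PotentialIntegrable V) (z : ℂ) : IsDiracSol V z (fundSol V z) := by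
  rw [fundSol, dif_pos hV]
  exact (exists_isDiracSol hV z 1).choose_spec.1

theorem fundSol_zero (hV : PotentialIntegrable V) (z : ℂ) : fundSol V z 0 = 1 := by
  rw [fundSol, dif_pos hV]
  exact (exists_isDiracSol hV z 1).choose_spec.2

theorem IsDiracSol.eq_fundSol_mul (hV : PotentialIntegrable V) {z : ℂ}
    {Y : ℝ → Matrix (n ⊕ n) k ℂ} (H : IsDiracSol V z Y) {x : ℝ} (hx : x ∈ Icc (0 : ℝ) 1) :
    Y x = fundSol V z x * Y 0 :=
  H.unique hV ((isDiracSol_fundSol hV z).mul_const (Y 0)) (by simp [fundSol_zero hV]) hx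

theorem colSq_fundSol_le (hV : PotentialIntegrable V) (z : ℂ) (j : n ⊕ n) {x : ℝ}
    (hx : x ∈ Icc (0 : ℝ) 1) : colSq (fundSol V z x) j ≤ growthConst V |z.im| := by
  have h1 := ((isDiracSol_fundSol hV z).colSq_gronwall hV j hx).1
  have h2 : colSq (1 : Matrix (n ⊕ n) (n ⊕ n) ℂ) j = 1 := by
    rw [colSq, Finset.sum_eq_single j (fun i _ hi => by simp [hi]) (by simp)]
    simp
  rwa [fundSol_zero hV, h2, mul_one] at h1

theorem norm_fundSol_le (hV : PotentialIntegrable V) {z : ℂ} {η : ℝ} (hz : |z.im| ≤ η)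
    (i j : n ⊕ n) {x : ℝ} (hx : x ∈ Icc (0 : ℝ) 1) :
    ‖fundSol V z x i j‖ ≤ 1 + growthConst V η := by
  have h1 := (norm_sq_le_colSq _ i j).trans
    ((colSq_fundSol_le hV z j hx).trans (growthConst_mono V hz))
  nlinarith [sq_nonneg (‖fundSol V z x i j‖ - 1), growthConst_pos V η]

omit [DecidableEq n] in
theorem continuousOn_conjTranspose_mul {Y : ℝ → Matrix (n ⊕ n) k ℂ} {Z : ℝ → Matrix (n ⊕ n) l ℂ}
    {s : Set ℝ} (hY : ∀ i j, ContinuousOn (fun t => Y t i j) s)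
    (hZ : ∀ i j, ContinuousOn (fun t => Z t i j) s) (i : l) (j : k) :
    ContinuousOn (fun t => ((Z t)ᴴ * Y t) i j) s := by
  simp only [Matrix.mul_apply, conjTranspose_apply]
  exact continuousOn_finsetSum _ fun p _ => (hZ p i).star.mul (hY p j)

/-- The matrix `∫₀ˣ X(t, w̄)* X(t, z) dt`. -/
def fundGram (V : ℝ → Matrix n n ℂ) (w z : ℂ) (x : ℝ) : Matrix (n ⊕ n) (n ⊕ n) ℂ :=
  Matrix.of fun i j => ∫ t in (0 : ℝ)..x, ((fundSol V (star w) t)ᴴ * fundSol V z t) i j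

theorem lagrange_fundSol (hV : PotentialIntegrable V) (w z : ℂ) {x : ℝ}
    (hx : x ∈ Icc (0 : ℝ) 1) : (fundSol V w x)ᴴ * (diracJ n * fundSol V z x) =
      diracJ n + (z - star w) • fundGram V (star w) z x := by
  ext i j
  have h1 := ((isDiracSol_fundSol hV z).lagrange (isDiracSol_fundSol hV w) i j).2 x hx
  refine Eq.trans h1 ?_
  simp [fundGram, fundSol_zero hV]

/-- Lagrange's identity at z = w shows that X(w̄)*J is invertible with inverse -X(w)J; multiplying
the identity for general z by this inverse solves it for X(z). The explicit factor z - w yields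
first continuity and then the complex derivative, without differentiating the system in z. -/
theorem fundSol_eq (hV : PotentialIntegrable V) (w z : ℂ) {x : ℝ} (hx : x ∈ Icc (0 : ℝ) 1) :
    fundSol V z x =
      fundSol V w x - (z - w) • (fundSol V w x * (diracJ n * fundGram V w z x)) := by
  have key := fun z => lagrange_fundSol hV (star w) z hx
  simp only [star_star] at key
  have h0 := key w
  rw [sub_self, zero_smul, add_zero] at h0
  have h1 : ((fundSol V (star w) x)ᴴ * diracJ n) * (fundSol V w x * -diracJ n) = 1 := by
    rw [Matrix.mul_neg, Matrix.mul_neg, ← Matrix.mul_assoc, Matrix.mul_assoc _ (diracJ n), h0,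
      diracJ_mul_self, neg_neg]
  rw [mul_eq_one_comm] at h1
  calc fundSol V z x = fundSol V w x * -diracJ n *
        ((fundSol V (star w) x)ᴴ * (diracJ n * fundSol V z x)) := by
        rw [← Matrix.mul_assoc _ (diracJ n), ← Matrix.mul_assoc, h1, Matrix.one_mul]
    _ = _ := by
        rw [key z, Matrix.mul_add, Matrix.mul_assoc, Matrix.neg_mul, diracJ_mul_self, neg_neg,
          Matrix.mul_one, Matrix.mul_smul, Matrix.mul_neg, Matrix.neg_mul, smul_neg,
          Matrix.mul_assoc, ← sub_eq_add_neg]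

theorem norm_conjTranspose_mul_fundSol_le (hV : PotentialIntegrable V) {w z : ℂ} {η : ℝ}
    (hw : |w.im| ≤ η) (hz : |z.im| ≤ η) (i j : n ⊕ n) {x : ℝ} (hx : x ∈ Icc (0 : ℝ) 1) :
    ‖((fundSol V w x)ᴴ * fundSol V z x) i j‖ ≤
      ∑ _p : n ⊕ n, (1 + growthConst V η) * (1 + growthConst V η) := by
  rw [Matrix.mul_apply]
  refine (norm_sum_le _ _).trans (Finset.sum_le_sum fun p _ => ?_)
  rw [norm_mul, conjTranspose_apply, norm_star]
  have := growthConst_pos V η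
  exact mul_le_mul (norm_fundSol_le hV hw p i hx) (norm_fundSol_le hV hz p j hx) (norm_nonneg _)
    (by linarith)

theorem eventually_abs_im_le (w : ℂ) : ∀ᶠ z : ℂ in 𝓝 w, |z.im| ≤ |w.im| + 1 := by
  have : Tendsto (fun z : ℂ => |z.im|) (𝓝 w) (𝓝 |w.im|) :=
    (Complex.continuous_im.tendsto w).abs
  exact (this.eventually (gt_mem_nhds (lt_add_one _))).mono fun z hz => hz.le

/-- In `fundSol_eq` the cofactor of z - w stays bounded near w, by the growth bound on the strip |Im
z| ≤ |Im w| + 1. -/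
theorem continuousAt_fundSol (hV : PotentialIntegrable V) (w : ℂ) {x : ℝ}
    (hx : x ∈ Icc (0 : ℝ) 1) (i j : n ⊕ n) : ContinuousAt (fun z => fundSol V z x i j) w := by
  set η := |w.im| + 1
  set B : ℝ := ∑ _p : n ⊕ n, (1 + growthConst V η) * (1 + growthConst V η)
  have hG : ∀ᶠ z in 𝓝 w, ∀ p, ‖fundGram V w z x p j‖ ≤ B * |x - 0| := by
    filter_upwards [eventually_abs_im_le w] with z hz p
    refine intervalIntegral.norm_integral_le_of_norm_le_const fun t ht => ?_
    rw [uIoc_of_le hx.1] at ht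
    exact norm_conjTranspose_mul_fundSol_le hV (by simp) hz p j ⟨ht.1.le, ht.2.trans hx.2⟩
  have hb : IsBoundedUnder (· ≤ ·) (𝓝 w) fun z =>
      ‖(fundSol V w x * (diracJ n * fundGram V w z x)) i j‖ := by
    refine ⟨entryNorm (fundSol V w x * diracJ n) * (B * |x - 0|), ?_⟩
    rw [eventually_map]
    filter_upwards [hG] with z hz
    rw [← Matrix.mul_assoc]
    exact norm_mulVec_le_entryNorm_mul hz i
  have h0 : Tendsto (fun z : ℂ => z - w) (𝓝 w) (𝓝 0) := by
    simpa using (continuous_id.sub continuous_const).tendsto (x := w) (f := fun z : ℂ => z - w)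
  have h1 := (h0.zero_mul_isBoundedUnder_le hb).const_sub (fundSol V w x i j)
  rw [sub_zero] at h1
  refine h1.congr fun z => ?_
  rw [fundSol_eq hV w z hx]
  simp

theorem continuousAt_fundGram (hV : PotentialIntegrable V) (w z₀ : ℂ) {x : ℝ}
    (hx : x ∈ Icc (0 : ℝ) 1) (i j : n ⊕ n) : ContinuousAt (fun z => fundGram V w z x i j) z₀ := by
  have hI : ∀ t ∈ uIoc 0 x, t ∈ Icc (0 : ℝ) 1 := fun t ht => by
    rw [uIoc_of_le hx.1] at ht
    exact ⟨ht.1.le, ht.2.trans hx.2⟩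
  refine intervalIntegral.continuousAt_of_dominated_interval
    (bound := fun _ => ∑ _p : n ⊕ n, (1 + growthConst V (max |w.im| (|z₀.im| + 1))) *
      (1 + growthConst V (max |w.im| (|z₀.im| + 1)))) ?_ ?_ intervalIntegrable_const ?_
  · refine Eventually.of_forall fun z => ?_
    refine ContinuousOn.aestronglyMeasurable (ContinuousOn.mono ?_ hI) measurableSet_uIoc
    exact continuousOn_conjTranspose_mul (isDiracSol_fundSol hV z).continuousOn
      (isDiracSol_fundSol hV _).continuousOn i j
  · filter_upwards [eventually_abs_im_le z₀] with z hz
    refine ae_of_all _ fun t ht => ?_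
    exact norm_conjTranspose_mul_fundSol_le hV (by simp) (hz.trans (le_max_right _ _)) i j
      (hI t ht)
  · refine ae_of_all _ fun t ht => ?_
    simp only [Matrix.mul_apply]
    exact tendsto_finsetSum _ fun p _ => (continuousAt_fundSol hV z₀ (hI t ht) p j).const_mul _

theorem hasDerivAt_of_eq_add_mul {f g : ℂ → ℂ} {w : ℂ}
    (h : ∀ᶠ z in 𝓝 w, f z = f w + (z - w) * g z)
    (hg : ContinuousAt g w) : HasDerivAt f (g w) w := by
  rw [hasDerivAt_iff_tendsto_slope]
  refine (hg.tendsto.mono_left nhdsWithin_le_nhds).congr' ?_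
  filter_upwards [self_mem_nhdsWithin, h.filter_mono nhdsWithin_le_nhds] with z hz hfz
  rw [slope_def_field, hfz]
  field_simp [sub_ne_zero.2 hz]
  ring

/-- The fundamental solution is an entire function of the spectral parameter. -/
theorem differentiable_fundSol (hV : PotentialIntegrable V) {x : ℝ} (hx : x ∈ Icc (0 : ℝ) 1)
    (i j : n ⊕ n) : Differentiable ℂ fun z => fundSol V z x i j := by
  intro w
  have h : ∀ z, fundSol V z x i j = fundSol V w x i j +
      (z - w) * -∑ p, (fundSol V w x * diracJ n) i p * fundGram V w z x p j := fun z => by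
    rw [fundSol_eq hV w z hx, ← Matrix.mul_assoc, Matrix.sub_apply, Matrix.smul_apply,
      Matrix.mul_apply, smul_eq_mul, mul_neg, sub_eq_add_neg]
  exact (hasDerivAt_of_eq_add_mul (Eventually.of_forall h) (tendsto_finsetSum _ fun p _ =>
    (continuousAt_fundGram hV w w hx p j).const_mul _).neg).differentiableAt

end Dirac

/-! ### The Weyl–Titchmarsh function -/

section Weyl

variable {n : Type} [Fintype n] [DecidableEq n] {k l : Type} {V : ℝ → Matrix n n ℂ}
  {U : Matrix n n ℂ}

theorem mata_mul_conjTranspose : mata n * (mata n)ᴴ = 1 := by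
  have h : (Real.sqrt 2 : ℂ) * Real.sqrt 2 = 2 := by
    rw [← Complex.ofReal_mul, Real.mul_self_sqrt zero_le_two]; norm_num
  have h0 : (Real.sqrt 2 : ℂ) ≠ 0 := fun h0 => by simp [h0] at h
  rw [mata, conjTranspose_smul, Matrix.smul_mul, Matrix.mul_smul, smul_smul,
    conjTranspose_fromCols_eq_fromRows_conjTranspose, fromCols_mul_fromRows]
  ext i j
  simp [Matrix.one_apply]
  split_ifs
  · field_simp
    rw [pow_two, h]; norm_num
  · simp

theorem mata_mul_diracJ_mul_conjTranspose : mata n * (diracJ n * (mata n)ᴴ) = 0 := by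
  rw [mata, conjTranspose_smul, Matrix.smul_mul, Matrix.mul_smul, Matrix.mul_smul,
    conjTranspose_fromCols_eq_fromRows_conjTranspose, diracJ_eq, fromBlocks_mul_fromRows,
    fromCols_mul_fromRows]
  simp

/-- The initial value of `φ`. -/
def phiInit (n : Type) [Fintype n] [DecidableEq n] : Matrix (n ⊕ n) n ℂ := diracJ n * (mata n)ᴴ

theorem diracJ_conjTranspose_mul_self : (diracJ n)ᴴ * diracJ n = 1 := by
  rw [diracJ_conjTranspose, Matrix.neg_mul, diracJ_mul_self, neg_neg]

theorem phiInit_mul_self : (phiInit n)ᴴ * phiInit n = 1 := by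
  rw [phiInit, conjTranspose_mul, conjTranspose_conjTranspose, Matrix.mul_assoc,
    ← Matrix.mul_assoc _ (diracJ n), diracJ_conjTranspose_mul_self, Matrix.one_mul,
    mata_mul_conjTranspose]

theorem phiInit_conjTranspose_mul_mata : (phiInit n)ᴴ * (mata n)ᴴ = 0 := by
  rw [phiInit, conjTranspose_mul, conjTranspose_conjTranspose, diracJ_conjTranspose,
    Matrix.mul_assoc, Matrix.neg_mul, Matrix.mul_neg, mata_mul_diracJ_mul_conjTranspose, neg_zero]

theorem phiInit_lagrange_self : (phiInit n)ᴴ * (diracJ n * phiInit n) = 0 := by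
  rw [phiInit, conjTranspose_mul, conjTranspose_conjTranspose, Matrix.mul_assoc,
    ← Matrix.mul_assoc _ (diracJ n), diracJ_conjTranspose_mul_self, Matrix.one_mul,
    mata_mul_diracJ_mul_conjTranspose]

theorem phiInit_lagrange_mata : (phiInit n)ᴴ * (diracJ n * (mata n)ᴴ) = 1 :=
  phiInit_mul_self

/-- The matrix `(I, -U)` of the boundary condition at `1`. -/
def bcMat (U : Matrix n n ℂ) : Matrix n (n ⊕ n) ℂ := fromCols 1 (-U)

omit [DecidableEq n] in
theorem bcMat_mul_eq_zero_iff [DecidableEq n] {H : Matrix (n ⊕ n) k ℂ} :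
    bcMat U * H = 0 ↔ H.toRows₁ = U * H.toRows₂ := by
  conv_lhs => rw [← fromRows_toRows H, bcMat, fromCols_mul_fromRows, Matrix.one_mul, Matrix.neg_mul,
    ← sub_eq_add_neg, sub_eq_zero]

/-- Vectors that satisfy the boundary condition at `1` are isotropic for `J`. -/
theorem isotropic_of_bcMat_mul_eq_zero (hU : U ∈ unitaryGroup n ℂ) {H : Matrix (n ⊕ n) k ℂ}
    {H' : Matrix (n ⊕ n) l ℂ} (h : bcMat U * H = 0) (h' : bcMat U * H' = 0) :
    Hᴴ * (diracJ n * H') = 0 := by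
  rw [bcMat_mul_eq_zero_iff] at h h'
  have hU' : Uᴴ * U = 1 := mem_unitaryGroup_iff'.1 hU
  rw [← fromRows_toRows H, ← fromRows_toRows H', h, h', diracJ_eq, fromBlocks_mul_fromRows,
    conjTranspose_fromRows_eq_fromCols_conjTranspose, fromCols_mul_fromRows]
  simp [conjTranspose_mul, Matrix.mul_assoc]
  rw [← Matrix.mul_assoc Uᴴ, hU', Matrix.one_mul]
  simp

/-- The characteristic matrix `(I, -U) φ(1, z)`. -/
def charMat (V : ℝ → Matrix n n ℂ) (U : Matrix n n ℂ) (z : ℂ) : Matrix n n ℂ :=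
  bcMat U * (fundSol V z 1 * phiInit n)

/-- The matrix `(I, -U) ψ(1, z)`. -/
def coCharMat (V : ℝ → Matrix n n ℂ) (U : Matrix n n ℂ) (z : ℂ) : Matrix n n ℂ :=
  bcMat U * (fundSol V z 1 * (mata n)ᴴ)

/-- The Weyl–Titchmarsh function. -/
def weylM (V : ℝ → Matrix n n ℂ) (U : Matrix n n ℂ) (z : ℂ) : Matrix n n ℂ :=
  -((charMat V U z)⁻¹ * coCharMat V U z)

/-- The initial value `a* + J a* M(z)` of the Weyl solution. -/
def weylInit (V : ℝ → Matrix n n ℂ) (U : Matrix n n ℂ) (z : ℂ) : Matrix (n ⊕ n) n ℂ :=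
  (mata n)ᴴ + phiInit n * weylM V U z

theorem charMat_mul_weylM {z : ℂ} (h : IsUnit (charMat V U z)) :
    charMat V U z * weylM V U z = -coCharMat V U z := by
  rw [weylM, Matrix.mul_neg, ← Matrix.mul_assoc,
    Matrix.mul_nonsing_inv _ ((Matrix.isUnit_iff_isUnit_det _).1 h), Matrix.one_mul]

theorem bcMat_mul_weylSol {z : ℂ} (h : IsUnit (charMat V U z)) :
    bcMat U * (fundSol V z 1 * weylInit V U z) = 0 := by
  have := charMat_mul_weylM h
  rw [charMat, coCharMat] at this
  rw [weylInit, Matrix.mul_add, Matrix.mul_add, ← Matrix.mul_assoc _ (phiInit n),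
    ← Matrix.mul_assoc _ _ (weylM V U z), this, add_neg_cancel]

/-- The columns of a* and J a* together are orthonormal, so the cross terms vanish. -/
theorem weylInit_mul_self (z : ℂ) :
    (weylInit V U z)ᴴ * weylInit V U z = 1 + (weylM V U z)ᴴ * weylM V U z := by
  have h : mata n * phiInit n = 0 := by
    have := congrArg Matrix.conjTranspose (phiInit_conjTranspose_mul_mata (n := n))
    simpa [conjTranspose_mul] using this
  rw [weylInit, conjTranspose_add, conjTranspose_mul, conjTranspose_conjTranspose, Matrix.add_mul,
    Matrix.mul_add, Matrix.mul_add, mata_mul_conjTranspose, ← Matrix.mul_assoc, h,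
    Matrix.mul_assoc _ _ (mata n)ᴴ, phiInit_conjTranspose_mul_mata,
    Matrix.mul_assoc, ← Matrix.mul_assoc _ (phiInit n), phiInit_mul_self]
  simp

theorem colSq_weylInit (z : ℂ) (j : n) :
    colSq (weylInit V U z) j = 1 + colSq (weylM V U z) j := by
  have := congrFun (congrFun (weylInit_mul_self (V := V) (U := U) z) j) j
  rw [Matrix.add_apply, conjTranspose_mul_self_diag, conjTranspose_mul_self_diag,
    Matrix.one_apply_eq] at this
  exact_mod_cast this

theorem phiInit_lagrange_weylInit (z : ℂ) :
    (phiInit n)ᴴ * (diracJ n * weylInit V U z) = 1 := by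
  rw [weylInit, Matrix.mul_add, Matrix.mul_add, phiInit_lagrange_mata, ← Matrix.mul_assoc (diracJ n),
    ← Matrix.mul_assoc, phiInit_lagrange_self, Matrix.zero_mul, add_zero]

/-- The ranges of a* and J a* are both isotropic for J and pair to ±1 with each other, so only the
terms linear in M survive. -/
theorem weylInit_lagrange (w z : ℂ) :
    (weylInit V U w)ᴴ * (diracJ n * weylInit V U z) = (weylM V U w)ᴴ - weylM V U z := by
  have h : mata n * (diracJ n * weylInit V U z) = -weylM V U z := by
    rw [weylInit, Matrix.mul_add, Matrix.mul_add, mata_mul_diracJ_mul_conjTranspose, zero_add,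
      phiInit, Matrix.mul_assoc, ← Matrix.mul_assoc (diracJ n), diracJ_mul_self,
      Matrix.neg_mul, Matrix.one_mul, Matrix.mul_neg, ← Matrix.mul_assoc, mata_mul_conjTranspose,
      Matrix.one_mul]
  nth_rewrite 1 [weylInit]
  rw [conjTranspose_add, conjTranspose_mul, conjTranspose_conjTranspose, Matrix.add_mul, h,
    Matrix.mul_assoc, phiInit_lagrange_weylInit, Matrix.mul_one]
  abel

theorem lagrange_fundSol_mul (hV : PotentialIntegrable V) (w z : ℂ) (A : Matrix (n ⊕ n) k ℂ)
    (B : Matrix (n ⊕ n) l ℂ) :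
    (fundSol V w 1 * A)ᴴ * (diracJ n * (fundSol V z 1 * B)) =
      Aᴴ * (diracJ n * B) + (z - star w) • (Aᴴ * (fundGram V (star w) z 1 * B)) := by
  have h := lagrange_fundSol hV w z (right_mem_Icc.2 zero_le_one)
  calc _ = Aᴴ * (((fundSol V w 1)ᴴ * (diracJ n * fundSol V z 1)) * B) := by
        simp only [conjTranspose_mul, Matrix.mul_assoc]
    _ = _ := by
        rw [h, Matrix.add_mul, Matrix.mul_add, Matrix.smul_mul, Matrix.mul_smul]

/-- Lagrange's identity for two Weyl solutions. The term at 1 vanishes because both solutions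
satisfy the boundary condition there, and the term at 0 is `weylInit_lagrange`. For w = z it is the
Herglotz property of M. -/
theorem weylM_sub (hV : PotentialIntegrable V) (hU : U ∈ unitaryGroup n ℂ) {w z : ℂ}
    (hw : IsUnit (charMat V U w)) (hz : IsUnit (charMat V U z)) :
    weylM V U z - (weylM V U w)ᴴ =
      (z - star w) • ((weylInit V U w)ᴴ * (fundGram V (star w) z 1 * weylInit V U z)) := by
  have h := lagrange_fundSol_mul hV w z (weylInit V U w) (weylInit V U z)
  rw [isotropic_of_bcMat_mul_eq_zero hU (bcMat_mul_weylSol hw) (bcMat_mul_weylSol hz),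
    weylInit_lagrange] at h
  rw [← sub_eq_zero, ← neg_eq_zero, h]
  abel

theorem conjTranspose_mul_fundGram_mul (hV : PotentialIntegrable V) (w z : ℂ) [Fintype k]
    [Fintype l] (A : Matrix (n ⊕ n) k ℂ) (B : Matrix (n ⊕ n) l ℂ) (i : k) (j : l) :
    (Aᴴ * (fundGram V (star w) z 1 * B)) i j =
      ∫ t in (0 : ℝ)..1, ((fundSol V w t * A)ᴴ * (fundSol V z t * B)) i j := by
  have hc : ∀ p q, IntervalIntegrable (fun t => ((fundSol V w t)ᴴ * fundSol V z t) p q)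
      volume 0 1 := fun p q => by
    refine ContinuousOn.intervalIntegrable ?_
    rw [uIcc_of_le zero_le_one]
    exact continuousOn_conjTranspose_mul (isDiracSol_fundSol hV z).continuousOn
      (isDiracSol_fundSol hV w).continuousOn p q
  have e : ∀ t, ((fundSol V w t * A)ᴴ * (fundSol V z t * B)) i j =
      ∑ p, ∑ q, star (A p i) * (((fundSol V w t)ᴴ * fundSol V z t) p q * B q j) := fun t => by
    rw [conjTranspose_mul, Matrix.mul_assoc, ← Matrix.mul_assoc _ _ B, Matrix.mul_apply]
    simp only [Matrix.mul_apply (N := B), conjTranspose_apply A, Finset.mul_sum]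
  simp only [e]
  rw [intervalIntegral.integral_finsetSum fun p _ => ?_]
  · rw [Matrix.mul_apply]
    refine Finset.sum_congr rfl fun p _ => ?_
    rw [intervalIntegral.integral_finsetSum fun q _ => ((hc p q).mul_const _).const_mul _,
      Matrix.mul_apply, Finset.mul_sum]
    refine Finset.sum_congr rfl fun q _ => ?_
    rw [intervalIntegral.integral_const_mul, intervalIntegral.integral_mul_const]
    simp [fundGram]
  · have := IntervalIntegrable.sum (μ := volume) (a := 0) (b := 1) Finset.univ
      (f := fun q t => star (A p i) * (((fundSol V w t)ᴴ * fundSol V z t) p q * B q j))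
      fun q _ => ((hc p q).mul_const _).const_mul _
    rw [Finset.sum_fn] at this
    exact this

/-- The number I is the squared L₂ norm of the j-th column of the solution with initial value A; its
lower bound is the integrated lower Grönwall bound. -/
theorem conjTranspose_mul_fundGram_mul_diag (hV : PotentialIntegrable V) (z : ℂ) [Fintype k]
    (A : Matrix (n ⊕ n) k ℂ) (j : k) :
    ∃ I : ℝ, (Aᴴ * (fundGram V (star z) z 1 * A)) j j = (I : ℂ) ∧
      colSq A j ≤ growthConst V |z.im| * I := by
  refine ⟨∫ t in (0 : ℝ)..1, colSq (fundSol V z t * A) j, ?_, ?_⟩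
  · rw [conjTranspose_mul_fundGram_mul hV]
    simp only [conjTranspose_mul_self_diag]
    exact intervalIntegral.integral_ofReal
  · have hs := (isDiracSol_fundSol hV z).mul_const A
    have hci : ContinuousOn (fun t => colSq (fundSol V z t * A) j) (Icc 0 1) :=
      continuousOn_finsetSum _ fun p _ => (hs.continuousOn p j).norm.pow 2
    have h1 : ∫ t in (0 : ℝ)..1, colSq A j ≤
        ∫ t in (0 : ℝ)..1, growthConst V |z.im| * colSq (fundSol V z t * A) j := by
      refine intervalIntegral.integral_mono_on zero_le_one intervalIntegrable_const ?_ ?_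
      · refine IntervalIntegrable.const_mul (ContinuousOn.intervalIntegrable ?_) _
        rwa [uIcc_of_le zero_le_one]
      · intro t ht
        have := (hs.colSq_gronwall hV j ht).2
        rwa [fundSol_zero hV, Matrix.one_mul] at this
    rw [intervalIntegral.integral_const_mul] at h1
    simpa using h1

end Weyl

/-! ### Analytic matrix functions and residues -/

section Residues

theorem differentiable_det {n : Type} [Fintype n] [DecidableEq n] {A : ℂ → Matrix n n ℂ}
    (hA : ∀ i j, Differentiable ℂ fun z => A z i j) : Differentiable ℂ fun z => (A z).det := by
  simp only [Matrix.det_apply]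
  refine Differentiable.fun_sum fun σ _ => Differentiable.const_smul ?_ _
  exact Differentiable.fun_finsetProd fun i _ => hA _ _

theorem differentiable_adjugate {n : Type} [Fintype n] [DecidableEq n] {A : ℂ → Matrix n n ℂ}
    (hA : ∀ i j, Differentiable ℂ fun z => A z i j) (i j : n) :
    Differentiable ℂ fun z => (A z).adjugate i j := by
  simp only [Matrix.adjugate_apply]
  refine differentiable_det fun p q => ?_
  simp only [Matrix.updateRow_apply]
  split_ifs
  · exact differentiable_const _
  · exact hA p q

theorem differentiable_mul_apply {k l m : Type} [Fintype l] {A : ℂ → Matrix k l ℂ}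
    {B : ℂ → Matrix l m ℂ} (hA : ∀ i j, Differentiable ℂ fun z => A z i j)
    (hB : ∀ i j, Differentiable ℂ fun z => B z i j) (i : k) (j : m) :
    Differentiable ℂ fun z => (A z * B z) i j := by
  simp only [Matrix.mul_apply]
  exact Differentiable.fun_sum fun p _ => (hA i p).mul (hB p j)

theorem tendsto_matrix_iff {ι k l : Type} {F : Filter ι} {A : ι → Matrix k l ℂ}
    {A₀ : Matrix k l ℂ} : Tendsto A F (𝓝 A₀) ↔ ∀ i j, Tendsto (fun x => A x i j) F (𝓝 (A₀ i j)) :=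
  tendsto_pi_nhds.trans (forall_congr' fun _ => tendsto_pi_nhds)

theorem tendsto_matrix_mul {ι k l m : Type} [Fintype l] {F : Filter ι} {A : ι → Matrix k l ℂ}
    {B : ι → Matrix l m ℂ} {A₀ : Matrix k l ℂ} {B₀ : Matrix l m ℂ} (hA : Tendsto A F (𝓝 A₀))
    (hB : Tendsto B F (𝓝 B₀)) : Tendsto (fun x => A x * B x) F (𝓝 (A₀ * B₀)) := by
  rw [tendsto_matrix_iff] at *
  intro i j
  simp only [Matrix.mul_apply]
  exact tendsto_finsetSum _ fun p _ => (hA i p).mul (hB p j)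

/-- A function with a simple pole has the expected circle integrals around it. -/
theorem eventually_circleIntegral_eq {f : ℂ → ℂ} {z c : ℂ} (hf : MeromorphicAt f z)
    (hc : Tendsto (fun ζ => (ζ - z) * f ζ) (𝓝[≠] z) (𝓝 c)) :
    ∀ᶠ ε in 𝓝[>] (0 : ℝ), (2 * Real.pi * Complex.I)⁻¹ * circleIntegral f z ε = c := by
  classical
  -- Filling the puncture with the limit gives a continuous meromorphic, hence analytic, function,
  -- to which Cauchy's formula applies.
  set g : ℂ → ℂ := Function.update (fun ζ => (ζ - z) * f ζ) z c with hg
  have hgc : ContinuousAt g z := continuousAt_update_same.2 hc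
  have hgm : MeromorphicAt g z := by
    refine MeromorphicAt.congr (f := fun ζ => (ζ - z) * f ζ)
      (((MeromorphicAt.id z).sub (MeromorphicAt.const z z)).mul hf) ?_
    filter_upwards [self_mem_nhdsWithin] with ζ hζ
    rw [hg, Function.update_of_ne hζ]
  have hga : AnalyticAt ℂ g z := hgm.analyticAt hgc
  obtain ⟨R, hR, hball⟩ := Metric.eventually_nhds_iff_ball.1 hga.eventually_analyticAt
  filter_upwards [Ioo_mem_nhdsGT hR] with ε hε
  have hd : DifferentiableOn ℂ g (Metric.closedBall z ε) := fun ζ hζ =>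
    (hball ζ (Metric.closedBall_subset_ball hε.2 hζ)).differentiableAt.differentiableWithinAt
  have h1 := hd.circleIntegral_sub_inv_smul (Metric.mem_ball_self hε.1)
  have h2 : circleIntegral f z ε = ∮ ζ in C(z, ε), (ζ - z)⁻¹ • g ζ := by
    refine circleIntegral.integral_congr hε.1.le fun ζ hζ => ?_
    have hne : ζ ≠ z := Metric.ne_of_mem_sphere hζ hε.1.ne'
    simp only [hg, Function.update_of_ne hne, smul_eq_mul]
    rw [inv_mul_cancel_left₀ (sub_ne_zero.2 hne)]
  rw [h2, h1, hg, Function.update_self, smul_eq_mul, inv_mul_cancel_left₀ Complex.two_pi_I_ne_zero]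

theorem circleIntegral_congr_eventually {f g : ℂ → ℂ} {z : ℂ} (h : f =ᶠ[𝓝[≠] z] g) :
    ∀ᶠ ε in 𝓝[>] (0 : ℝ), circleIntegral f z ε = circleIntegral g z ε := by
  obtain ⟨R, hR, hball⟩ := Metric.eventually_nhds_iff_ball.1 (eventually_nhdsWithin_iff.1 h)
  filter_upwards [Ioo_mem_nhdsGT hR] with ε hε
  refine circleIntegral.integral_congr hε.1.le fun ζ hζ => hball ζ ?_ ?_
  · exact Metric.closedBall_subset_ball hε.2 (Metric.sphere_subset_closedBall hζ)
  · exact Metric.ne_of_mem_sphere hζ hε.1.ne'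

theorem HasResidueAt.congr {n : Type} {M M' : ℂ → Matrix n n ℂ} {z : ℂ} {C : Matrix n n ℂ}
    (H : HasResidueAt M z C) (h : M =ᶠ[𝓝[≠] z] M') : HasResidueAt M' z C := by
  intro i k
  have h' : (fun ζ => M ζ i k) =ᶠ[𝓝[≠] z] fun ζ => M' ζ i k := h.mono fun ζ hζ => by
    simp only [hζ]
  refine ⟨(H i k).1.congr h', ?_⟩
  filter_upwards [(H i k).2, circleIntegral_congr_eventually h'] with ε h1 h2
  rw [← h2, h1]

theorem HasResidueAt.unique {n : Type} {M : ℂ → Matrix n n ℂ} {z : ℂ} {C C' : Matrix n n ℂ}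
    (H : HasResidueAt M z C) (H' : HasResidueAt M z C') : C = C' := by
  ext i k
  obtain ⟨ε, h1, h2⟩ := ((H i k).2.and (H' i k).2).exists
  rw [← h1, h2]

theorem hasResidueAt_of_tendsto {n : Type} {M : ℂ → Matrix n n ℂ} {z : ℂ} {C : Matrix n n ℂ}
    (hM : ∀ i k, MeromorphicAt (fun ζ => M ζ i k) z)
    (h : Tendsto (fun ζ => (ζ - z) • M ζ) (𝓝[≠] z) (𝓝 C)) : HasResidueAt M z C := fun i k =>
  ⟨hM i k, eventually_circleIntegral_eq (hM i k) (tendsto_matrix_iff.1 h i k)⟩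

/-- A meromorphic function that is `O(1/y)` along the vertical line through `z` has at most a
simple pole at `z`. -/
theorem exists_tendsto_sub_mul_of_vertical_bound {f : ℂ → ℂ} {z : ℂ} {K : ℝ}
    (hf : MeromorphicAt f z)
    (hb : ∀ᶠ y : ℝ in 𝓝[>] 0, y * ‖f (z + y * Complex.I)‖ ≤ K) :
    ∃ c, Tendsto (fun ζ => (ζ - z) * f ζ) (𝓝[≠] z) (𝓝 c) := by
  have hm : MeromorphicAt (fun ζ => (ζ - z) * f ζ) z :=
    ((MeromorphicAt.id z).sub (MeromorphicAt.const z z)).mul hf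
  -- A pole of the product would send its modulus to infinity along every approach, in particular
  -- along the vertical line.
  refine tendsto_nhds_of_meromorphicOrderAt_nonneg hm (not_lt.1 fun hneg => ?_)
  have h1 := tendsto_norm_cobounded_atTop.comp (tendsto_cobounded_of_meromorphicOrderAt_neg hneg)
  have h2 : Tendsto (fun y : ℝ => z + y * Complex.I) (𝓝[>] 0) (𝓝[≠] z) := by
    refine tendsto_nhdsWithin_iff.2 ⟨?_, ?_⟩
    · have : Continuous fun y : ℝ => z + y * Complex.I := by fun_prop
      have h := this.tendsto 0
      simp only [Complex.ofReal_zero, zero_mul, add_zero] at h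
      exact h.mono_left nhdsWithin_le_nhds
    · filter_upwards [self_mem_nhdsWithin] with y hy
      simpa using (ne_of_gt hy : y ≠ 0)
  obtain ⟨y, hy, hy', hy0⟩ := (((h1.comp h2).eventually_gt_atTop K).and
    (hb.and self_mem_nhdsWithin)).exists
  have : (0 : ℝ) < y := hy0
  simp only [Function.comp_apply, add_sub_cancel_left, norm_mul, Complex.norm_I, mul_one,
    Complex.norm_real, Real.norm_of_nonneg this.le] at hy
  linarith

end Residues

/-! ### The Weyl function: simple real poles, residues, and monotonicity between the poles -/

section WeylAnalytic

variable {n : Type} [Fintype n] [DecidableEq n] {V : ℝ → Matrix n n ℂ} {U : Matrix n n ℂ}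

theorem differentiable_bcMat_mul_fundSol (hV : PotentialIntegrable V) (A : Matrix (n ⊕ n) n ℂ)
    (i j : n) : Differentiable ℂ fun z => (bcMat U * (fundSol V z 1 * A)) i j :=
  differentiable_mul_apply (A := fun _ => bcMat U) (B := fun z => fundSol V z 1 * A)
    (fun _ _ => differentiable_const _)
    (differentiable_mul_apply (B := fun _ => A)
      (differentiable_fundSol hV (right_mem_Icc.2 zero_le_one))
      fun _ _ => differentiable_const _) i j

theorem differentiable_charMat (hV : PotentialIntegrable V) (i j : n) :
    Differentiable ℂ fun z => charMat V U z i j :=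
  differentiable_bcMat_mul_fundSol hV _ i j

theorem differentiable_coCharMat (hV : PotentialIntegrable V) (i j : n) :
    Differentiable ℂ fun z => coCharMat V U z i j :=
  differentiable_bcMat_mul_fundSol hV _ i j

/-- Cramer's rule, which presents M as a quotient of entire functions. With the convention 0⁻¹ = 0
it also holds at the zeros of the determinant. -/
theorem weylM_apply (z : ℂ) (i j : n) : weylM V U z i j =
    -((charMat V U z).det⁻¹ * ((charMat V U z).adjugate * coCharMat V U z) i j) := by
  rw [weylM, Matrix.inv_def, Ring.inverse_eq_inv', Matrix.smul_mul]
  simp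

theorem differentiable_adjugate_mul_coCharMat (hV : PotentialIntegrable V) (i j : n) :
    Differentiable ℂ fun z => ((charMat V U z).adjugate * coCharMat V U z) i j :=
  differentiable_mul_apply (differentiable_adjugate (differentiable_charMat hV))
    (differentiable_coCharMat hV) i j

theorem differentiable_det_charMat (hV : PotentialIntegrable V) :
    Differentiable ℂ fun z => (charMat V U z).det :=
  differentiable_det (differentiable_charMat hV)

theorem isUnit_charMat_iff {z : ℂ} : IsUnit (charMat V U z) ↔ (charMat V U z).det ≠ 0 := by
  rw [Matrix.isUnit_iff_isUnit_det, isUnit_iff_ne_zero]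

theorem meromorphicAt_weylM (hV : PotentialIntegrable V) (z : ℂ) (i j : n) :
    MeromorphicAt (fun ζ => weylM V U ζ i j) z := by
  simp only [weylM_apply]
  exact (((differentiable_det_charMat hV).analyticAt z).meromorphicAt.inv.mul
    ((differentiable_adjugate_mul_coCharMat hV i j).analyticAt z).meromorphicAt).neg

theorem continuousAt_weylM (hV : PotentialIntegrable V) {z : ℂ} (hz : IsUnit (charMat V U z)) :
    ContinuousAt (fun ζ => weylM V U ζ) z := by
  refine tendsto_matrix_iff.2 fun i j => ?_
  simp only [weylM_apply]
  exact (((differentiable_det_charMat hV).continuous.tendsto z).inv₀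
    (isUnit_charMat_iff.1 hz)).mul
    ((differentiable_adjugate_mul_coCharMat hV i j).continuous.tendsto z) |>.neg

/-- The spectral parameters for which the boundary problem has nontrivial solutions are real. -/
theorem isUnit_charMat_of_im_ne_zero (hV : PotentialIntegrable V) (hU : U ∈ unitaryGroup n ℂ)
    {z : ℂ} (hz : z.im ≠ 0) : IsUnit (charMat V U z) := by
  rw [isUnit_charMat_iff]
  intro hdet
  obtain ⟨v, hv, hv0⟩ := Matrix.exists_mulVec_eq_zero_iff.2 hdet
  set v' : Matrix n Unit ℂ := Matrix.of fun i _ => v i with hv'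
  have h0 : bcMat U * (fundSol V z 1 * (phiInit n * v')) = 0 := by
    rw [← Matrix.mul_assoc _ (phiInit n), ← Matrix.mul_assoc]
    ext i j
    exact congrFun hv0 i
  have h1 := lagrange_fundSol_mul hV z z (phiInit n * v') (phiInit n * v')
  rw [isotropic_of_bcMat_mul_eq_zero hU h0 h0] at h1
  have h2 : (phiInit n * v')ᴴ * (diracJ n * (phiInit n * v')) = 0 := by
    rw [conjTranspose_mul, Matrix.mul_assoc, ← Matrix.mul_assoc (diracJ n),
      ← Matrix.mul_assoc (phiInit n)ᴴ, phiInit_lagrange_self, Matrix.zero_mul, Matrix.mul_zero]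
  rw [h2, zero_add] at h1
  have hne : z - star z ≠ 0 := by
    intro h
    have := congrArg Complex.im h
    simp at this
    exact hz (by linarith)
  -- The Gram form of the solution φv vanishes, so its initial value does too; J a* is isometric,
  -- which forces v = 0.
  have h3 := (smul_eq_zero.1 h1.symm).resolve_left hne
  obtain ⟨I, hI, hle⟩ := conjTranspose_mul_fundGram_mul_diag hV z (phiInit n * v') ()
  rw [h3, Matrix.zero_apply] at hI
  have hI0 : I = 0 := by exact_mod_cast hI.symm
  rw [hI0, mul_zero] at hle
  have h4 : colSq v' () = 0 := by
    have : colSq (phiInit n * v') () = colSq v' () := by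
      have := conjTranspose_mul_self_diag (phiInit n * v') ()
      rw [conjTranspose_mul, Matrix.mul_assoc, ← Matrix.mul_assoc _ (phiInit n), phiInit_mul_self,
        Matrix.one_mul, conjTranspose_mul_self_diag] at this
      exact_mod_cast this.symm
    exact le_antisymm (this ▸ hle) (colSq_nonneg _ _)
  exact hv (funext fun i => colSq_eq_zero h4 i)

/-- The determinant is entire and nonzero at i, so its zeros are isolated by the identity theorem.
-/
theorem eventually_isUnit_charMat (hV : PotentialIntegrable V) (hU : U ∈ unitaryGroup n ℂ)
    (z : ℂ) : ∀ᶠ ζ in 𝓝[≠] z, IsUnit (charMat V U ζ) := by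
  simp only [isUnit_charMat_iff]
  have hd := differentiable_det_charMat (U := U) hV
  refine ((hd.analyticAt z).eventually_eq_zero_or_eventually_ne_zero).resolve_left fun h => ?_
  have h1 := AnalyticOnNhd.eq_of_eventuallyEq (f := fun z => (charMat V U z).det) (g := fun _ => 0)
    (fun w _ => hd.analyticAt w) (fun w _ => analyticAt_const) h
  exact isUnit_charMat_iff.1 (isUnit_charMat_of_im_ne_zero hV hU (z := Complex.I) (by simp))
    (congrFun h1 Complex.I)

/-- `weylM_sub` with w = z, read on imaginary parts. The number I is the squared L₂ norm of the j-th
column of the Weyl solution, whose initial value has squared length 1 + `colSq (weylM V U z) j`. -/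
theorem weylM_diag_im (hV : PotentialIntegrable V) (hU : U ∈ unitaryGroup n ℂ) {z : ℂ}
    (hz : IsUnit (charMat V U z)) (j : n) : ∃ I : ℝ, (weylM V U z j j).im = z.im * I ∧
      1 + colSq (weylM V U z) j ≤ growthConst V |z.im| * I := by
  obtain ⟨I, hI, hle⟩ := conjTranspose_mul_fundGram_mul_diag hV z (weylInit V U z) j
  refine ⟨I, ?_, by rwa [colSq_weylInit] at hle⟩
  have h := congrFun (congrFun (weylM_sub hV hU hz hz) j) j
  rw [Matrix.sub_apply, Matrix.smul_apply, hI, conjTranspose_apply, smul_eq_mul] at h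
  have h' := congrArg Complex.im h
  simp at h'
  linarith

theorem vertical_bound_weylM (hV : PotentialIntegrable V) (hU : U ∈ unitaryGroup n ℂ) (t : ℝ)
    {y : ℝ} (hy : 0 < y) (hy1 : y ≤ 1) (i j : n) :
    y * ‖weylM V U (t + y * Complex.I) i j‖ ≤ growthConst V 1 := by
  set z : ℂ := t + y * Complex.I with hz
  have him : z.im = y := by simp [hz]
  obtain ⟨I, hI, hle⟩ := weylM_diag_im hV hU
    (isUnit_charMat_of_im_ne_zero hV hU (z := z) (by rw [him]; exact hy.ne')) j
  rw [him] at hI hle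
  set c := growthConst V 1
  have hc : 0 < c := growthConst_pos V 1
  have hM : ∀ p, ‖weylM V U z p j‖ ^ 2 ≤ colSq (weylM V U z) j := fun p => norm_sq_le_colSq _ p j
  have hcol := colSq_nonneg (weylM V U z) j
  have hI0 : 0 < I := by
    have : 0 < growthConst V |y| * I := by linarith
    exact (mul_pos_iff_of_pos_left (growthConst_pos V _)).1 this
  have h1 : growthConst V |y| * I ≤ c * I :=
    mul_le_mul_of_nonneg_right (growthConst_mono V (by rwa [abs_of_pos hy])) hI0.le
  have h2 : y * I ≤ ‖weylM V U z j j‖ := by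
    rw [← hI]; exact (le_abs_self _).trans (Complex.abs_im_le_norm _)
  -- Combines |M_pj|² ≤ cI with yI = Im M_jj ≤ |M_jj|. The case p = j bounds the diagonal entry by
  -- c/y; inserting that bound on the right controls the rest of the column.
  have key : ∀ p, y * ‖weylM V U z p j‖ ^ 2 ≤ c * ‖weylM V U z j j‖ := fun p => by
    calc y * ‖weylM V U z p j‖ ^ 2 ≤ y * (c * I) :=
          mul_le_mul_of_nonneg_left (by linarith [hM p]) hy.le
      _ = c * (y * I) := by ring
      _ ≤ _ := mul_le_mul_of_nonneg_left h2 hc.le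
  have hd : y * ‖weylM V U z j j‖ ≤ c := by
    by_contra! hcon
    have h3 := key j
    have h4 : 0 < ‖weylM V U z j j‖ := by
      by_contra! h
      have : ‖weylM V U z j j‖ = 0 := le_antisymm h (norm_nonneg _)
      rw [this, mul_zero] at hcon
      linarith
    nlinarith
  by_contra! hcon
  have h3 := mul_le_mul_of_nonneg_left (key i) hy.le
  have h4 := mul_le_mul_of_nonneg_left hd hc.le
  nlinarith

/-- The Weyl function has at most simple poles on the real axis. -/
theorem exists_tendsto_sub_smul_weylM (hV : PotentialIntegrable V) (hU : U ∈ unitaryGroup n ℂ)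
    (t : ℝ) : ∃ R, Tendsto (fun ζ : ℂ => (ζ - t) • weylM V U ζ) (𝓝[≠] (t : ℂ)) (𝓝 R) := by
  have h : ∀ i j, ∃ c, Tendsto (fun ζ : ℂ => (ζ - t) * weylM V U ζ i j) (𝓝[≠] (t : ℂ)) (𝓝 c) :=
    fun i j => exists_tendsto_sub_mul_of_vertical_bound (meromorphicAt_weylM hV _ i j) (by
      filter_upwards [Ioo_mem_nhdsGT one_pos] with y hy
      exact vertical_bound_weylM hV hU t hy.1 hy.2.le i j)
  choose c hc using h
  exact ⟨Matrix.of c, tendsto_matrix_iff.2 hc⟩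

/-- Off the poles, `charMat` times M is minus an entire function, so the factor ζ - t sends the
product to zero. -/
theorem charMat_mul_residue (hV : PotentialIntegrable V) (hU : U ∈ unitaryGroup n ℂ)
    {t : ℂ} {R : Matrix n n ℂ}
    (hR : Tendsto (fun ζ : ℂ => (ζ - t) • weylM V U ζ) (𝓝[≠] t) (𝓝 R)) :
    charMat V U t * R = 0 := by
  have h1 : Tendsto (fun ζ => charMat V U ζ) (𝓝[≠] t) (𝓝 (charMat V U t)) :=
    tendsto_matrix_iff.2 fun i j =>
      ((differentiable_charMat hV i j).continuous.tendsto t).mono_left nhdsWithin_le_nhds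
  have h2 : Tendsto (fun ζ => coCharMat V U ζ) (𝓝[≠] t) (𝓝 (coCharMat V U t)) :=
    tendsto_matrix_iff.2 fun i j =>
      ((differentiable_coCharMat hV i j).continuous.tendsto t).mono_left nhdsWithin_le_nhds
  have h3 : Tendsto (fun ζ : ℂ => ζ - t) (𝓝[≠] t) (𝓝 0) := by
    simpa using (tendsto_nhdsWithin_of_tendsto_nhds (tendsto_id (x := 𝓝 t))).sub_const t
  refine tendsto_nhds_unique (tendsto_matrix_mul h1 hR) ?_
  have h4 := (h3.smul h2).neg
  rw [zero_smul, neg_zero] at h4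
  refine h4.congr' ?_
  filter_upwards [eventually_isUnit_charMat hV hU t] with ζ hζ
  rw [Matrix.mul_smul, charMat_mul_weylM hζ, smul_neg]

/-- The Gram matrix `∫₀¹ φ(t,λ)* φ(t,λ) dt` of the solution `φ`, for real `λ`. -/
def phiGram (V : ℝ → Matrix n n ℂ) (t : ℝ) : Matrix n n ℂ :=
  (phiInit n)ᴴ * (fundGram V t t 1 * phiInit n)

/-- Lagrange's identity between φ(·,t)v and the Weyl solution at ζ: both satisfy the condition at 1,
and the term at 0 equals v*. As ζ → t, the Weyl solution multiplied by ζ - t tends to φR. -/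
theorem phiGram_mul_residue (hV : PotentialIntegrable V) (hU : U ∈ unitaryGroup n ℂ)
    {t : ℝ} {R : Matrix n n ℂ}
    (hR : Tendsto (fun ζ : ℂ => (ζ - t) • weylM V U ζ) (𝓝[≠] (t : ℂ)) (𝓝 R))
    {v : Matrix n Unit ℂ} (hv : charMat V U t * v = 0) : vᴴ * (phiGram V t * R) = -vᴴ := by
  set G : ℂ → Matrix (n ⊕ n) (n ⊕ n) ℂ := fun z => fundGram V t z 1 with hG
  have hGt : Tendsto G (𝓝[≠] (t : ℂ)) (𝓝 (G t)) := tendsto_matrix_iff.2 fun i j =>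
    (continuousAt_fundGram hV t t (right_mem_Icc.2 zero_le_one) i j).tendsto.mono_left
      nhdsWithin_le_nhds
  have h3 : Tendsto (fun ζ : ℂ => ζ - t) (𝓝[≠] (t : ℂ)) (𝓝 0) := by
    simpa using (tendsto_nhdsWithin_of_tendsto_nhds (tendsto_id (x := 𝓝 (t : ℂ)))).sub_const (t : ℂ)
  have hD : Tendsto (fun ζ : ℂ => (ζ - t) • weylInit V U ζ) (𝓝[≠] (t : ℂ))
      (𝓝 (phiInit n * R)) := by
    have h4 := (h3.smul_const ((mata n)ᴴ)).add
      (tendsto_matrix_mul (tendsto_const_nhds (x := phiInit n)) hR)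
    rw [zero_smul, zero_add] at h4
    refine h4.congr fun ζ => ?_
    rw [weylInit, smul_add, Matrix.mul_smul]
  have hlim := tendsto_matrix_mul (tendsto_const_nhds (x := vᴴ * (phiInit n)ᴴ))
    (tendsto_matrix_mul hGt hD)
  have heq : (fun _ : ℂ => -vᴴ) =ᶠ[𝓝[≠] (t : ℂ)]
      fun ζ => vᴴ * (phiInit n)ᴴ * (G ζ * ((ζ - t) • weylInit V U ζ)) := by
    filter_upwards [eventually_isUnit_charMat hV hU t] with ζ hζ
    have h0 : bcMat U * (fundSol V t 1 * (phiInit n * v)) = 0 := by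
      rw [← hv, charMat]; simp only [Matrix.mul_assoc]
    have h1 := lagrange_fundSol_mul hV t ζ (phiInit n * v) (weylInit V U ζ)
    rw [isotropic_of_bcMat_mul_eq_zero hU h0 (bcMat_mul_weylSol hζ), conjTranspose_mul,
      Matrix.mul_assoc _ _ (diracJ n * _), phiInit_lagrange_weylInit, Matrix.mul_one] at h1
    have ht : star (t : ℂ) = t := Complex.conj_ofReal t
    rw [ht] at h1
    rw [Matrix.mul_smul, Matrix.mul_smul]
    exact neg_eq_of_add_eq_zero_right h1.symm
  have := tendsto_nhds_unique (hlim.congr' heq.symm) tendsto_const_nhds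
  rw [← this, phiGram]
  simp only [Matrix.mul_assoc, hG]

/-- At a real point off the poles M is Hermitian, so `weylM_sub` becomes an exact difference
quotient; its limit on the diagonal is the squared norm of a column of the Weyl solution. -/
theorem hasDerivAt_weylM_diag (hV : PotentialIntegrable V) (hU : U ∈ unitaryGroup n ℂ) {t : ℝ}
    (ht : IsUnit (charMat V U t)) (j : n) : ∃ d : ℝ,
      HasDerivAt (fun s : ℝ => (weylM V U s j j).re) d t ∧
        1 + (weylM V U t j j).re ^ 2 ≤ growthConst V 0 * d := by
  have hst : star (t : ℂ) = t := Complex.conj_ofReal t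
  obtain ⟨I, hI, hle⟩ := conjTranspose_mul_fundGram_mul_diag hV t (weylInit V U t) j
  have hherm := weylM_sub hV hU ht ht
  rw [hst, sub_self, zero_smul, sub_eq_zero] at hherm
  have hev : ∀ᶠ z in 𝓝 (t : ℂ), IsUnit (charMat V U z) := by
    simp only [isUnit_charMat_iff] at ht ⊢
    exact (differentiable_det_charMat hV).continuous.continuousAt.eventually_ne ht
  have hder : HasDerivAt (fun z => weylM V U z j j)
      (((weylInit V U t)ᴴ * (fundGram V t t 1 * weylInit V U t)) j j) (t : ℂ) := by
    refine hasDerivAt_of_eq_add_mul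
      (g := fun z => ((weylInit V U t)ᴴ * (fundGram V t z 1 * weylInit V U z)) j j) ?_ ?_
    · filter_upwards [hev] with z hz
      have h := congrFun (congrFun (weylM_sub hV hU ht hz) j) j
      rw [← hherm, hst, Matrix.sub_apply, Matrix.smul_apply, smul_eq_mul] at h
      rw [← h]; ring
    · have hG : Tendsto (fun z => fundGram V t z 1) (𝓝 (t : ℂ)) (𝓝 (fundGram V t t 1)) :=
        tendsto_matrix_iff.2 fun i j =>
          (continuousAt_fundGram hV t t (right_mem_Icc.2 zero_le_one) i j).tendsto
      have hD : Tendsto (fun z => weylInit V U z) (𝓝 (t : ℂ)) (𝓝 (weylInit V U t)) :=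
        tendsto_const_nhds.add (tendsto_matrix_mul tendsto_const_nhds (continuousAt_weylM hV ht))
      exact tendsto_matrix_iff.1 (tendsto_matrix_mul tendsto_const_nhds
        (tendsto_matrix_mul hG hD)) j j
  rw [hst] at hI
  rw [hI] at hder
  refine ⟨I, by simpa using hder.real_of_complex, ?_⟩
  rw [colSq_weylInit, Complex.ofReal_im, abs_zero] at hle
  have h1 := norm_sq_le_colSq (weylM V U t) j j
  have h2 := Complex.abs_re_le_norm (weylM V U t j j)
  have h3 : (weylM V U t j j).re ^ 2 ≤ ‖weylM V U t j j‖ ^ 2 := by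
    rw [← sq_abs]; gcongr
  linarith

/-- Every sufficiently long real interval contains a zero of the characteristic determinant. -/
theorem exists_not_isUnit_charMat [Nonempty n] (hV : PotentialIntegrable V)
    (hU : U ∈ unitaryGroup n ℂ) (t : ℝ) :
    ∃ s ∈ Icc t (t + growthConst V 0 * Real.pi), ¬ IsUnit (charMat V U (s : ℂ)) := by
  by_contra! hcon
  obtain ⟨j⟩ := ‹Nonempty n›
  set c := growthConst V 0
  have hc : 0 < c := growthConst_pos V 0
  have hpi := Real.pi_pos
  choose! d hd hle using fun s (hs : s ∈ Icc t (t + c * Real.pi)) =>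
    hasDerivAt_weylM_diag hV hU (hcon s hs) j
  -- The arctangent has derivative at least 1/c, so over a pole-free interval of length cπ it would
  -- grow by at least π, whereas its range is an open interval of length π.
  set f : ℝ → ℝ := fun s => Real.arctan (weylM V U s j j).re - s / c with hf
  have hfd : ∀ s ∈ Icc t (t + c * Real.pi), HasDerivAt f
      (1 / (1 + (weylM V U s j j).re ^ 2) * d s - 1 / c) s := fun s hs =>
    (hd s hs).arctan.sub ((hasDerivAt_id s).div_const c)
  have hmono : MonotoneOn f (Icc t (t + c * Real.pi)) := by
    refine monotoneOn_of_deriv_nonneg (convex_Icc _ _)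
      (fun s hs => (hfd s hs).continuousAt.continuousWithinAt)
      (fun s hs => (hfd s (interior_subset hs)).differentiableAt.differentiableWithinAt)
      fun s hs => ?_
    rw [(hfd s (interior_subset hs)).deriv]
    have h1 := hle s (interior_subset hs)
    have h2 : 0 < 1 + (weylM V U s j j).re ^ 2 := by positivity
    rw [sub_nonneg, one_div_mul_eq_div, div_le_div_iff₀ hc h2]
    linarith
  have hle' : t ≤ t + c * Real.pi := by linarith [mul_pos hc hpi]
  have h1 := hmono (left_mem_Icc.2 hle') (right_mem_Icc.2 hle') hle'
  simp only [hf] at h1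
  have h2 := Real.arctan_lt_pi_div_two (weylM V U (t + c * Real.pi : ℝ) j j).re
  have h3 := Real.neg_pi_div_two_lt_arctan (weylM V U t j j).re
  have h4 : (t + c * Real.pi) / c = t / c + Real.pi := by field_simp
  linarith

end WeylAnalytic

/-! ### Labelling of discrete sets of reals by the integers -/

section Labelling

/-- A nonempty locally finite linear order without extremes is isomorphic to ℤ; a shift moves the
greatest index with a negative value to 0. -/
theorem exists_int_labelling {S : Set ℝ} (hfin : ∀ a b, (S ∩ Icc a b).Finite)
    (hup : ∀ t, ∃ s ∈ S, t < s) (hdown : ∀ t, ∃ s ∈ S, s < t) :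
    ∃ f : ℤ → ℝ, StrictMono f ∧ range f = S ∧ f 0 < 0 ∧ 0 ≤ f 1 := by
  classical
  let _ : LocallyFiniteOrder S := LocallyFiniteOrder.ofFiniteIcc fun a b => by
    refine Finite.of_finite_image (f := ((↑) : S → ℝ)) ((hfin a b).subset ?_)
      Subtype.val_injective.injOn
    rintro _ ⟨x, hx, rfl⟩
    exact ⟨x.2, hx⟩
  let _ : SuccOrder S := LinearLocallyFiniteOrder.succOrder S
  let _ : PredOrder S := LinearLocallyFiniteOrder.predOrder S
  have _ : Nonempty S := let ⟨s, hs, _⟩ := hup 0; ⟨⟨s, hs⟩⟩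
  have _ : NoMaxOrder S := ⟨fun a => let ⟨s, hs, h⟩ := hup a; ⟨⟨s, hs⟩, h⟩⟩
  have _ : NoMinOrder S := ⟨fun a => let ⟨s, hs, h⟩ := hdown a; ⟨⟨s, hs⟩, h⟩⟩
  let e : S ≃o ℤ := orderIsoIntOfLinearSuccPredArch
  let g : ℤ → ℝ := fun j => e.symm j
  have hg : StrictMono g := fun a b h => e.symm.strictMono h
  have hrange : range g = S := by
    ext x
    constructor
    · rintro ⟨j, rfl⟩
      exact (e.symm j).2
    · intro hx
      exact ⟨e ⟨x, hx⟩, by simp [g]⟩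
  obtain ⟨s₁, hs₁, h₁⟩ := hup 0
  obtain ⟨s₂, hs₂, h₂⟩ := hdown 0
  rw [← hrange] at hs₁ hs₂
  obtain ⟨j₁, rfl⟩ := hs₁
  obtain ⟨j₂, rfl⟩ := hs₂
  obtain ⟨m, hm, hmax⟩ := Int.exists_greatest_of_bdd (P := fun j => g j < 0)
    ⟨j₁, fun j hj => (hg.lt_iff_lt.1 (hj.trans h₁)).le⟩ ⟨j₂, h₂⟩
  refine ⟨fun j => g (j + m), fun a b h => hg (by omega), ?_, by simpa using hm, ?_⟩
  · rw [← hrange]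
    exact (Equiv.addRight m).surjective.range_comp g
  · by_contra! h
    have := hmax _ h
    omega

/-- Both sequences carry the least nonnegative element at index 1, and agreement at one index passes
to its two neighbours because the ranges coincide. -/
theorem int_labelling_unique {f g : ℤ → ℝ} (hf : StrictMono f) (hg : StrictMono g)
    (hfg : range f = range g) (hf0 : f 0 < 0) (hf1 : 0 ≤ f 1) (hg0 : g 0 < 0) (hg1 : 0 ≤ g 1) :
    f = g := by
  have aux : ∀ {f g : ℤ → ℝ}, StrictMono f → StrictMono g → range f = range g → ∀ {i j : ℤ},
      f i = g j → f (i + 1) ≤ g (j + 1) ∧ f (i - 1) ≤ g (j - 1) := by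
    intro f g hf hg hfg i j hij
    obtain ⟨a, ha⟩ : g (j + 1) ∈ range f := hfg ▸ mem_range_self _
    obtain ⟨b, hb⟩ : f (i - 1) ∈ range g := hfg ▸ mem_range_self _
    have h1 : i < a := hf.lt_iff_lt.1 (by rw [ha, hij]; exact hg (by omega))
    have h2 : b < j := hg.lt_iff_lt.1 (by rw [hb, ← hij]; exact hf (by omega))
    exact ⟨ha ▸ hf.monotone (by omega), hb ▸ hg.monotone (by omega)⟩
  have base : ∀ {f g : ℤ → ℝ}, StrictMono f → StrictMono g → range f = range g →
      f 0 < 0 → 0 ≤ g 1 → f 1 ≤ g 1 := by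
    intro f g hf hg hfg h0 h1
    obtain ⟨a, ha⟩ : g 1 ∈ range f := hfg ▸ mem_range_self _
    have : 0 < a := hf.lt_iff_lt.1 (by rw [ha]; linarith)
    exact ha ▸ hf.monotone (by omega)
  have h1 : f 1 = g 1 := le_antisymm (base hf hg hfg hf0 hg1) (base hg hf hfg.symm hg0 hf1)
  funext j
  refine Int.inductionOn' (motive := fun j => f j = g j) j 1 h1 (fun k _ h => ?_) fun k _ h => ?_
  · exact le_antisymm (aux hf hg hfg h).1 (aux hg hf hfg.symm h.symm).1
  · exact le_antisymm (aux hf hg hfg h).2 (aux hg hf hfg.symm h.symm).2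

theorem IsEigenvalueLabelling.unique {H : Type} [AddCommGroup H] [Module ℂ H] {T : H →ₗ.[ℂ] H}
    {f g : ℤ → ℝ} (hf : IsEigenvalueLabelling T f) (hg : IsEigenvalueLabelling T g) : f = g := by
  refine int_labelling_unique hf.strictMono hg.strictMono ?_ hf.zero_neg hf.one_nonneg hg.zero_neg
    hg.one_nonneg
  ext x
  have h := (hf.isEigenvalue_iff x).symm.trans (hg.isEigenvalue_iff x)
  simpa [eq_comm] using h

theorem isEigenvalue_iff_graph {H : Type} [AddCommGroup H] [Module ℂ H] {T : H →ₗ.[ℂ] H} {z : ℂ} :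
    IsEigenvalue T z ↔ ∃ y : H, y ≠ 0 ∧ (y, z • y) ∈ T.graph := by
  constructor
  · rintro ⟨y, hy, h⟩
    exact ⟨y, hy, (LinearPMap.mem_graph_iff T).2 ⟨y, rfl, h⟩⟩
  · rintro ⟨y, hy, h⟩
    obtain ⟨y', h1, h2⟩ := (LinearPMap.mem_graph_iff T).1 h
    simp only at h1 h2
    subst h1
    exact ⟨y', hy, h2⟩

end Labelling

/-! ### The eigenvalues of `S_{V,U}` -/

section EigenvaluesS

variable {n : Type} [Fintype n] [DecidableEq n] {V : ℝ → Matrix n n ℂ} {U : Matrix n n ℂ}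

/-- The number `1 / (i √2)`. -/
def phiScalar : ℂ := -Complex.I * ((1 / Real.sqrt 2 : ℝ) : ℂ)

theorem phiScalar_ne_zero : phiScalar ≠ 0 := by
  simp [phiScalar]

/-- With equal scalar blocks, the range of J a* is exactly the subspace f₁(0) = f₂(0). -/
theorem phiInit_eq : phiInit n = fromRows (phiScalar • 1) (phiScalar • 1) := by
  rw [phiInit, mata, conjTranspose_smul, conjTranspose_fromCols_eq_fromRows_conjTranspose,
    Matrix.mul_smul, diracJ_eq, fromBlocks_mul_fromRows]
  ext i j
  rcases i with i | i <;> simp [phiScalar] <;> ring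

theorem memLp_toLp_of_continuousOn {m : Type} [Fintype m] {a b : ℝ} {g : ℝ → m → ℂ}
    (hg : ∀ i, ContinuousOn (fun x => g x i) (Icc a b)) :
    MemLp (fun x => (WithLp.toLp 2 (g x) : EuclideanSpace ℂ m)) 2
      (volume.restrict (Ioo a b)) := by
  have hc : ContinuousOn (fun x => (WithLp.toLp 2 (g x) : EuclideanSpace ℂ m)) (Icc a b) :=
    (PiLp.continuous_toLp 2 _).comp_continuousOn (continuousOn_pi.2 hg)
  obtain ⟨C, hC⟩ := isCompact_Icc.exists_bound_of_continuousOn hc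
  refine MemLp.of_bound ((hc.mono Ioo_subset_Icc_self).aestronglyMeasurable measurableSet_Ioo) C ?_
  rw [ae_restrict_iff' measurableSet_Ioo]
  exact ae_of_all _ fun x hx => hC x (Ioo_subset_Icc_self hx)

/-- The condition at 0 puts the initial value in the range of J a*, so every candidate is φ(·,z)v;
the condition at 1 then says that v lies in the kernel of `charMat`. -/
theorem isEigenvalue_opS_iff (hV : PotentialIntegrable V) {z : ℂ} :
    IsEigenvalue (opS V U) z ↔ ¬ IsUnit (charMat V U z) := by
  rw [isEigenvalue_iff_graph, opS, graph_diracOperator zero_lt_one, isUnit_charMat_iff, not_not,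
    ← Matrix.exists_mulVec_eq_zero_iff]
  have hκ0 := phiScalar_ne_zero
  constructor
  · rintro ⟨y, hy, g, g', hp, hyg, hzg, hbc0, hbc1⟩
    let Y : ℝ → Matrix (n ⊕ n) Unit ℂ := fun x => Matrix.of fun i _ => g x i
    have hY : IsDiracSol V z Y := by
      refine MatPrim.congr_deriv (Y' := fun x => Matrix.of fun i _ => g' x i) zero_le_one
        (fun i _ => hp i) ?_
      filter_upwards [hyg, hzg, Lp.coeFn_smul z y] with x h1 h2 h3
      rw [neg_diracJ_mul_eq_iff, eq_sub_iff_add_eq]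
      have h2' : (z • y : L2 0 1 (n ⊕ n)) x =
        WithLp.toLp 2 (diracJ n *ᵥ g' x + diracPotential V x *ᵥ g x) := h2
      have h1' : y x = WithLp.toLp 2 (g x) := h1
      rw [h3, Pi.smul_apply, h1'] at h2'
      have h4 := congrArg WithLp.ofLp h2'
      ext i j
      exact (congrFun h4 i).symm
    have hYe : ∀ x ∈ Icc (0 : ℝ) 1, Y x = fundSol V z x * Y 0 := fun x hx =>
      hY.eq_fundSol_mul hV hx
    have hY0 : Y 0 = phiInit n * Matrix.of fun i (_ : Unit) => phiScalar⁻¹ * g 0 (Sum.inl i) := by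
      rw [phiInit_eq, fromRows_mul]
      ext i j
      rcases i with i | i
      · simp [Y, hκ0]
      · have := congrFun hbc0 i
        simp only [Function.comp_apply] at this
        simp [Y, hκ0, this]
    refine ⟨fun i => phiScalar⁻¹ * g 0 (Sum.inl i), fun h0 => hy ?_, ?_⟩
    · have hY00 : Y 0 = 0 := by
        rw [hY0]
        have : (Matrix.of fun i (_ : Unit) => phiScalar⁻¹ * g 0 (Sum.inl i)) = 0 := by
          ext i j; exact congrFun h0 i
        rw [this, Matrix.mul_zero]
      refine Lp.ext ?_
      filter_upwards [hyg, Lp.coeFn_zero (EuclideanSpace ℂ (n ⊕ n)) 2 (volume.restrict (Ioo 0 1)),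
        ae_restrict_mem measurableSet_Ioo] with x h1 h2 hx
      have h1' : y x = WithLp.toLp 2 (g x) := h1
      rw [h1', h2]
      have h3 := hYe x (Ioo_subset_Icc_self hx)
      rw [hY00, Matrix.mul_zero] at h3
      ext i
      exact congrFun (congrFun h3 i) ()
    · have h1 : bcMat U * Y 1 = 0 := by
        rw [bcMat_mul_eq_zero_iff]
        ext i j
        exact congrFun hbc1 i
      rw [hYe 1 (right_mem_Icc.2 zero_le_one), hY0, ← Matrix.mul_assoc (fundSol V z 1),
        ← Matrix.mul_assoc] at h1
      ext i
      exact congrFun (congrFun h1 i) ()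
  · rintro ⟨v, hv, hv0⟩
    let v' : Matrix n Unit ℂ := Matrix.of fun i _ => v i
    let Y : ℝ → Matrix (n ⊕ n) Unit ℂ := fun x => fundSol V z x * (phiInit n * v')
    have hY : IsDiracSol V z Y := (isDiracSol_fundSol hV z).mul_const _
    have hY0 : Y 0 = phiInit n * v' := by simp [Y, fundSol_zero hV]
    have hmem := memLp_toLp_of_continuousOn (g := fun x i => Y x i ())
      (fun i => hY.continuousOn i ())
    have hae := hmem.coeFn_toLp
    refine ⟨hmem.toLp _, fun h0 => hv ?_, fun x i => Y x i (),
      fun x i => (-(diracJ n * (z • Y x - diracPotential V x * Y x))) i (), fun i => hY i (),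
      hae, ?_, ?_, ?_⟩
    -- If the class were zero, the solution would vanish at some point of (0,1), and the backward
    -- Grönwall bound would carry that zero to the origin.
    · rw [h0] at hae
      have : (ae (volume.restrict (Ioo (0 : ℝ) 1))).NeBot := by
        rw [ae_neBot, Ne, Measure.restrict_eq_zero, Real.volume_Ioo]
        simp
      obtain ⟨x, h1, h2, hx⟩ := (hae.and ((Lp.coeFn_zero (EuclideanSpace ℂ (n ⊕ n)) 2
        (volume.restrict (Ioo (0 : ℝ) 1))).and (ae_restrict_mem measurableSet_Ioo))).exists
      rw [h2] at h1
      have h3 : colSq (Y x) () = 0 :=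
        Finset.sum_eq_zero fun i _ => by
          have := congrFun (congrArg WithLp.ofLp h1) i
          simp only [Pi.zero_apply, WithLp.ofLp_zero] at this
          rw [← this]; simp
      have h4 := (hY.colSq_gronwall hV () (Ioo_subset_Icc_self hx)).2
      rw [h3, mul_zero] at h4
      have h5 := le_antisymm h4 (colSq_nonneg _ _)
      ext i
      have h6 := colSq_eq_zero h5 (Sum.inl i)
      rw [hY0, phiInit_eq, fromRows_mul] at h6
      simpa [hκ0, v'] using h6
    · filter_upwards [hae, Lp.coeFn_smul z (hmem.toLp _)] with x h1 h2
      change (z • hmem.toLp _ : L2 0 1 (n ⊕ n)) x = _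
      rw [h2, Pi.smul_apply, h1]
      have h3 : diracJ n * -(diracJ n * (z • Y x - diracPotential V x * Y x)) +
          diracPotential V x * Y x = z • Y x := by
        rw [neg_diracJ_mul_eq_iff.1 rfl, sub_add_cancel]
      ext i
      exact (congrFun (congrFun h3 i) ()).symm
    · ext i
      change Y 0 (Sum.inl i) () = Y 0 (Sum.inr i) ()
      rw [hY0, phiInit_eq, fromRows_mul]
      rfl
    · have h1 : bcMat U * Y 1 = 0 := by
        have : charMat V U z * v' = 0 := by
          ext i j; exact congrFun hv0 i
        rw [← this, charMat]; simp only [Y, Matrix.mul_assoc]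
      rw [bcMat_mul_eq_zero_iff] at h1
      ext i
      exact congrFun (congrFun h1 i) ()

theorem exists_isEigenvalueLabelling_opS [Nonempty n] (hV : PotentialIntegrable V)
    (hU : U ∈ unitaryGroup n ℂ) : ∃ lam : ℤ → ℝ, IsEigenvalueLabelling (opS V U) lam := by
  have hc : 0 < growthConst V 0 * Real.pi := mul_pos (growthConst_pos V 0) Real.pi_pos
  have hfin : ∀ a b, ({t : ℝ | ¬ IsUnit (charMat V U (t : ℂ))} ∩ Icc a b).Finite := by
    intro a b
    by_contra hinf
    -- Infinitely many eigenvalues in a compact interval would accumulate, contrary to the isolation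
    -- of the zeros of the determinant.
    obtain ⟨x, -, hx⟩ := Set.Infinite.exists_accPt_of_subset_isCompact hinf isCompact_Icc
      inter_subset_right
    rw [accPt_iff_frequently_nhdsNE] at hx
    refine hx ?_
    have ht : Tendsto (fun t : ℝ => (t : ℂ)) (𝓝[≠] x) (𝓝[≠] (x : ℂ)) :=
      tendsto_nhdsWithin_iff.2 ⟨(Complex.continuous_ofReal.tendsto x).mono_left nhdsWithin_le_nhds,
        by filter_upwards [self_mem_nhdsWithin] with t ht using fun h => ht (Complex.ofReal_injective h)⟩
    filter_upwards [ht.eventually (eventually_isUnit_charMat hV hU x)] with t ht hmem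
    exact hmem.1 ht
  have hup : ∀ t, ∃ s ∈ {t : ℝ | ¬ IsUnit (charMat V U (t : ℂ))}, t < s := by
    intro t
    obtain ⟨s, hs, h⟩ := exists_not_isUnit_charMat hV hU (t + 1)
    exact ⟨s, h, by linarith [hs.1]⟩
  have hdown : ∀ t, ∃ s ∈ {t : ℝ | ¬ IsUnit (charMat V U (t : ℂ))}, s < t := by
    intro t
    -- The search window is chosen to end at t - 1.
    obtain ⟨s, hs, h⟩ := exists_not_isUnit_charMat hV hU (t - 1 - growthConst V 0 * Real.pi)
    exact ⟨s, h, by linarith [hs.2]⟩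
  obtain ⟨f, hf, hr, h0, h1⟩ := exists_int_labelling hfin hup hdown
  refine ⟨f, hf, fun z => ?_, h0, h1⟩
  rw [isEigenvalue_opS_iff hV]
  constructor
  · intro hz
    have him : z.im = 0 := by
      by_contra h
      exact hz (isUnit_charMat_of_im_ne_zero hV hU h)
    have hzr : z = (z.re : ℂ) := Complex.ext rfl (by simpa using him)
    rw [hzr] at hz
    obtain ⟨j, hj⟩ : z.re ∈ range f := hr ▸ hz
    exact ⟨j, by rw [hj]; exact hzr⟩
  · rintro ⟨j, rfl⟩
    have : f j ∈ {t : ℝ | ¬ IsUnit (charMat V U (t : ℂ))} := hr ▸ mem_range_self j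
    exact this

end EigenvaluesS

/-! ### The square root of a unitary matrix -/

section HalfPower

variable {n : Type} [Fintype n] [DecidableEq n]

/-- Half of the argument of `w`, taken in `[0, π)` for the argument in `[0, 2π)`. -/
def halfArg (w : ℂ) : ℝ := if 0 ≤ w.arg then w.arg / 2 else w.arg / 2 + Real.pi

theorem halfArg_mem (w : ℂ) : halfArg w ∈ Ico 0 Real.pi := by
  have h1 := Complex.neg_pi_lt_arg w
  have h2 := Complex.arg_le_pi w
  have h3 := Real.pi_pos
  unfold halfArg
  split_ifs with h
  · exact ⟨by linarith, by linarith⟩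
  · exact ⟨by linarith, by linarith⟩

theorem exp_two_mul_halfArg {w : ℂ} (hw : ‖w‖ = 1) :
    Complex.exp (2 * halfArg w * Complex.I) = w := by
  have h := Complex.norm_mul_exp_arg_mul_I w
  rw [hw, Complex.ofReal_one, one_mul] at h
  unfold halfArg
  split_ifs with h0
  · push_cast
    rw [mul_div_cancel₀ _ (two_ne_zero)]
    exact h
  · push_cast
    have : (2 * ((w.arg : ℂ) / 2 + Real.pi) * Complex.I) =
        w.arg * Complex.I + 2 * Real.pi * Complex.I := by ring
    rw [this, Complex.exp_add, Complex.exp_two_pi_mul_I, mul_one, h]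

/-- Equal exponentials of the doubled angles mean that the angles differ by a multiple of π, and
both lie in [0,π). -/
theorem halfArg_exp {γ : ℝ} (hγ : γ ∈ Ico 0 Real.pi) :
    halfArg (Complex.exp (2 * γ * Complex.I)) = γ := by
  set w := Complex.exp (2 * γ * Complex.I) with hw
  have hn : ‖w‖ = 1 := by
    have : w = Complex.exp ((2 * γ : ℝ) * Complex.I) := by rw [hw]; push_cast; rfl
    rw [this, Complex.norm_exp_ofReal_mul_I]
  have h := exp_two_mul_halfArg hn
  rw [hw, Complex.exp_eq_exp_iff_exists_int] at h
  obtain ⟨m, hm⟩ := h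
  have h1 := congrArg Complex.im hm
  simp at h1
  have h2 := halfArg_mem w
  have h3 : halfArg w = γ + m * Real.pi := by
    rw [hw]; linarith
  have hpi := Real.pi_pos
  have h4 : (m : ℝ) < 1 := by
    by_contra! hc
    nlinarith [h2.2, hγ.1]
  have h5 : (-1 : ℝ) < m := by
    by_contra! hc
    nlinarith [h2.1, hγ.2]
  have h6 : m = 0 := by
    have h4' : m < 1 := by exact_mod_cast h4
    have h5' : -1 < m := by exact_mod_cast h5
    omega
  rw [h3, h6]; simp

open scoped Matrix.Norms.L2Operator in
-- U is normal with finite spectrum, so the functional calculus accepts the discontinuous branch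
-- e^(i `halfArg`), and the spectral mapping theorem supplies the eigenvalues.
theorem exists_isHalfPower {U : Matrix n n ℂ} (hU : U ∈ unitaryGroup n ℂ) :
    ∃ R, IsHalfPower U R := by
  have hnormal : IsStarNormal U := ⟨by
    rw [commute_iff_eq, mem_unitaryGroup_iff.1 hU, mem_unitaryGroup_iff'.1 hU]⟩
  have hspec : ∀ w ∈ spectrum ℂ U, ‖w‖ = 1 := fun w hw => by
    simpa using Unitary.spectrum_subset_circle (⟨U, hU⟩ : unitary (Matrix n n ℂ)) hw
  let f : ℂ → ℂ := fun w => Complex.exp (halfArg w * Complex.I)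
  have hfin : (spectrum ℂ U).Finite := Matrix.finite_spectrum U
  have hf : ContinuousOn f (spectrum ℂ U) := hfin.continuousOn f
  refine ⟨cfc f U, ?_, ?_⟩
  · rw [← cfc_mul f f U hf hf]
    have : cfc (fun x => f x * f x) U = cfc (id : ℂ → ℂ) U := by
      refine cfc_congr fun w hw => ?_
      simp only [f, id, ← Complex.exp_add]
      rw [← two_mul, ← mul_assoc]
      exact exp_two_mul_halfArg (hspec w hw)
    rw [this, cfc_id ℂ U]
  · rw [cfc_map_spectrum f U hnormal hf]
    ext w
    constructor
    · rintro ⟨u, hu, rfl⟩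
      exact ⟨halfArg u, halfArg_mem u, rfl, by rwa [exp_two_mul_halfArg (hspec u hu)]⟩
    · rintro ⟨γ, hγ, rfl, h⟩
      exact ⟨_, h, by simp only [f, halfArg_exp hγ]⟩

end HalfPower

/-! ### The spectral data of `S_{V,U}` -/

section SpectralDataS

variable {n : Type} [Fintype n] [DecidableEq n] {V : ℝ → Matrix n n ℂ} {U : Matrix n n ℂ}

theorem IsHalfPower.isUnit {R : Matrix n n ℂ} (hU : U ∈ unitaryGroup n ℂ) (hR : IsHalfPower U R) :
    IsUnit R := by
  have h : R * (R * star U) = 1 := by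
    rw [← Matrix.mul_assoc, hR.1, mem_unitaryGroup_iff.1 hU]
  exact IsUnit.of_mul_eq_one _ h

/-- From R² = U one has b_U = N(I, -U) with N = R⁻¹/√2. The factor N cancels in the Weyl function.
-/
theorem matb_eq {R : Matrix n n ℂ} (hU : U ∈ unitaryGroup n ℂ) (hR : IsHalfPower U R) :
    ∃ N : Matrix n n ℂ, IsUnit N ∧ matb R = N * bcMat U := by
  have hRu := hR.isUnit hU
  have hdet := (Matrix.isUnit_iff_isUnit_det _).1 hRu
  have hs : ((1 / Real.sqrt 2 : ℝ) : ℂ) ≠ 0 := by simp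
  refine ⟨((1 / Real.sqrt 2 : ℝ) : ℂ) • R⁻¹, ?_, ?_⟩
  · have : IsUnit R⁻¹ := (Matrix.isUnit_nonsing_inv_iff).2 hRu
    exact this.smul (Units.mk0 _ hs)
  · rw [matb, bcMat, Matrix.smul_mul, mul_fromCols, Matrix.mul_one, Matrix.mul_neg, ← hR.1,
      ← Matrix.mul_assoc, Matrix.nonsing_inv_mul _ hdet, Matrix.one_mul]

theorem inv_mul_mul_cancel {N A B : Matrix n n ℂ} (hN : IsUnit N) :
    (N * A)⁻¹ * (N * B) = A⁻¹ * B := by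
  rw [Matrix.mul_inv_rev, Matrix.mul_assoc, ← Matrix.mul_assoc _ N,
    Matrix.nonsing_inv_mul _ ((Matrix.isUnit_iff_isUnit_det _).1 hN), Matrix.one_mul]

/-- After the cancellation no choice of square root matters. The values at singular points remain
free, but residues do not see them. -/
theorem isWeylFunction_iff (hV : PotentialIntegrable V) (hU : U ∈ unitaryGroup n ℂ)
    {M : ℂ → Matrix n n ℂ} : IsWeylFunction V U M ↔
      ∀ z, IsUnit (charMat V U z) → M z = weylM V U z := by
  have key : ∀ {R : Matrix n n ℂ} {φ ψ : ℂ → ℝ → Matrix (n ⊕ n) n ℂ}, IsHalfPower U R →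
      (∀ z, φ z 1 = fundSol V z 1 * phiInit n) → (∀ z, ψ z 1 = fundSol V z 1 * (mata n)ᴴ) →
      ((∀ z, IsUnit (matb R * φ z 1) → M z = -((matb R * φ z 1)⁻¹ * (matb R * ψ z 1))) ↔
        ∀ z, IsUnit (charMat V U z) → M z = weylM V U z) := by
    intro R φ ψ hR hφ hψ
    obtain ⟨N, hN, hb⟩ := matb_eq hU hR
    refine forall_congr' fun z => ?_
    rw [hb, hφ, hψ, Matrix.mul_assoc, Matrix.mul_assoc, inv_mul_mul_cancel hN, weylM, charMat,
      coCharMat, hN.mul_left_iff]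
  constructor
  · rintro ⟨R, φ, ψ, hR, hφ, hψ, h⟩
    refine (key hR (fun z => ?_) fun z => ?_).1 h
    · obtain ⟨h1, h2⟩ := isCauchySolution_iff.1 (hφ z)
      rw [h1.eq_fundSol_mul hV (right_mem_Icc.2 zero_le_one), h2, phiInit]
    · obtain ⟨h1, h2⟩ := isCauchySolution_iff.1 (hψ z)
      rw [h1.eq_fundSol_mul hV (right_mem_Icc.2 zero_le_one), h2]
  · intro h
    obtain ⟨R, hR⟩ := exists_isHalfPower hU
    refine ⟨R, fun z x => fundSol V z x * phiInit n, fun z x => fundSol V z x * (mata n)ᴴ, hR,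
      fun z => ?_, fun z => ?_, (key (φ := fun z x => fundSol V z x * phiInit n)
        (ψ := fun z x => fundSol V z x * (mata n)ᴴ) hR (fun _ => rfl) fun _ => rfl).2 h⟩
    · exact isCauchySolution_iff.2 ⟨(isDiracSol_fundSol hV z).mul_const _, by
        beta_reduce
        rw [fundSol_zero hV, Matrix.one_mul, phiInit]⟩
    · exact isCauchySolution_iff.2 ⟨(isDiracSol_fundSol hV z).mul_const _, by
        beta_reduce
        rw [fundSol_zero hV, Matrix.one_mul]⟩

/-- `S_{V,U}` has exactly one sequence of spectral data. Its second components satisfy the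
equations that determine norming matrices. -/
theorem exists_unique_spectralDataS [Nonempty n] (hV : PotentialIntegrable V)
    (hU : U ∈ unitaryGroup n ℂ) : ∃ d : ℤ → ℝ × Matrix n n ℂ,
      (∀ d', IsSpectralDataS V U d' ↔ d' = d) ∧
      IsEigenvalueLabelling (opS V U) (fun j => (d j).1) ∧
      ∀ j, charMat V U (d j).1 * (d j).2 = 0 ∧
        ∀ v : Matrix n Unit ℂ, charMat V U (d j).1 * v = 0 →
          vᴴ * (phiGram V (d j).1 * (d j).2) = vᴴ := by
  obtain ⟨lam, hlam⟩ := exists_isEigenvalueLabelling_opS hV hU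
  choose R hR using exists_tendsto_sub_smul_weylM hV hU
  have hres : ∀ t : ℝ, HasResidueAt (weylM V U) t (R t) := fun t =>
    hasResidueAt_of_tendsto (meromorphicAt_weylM hV t) (hR t)
  refine ⟨fun j => (lam j, -R (lam j)), fun d' => ⟨?_, ?_⟩, hlam, fun j => ⟨?_, fun v hv => ?_⟩⟩
  · rintro ⟨hd, M, hM, hr⟩
    have h1 : (fun j => (d' j).1) = lam := hd.unique hlam
    rw [isWeylFunction_iff hV hU] at hM
    funext j
    have h2 : (d' j).1 = lam j := congrFun h1 j
    have h3 := (hr j).congr (M' := weylM V U)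
      ((eventually_isUnit_charMat hV hU _).mono fun z hz => hM z hz)
    rw [h2] at h3
    exact Prod.ext h2 (neg_eq_iff_eq_neg.1 (h3.unique (hres _)))
  · rintro rfl
    exact ⟨hlam, weylM V U, (isWeylFunction_iff hV hU).2 fun _ _ => rfl, fun j => by
      simpa using hres (lam j)⟩
  · simp [charMat_mul_residue hV hU (hR (lam j))]
  · simp [phiGram_mul_residue hV hU (hR (lam j)) hv]

end SpectralDataS

/-! ### Folding of absolutely continuous functions and of differential equations -/

section FoldPrim

/-- Lebesgue measure on `(-1,1)` is the sum of Lebesgue measure on `(0,1)` and its reflection. -/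
theorem volume_restrict_Ioo_neg_one_one : volume.restrict (Ioo (-1 : ℝ) 1) =
    (volume.restrict (Ioo (0 : ℝ) 1)).map (fun x => -x) + volume.restrict (Ioo (0 : ℝ) 1) := by
  have h1 : (volume.restrict (Ioo (0 : ℝ) 1)).map (fun x => -x) =
      volume.restrict (Ioo (-1 : ℝ) 0) := by
    have := ((Measure.measurePreserving_neg (volume : Measure ℝ)).restrict_preimage
      (measurableSet_Ioo (a := (-1 : ℝ)) (b := 0))).map_eq
    rwa [show (Neg.neg ⁻¹' Ioo (-1 : ℝ) 0) = Ioo 0 1 by ext x; simp] at this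
  rw [h1, Measure.restrict_congr_set (Ioo_ae_eq_Ico (a := (0 : ℝ)) (b := 1) (μ := volume)),
    ← Measure.restrict_union _ measurableSet_Ico, Ioo_union_Ico_eq_Ioo (by norm_num) (by norm_num)]
  exact Set.disjoint_left.2 fun x hx hx' => absurd hx.2 (not_lt.2 hx'.1)

theorem measurableEmbedding_neg_real : MeasurableEmbedding (fun x : ℝ => -x) :=
  (MeasurableEquiv.neg ℝ).measurableEmbedding

theorem ae_Ioo_neg_one_one_iff {P : ℝ → Prop} :
    (∀ᵐ x ∂volume.restrict (Ioo (-1 : ℝ) 1), P x) ↔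
      ∀ᵐ x ∂volume.restrict (Ioo (0 : ℝ) 1), P x ∧ P (-x) := by
  rw [volume_restrict_Ioo_neg_one_one, ae_add_measure_iff,
    measurableEmbedding_neg_real.ae_map_iff, and_comm, ← eventually_and]

variable {F : Type*} [NormedAddCommGroup F] [NormedSpace ℝ F]

/-- Moving the base point from -1 to 0 lets the condition split into independent halves. -/
theorem isPrimOn_neg_one_one_iff_integral_zero {g h : ℝ → F} : IsPrimOn (-1) 1 g h ↔
    IntervalIntegrable h volume (-1) 1 ∧ ∀ x ∈ Icc (-1 : ℝ) 1, g x = g 0 + ∫ t in (0 : ℝ)..x, h t := by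
  refine and_congr_right fun hi => ?_
  have hsub : ∀ {a b : ℝ}, a ∈ Icc (-1 : ℝ) 1 → b ∈ Icc (-1 : ℝ) 1 →
      IntervalIntegrable h volume a b := fun ha hb => hi.mono_set (uIcc_subset_uIcc
        (by rwa [uIcc_of_le (by norm_num)]) (by rwa [uIcc_of_le (by norm_num)]))
  have h0 : (0 : ℝ) ∈ Icc (-1 : ℝ) 1 := by simp
  have h1 : (-1 : ℝ) ∈ Icc (-1 : ℝ) 1 := by simp
  constructor
  · intro H x hx
    rw [H x hx, H 0 h0, add_assoc, intervalIntegral.integral_add_adjacent_intervals (hsub h1 h0)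
      (hsub h0 hx)]
  · intro H x hx
    rw [H x hx, H (-1) h1, add_assoc, intervalIntegral.integral_add_adjacent_intervals (hsub h0 h1)
      (hsub h1 hx)]

/-- Both halves start from the same value g(0), so no matching condition remains; the sign comes
from the chain rule. -/
theorem isPrimOn_neg_one_one_iff {g h : ℝ → F} : IsPrimOn (-1) 1 g h ↔
    IsPrimOn 0 1 g h ∧ IsPrimOn 0 1 (fun x => g (-x)) (fun x => -h (-x)) := by
  have hneg : ∀ x, ∫ t in (0 : ℝ)..x, -h (-t) = ∫ t in (0 : ℝ)..(-x), h t := fun x => by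
    rw [intervalIntegral.integral_neg, intervalIntegral.integral_comp_neg, neg_zero,
      ← intervalIntegral.integral_symm]
  have hii : IntervalIntegrable (fun x => -h (-x)) volume 0 1 ↔
      IntervalIntegrable h volume (-1) 0 := by
    rw [IntervalIntegrable.iff_comp_neg (f := h)]
    simp only [neg_neg, neg_zero]
    exact ⟨fun H => by simpa [Pi.neg_def] using H.neg.symm, fun H => by
      simpa [Pi.neg_def] using H.neg.symm⟩
  rw [isPrimOn_neg_one_one_iff_integral_zero, IsPrimOn, IsPrimOn, hii]
  simp only [hneg, neg_zero]
  constructor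
  · rintro ⟨hi, H⟩
    refine ⟨⟨hi.mono_set (uIcc_subset_uIcc_right ?_), fun x hx => H x ⟨by linarith [hx.1], hx.2⟩⟩,
      hi.mono_set (uIcc_subset_uIcc_left ?_), fun x hx => H (-x) ⟨by linarith [hx.2],
        by linarith [hx.1]⟩⟩ <;> rw [uIcc_of_le (by norm_num)] <;> simp
  · rintro ⟨⟨hi, H⟩, hi', H'⟩
    refine ⟨hi'.trans hi, fun x hx => ?_⟩
    rcases le_total 0 x with h | h
    · exact H x ⟨h, hx.2⟩
    · simpa using H' (-x) ⟨by linarith, by linarith [hx.1]⟩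

end FoldPrim

/-! ### Folding the Dirac expression and the boundary conditions -/

section FoldVec

variable {r : ℕ}

/-- The folding of a vector function on `(-1,1)`. -/
def foldV (g : ℝ → Fin r ⊕ Fin r → ℂ) (x : ℝ) : (Fin r ⊕ Fin r) ⊕ (Fin r ⊕ Fin r) → ℂ :=
  Sum.elim (Sum.elim (fun i => g x (Sum.inl i)) (fun i => g (-x) (Sum.inr i)))
    (Sum.elim (fun i => g (-x) (Sum.inl i)) (fun i => g x (Sum.inr i)))

/-- The folding of the derivative of a vector function on `(-1,1)`. -/
def foldD (g : ℝ → Fin r ⊕ Fin r → ℂ) (x : ℝ) : (Fin r ⊕ Fin r) ⊕ (Fin r ⊕ Fin r) → ℂ :=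
  Sum.elim (Sum.elim (fun i => g x (Sum.inl i)) (fun i => -g (-x) (Sum.inr i)))
    (Sum.elim (fun i => -g (-x) (Sum.inl i)) (fun i => g x (Sum.inr i)))

/-- The inverse of `foldV`. -/
def unfoldV (f : ℝ → (Fin r ⊕ Fin r) ⊕ (Fin r ⊕ Fin r) → ℂ) (x : ℝ) : Fin r ⊕ Fin r → ℂ :=
  if 0 ≤ x then Sum.elim (fun i => f x (Sum.inl (Sum.inl i))) (fun i => f x (Sum.inr (Sum.inr i)))
  else Sum.elim (fun i => f (-x) (Sum.inr (Sum.inl i))) (fun i => f (-x) (Sum.inl (Sum.inr i)))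

/-- The inverse of `foldD`. -/
def unfoldD (f : ℝ → (Fin r ⊕ Fin r) ⊕ (Fin r ⊕ Fin r) → ℂ) (x : ℝ) : Fin r ⊕ Fin r → ℂ :=
  if 0 ≤ x then Sum.elim (fun i => f x (Sum.inl (Sum.inl i))) (fun i => f x (Sum.inr (Sum.inr i)))
  else Sum.elim (fun i => -f (-x) (Sum.inr (Sum.inl i))) (fun i => -f (-x) (Sum.inl (Sum.inr i)))

theorem foldV_unfoldV_of_pos (f : ℝ → (Fin r ⊕ Fin r) ⊕ (Fin r ⊕ Fin r) → ℂ) {x : ℝ} (hx : 0 < x) :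
    foldV (unfoldV f) x = f x := by
  have h : ¬ 0 ≤ -x := by linarith
  ext i
  rcases i with (i | i) | (i | i) <;> simp [foldV, unfoldV, hx.le, h]

theorem foldD_unfoldD_of_pos (f : ℝ → (Fin r ⊕ Fin r) ⊕ (Fin r ⊕ Fin r) → ℂ) {x : ℝ} (hx : 0 < x) :
    foldD (unfoldD f) x = f x := by
  have h : ¬ 0 ≤ -x := by linarith
  ext i
  rcases i with (i | i) | (i | i) <;> simp [foldD, unfoldD, hx.le, h]

/-- At 0 `unfoldV` reads only half of the components; the others are recovered from f₁(0) = f₂(0).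
-/
theorem foldV_unfoldV {f : ℝ → (Fin r ⊕ Fin r) ⊕ (Fin r ⊕ Fin r) → ℂ}
    (h0 : ∀ i, f 0 (Sum.inl i) = f 0 (Sum.inr i)) {x : ℝ} (hx : 0 ≤ x) :
    foldV (unfoldV f) x = f x := by
  rcases hx.eq_or_lt with rfl | hx
  · ext i
    rcases i with (i | i) | (i | i) <;> simp [foldV, unfoldV, h0]
  · exact foldV_unfoldV_of_pos f hx

theorem foldV_eq_iff {g h : ℝ → Fin r ⊕ Fin r → ℂ} {x : ℝ} :
    foldV g x = foldV h x ↔ g x = h x ∧ g (-x) = h (-x) := by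
  constructor
  · intro H
    constructor <;> ext i <;> rcases i with i | i
    · exact congrFun H (Sum.inl (Sum.inl i))
    · exact congrFun H (Sum.inr (Sum.inr i))
    · exact congrFun H (Sum.inr (Sum.inl i))
    · exact congrFun H (Sum.inl (Sum.inr i))
  · rintro ⟨h1, h2⟩
    simp only [foldV, h1, h2]

theorem isPrimOn_foldV_iff {g g' : ℝ → Fin r ⊕ Fin r → ℂ} :
    (∀ i, IsPrimOn 0 1 (fun x => foldV g x i) (fun x => foldD g' x i)) ↔
      ∀ i, IsPrimOn (-1) 1 (fun x => g x i) (fun x => g' x i) := by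
  simp only [isPrimOn_neg_one_one_iff]
  constructor
  · rintro H (i | i)
    · exact ⟨H (Sum.inl (Sum.inl i)), H (Sum.inr (Sum.inl i))⟩
    · exact ⟨H (Sum.inr (Sum.inr i)), H (Sum.inl (Sum.inr i))⟩
  · rintro H ((i | i) | (i | i))
    · exact (H (Sum.inl i)).1
    · exact (H (Sum.inr i)).2
    · exact (H (Sum.inl i)).2
    · exact (H (Sum.inr i)).1

theorem isPrimOn_unfoldV {f f' : ℝ → (Fin r ⊕ Fin r) ⊕ (Fin r ⊕ Fin r) → ℂ}
    (H : ∀ i, IsPrimOn 0 1 (fun x => f x i) (fun x => f' x i))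
    (h0 : ∀ i, f 0 (Sum.inl i) = f 0 (Sum.inr i)) (i : Fin r ⊕ Fin r) :
    IsPrimOn (-1) 1 (fun x => unfoldV f x i) (fun x => unfoldD f' x i) := by
  refine isPrimOn_foldV_iff.1 (fun i => ?_) i
  refine ((H i).congr zero_le_one fun x hx => by rw [foldV_unfoldV h0 hx.1]).congr_deriv
    zero_le_one ?_
  rw [ae_restrict_iff' measurableSet_Ioo]
  exact ae_of_all _ fun x hx => by rw [foldD_unfoldD_of_pos _ hx.1]

/-- A reflected component changes sign twice: in its derivative, and in J, since y₂(-x) sits in f₁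
and y₁(-x) in f₂. -/
theorem dirac_foldV (q : ℝ → Matrix (Fin r) (Fin r) ℂ) (g g' : ℝ → Fin r ⊕ Fin r → ℂ) (x : ℝ) :
    diracJ (Fin r ⊕ Fin r) *ᵥ foldD g' x + diracPotential (foldPotential q) x *ᵥ foldV g x =
      foldV (fun x => diracJ (Fin r) *ᵥ g' x + diracPotential q x *ᵥ g x) x := by
  ext i
  rcases i with (i | i) | (i | i) <;>
    simp [diracJ_eq, diracPotential, foldPotential, foldV, foldD, fromBlocks_mulVec, mulVec,
      dotProduct, fromBlocks_conjTranspose, Matrix.one_apply]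

/-- Here f₁(1) = P₂y(-1) + P₁y(1) and f₂(1) = P₁y(-1) + P₂y(1); collecting terms produces A_U and
B_U. -/
theorem bcT_iff_bcS (U : Matrix (Fin r ⊕ Fin r) (Fin r ⊕ Fin r) ℂ) (g : ℝ → Fin r ⊕ Fin r → ℂ) :
    matA U *ᵥ g (-1) + matB U *ᵥ g 1 =
      foldV g 1 ∘ Sum.inl - U *ᵥ (foldV g 1 ∘ Sum.inr) := by
  have h1 : foldV g 1 ∘ Sum.inl = (fromBlocks 0 0 0 1 : Matrix (Fin r ⊕ Fin r) (Fin r ⊕ Fin r) ℂ) *ᵥ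
      g (-1) + (fromBlocks 1 0 0 0 : Matrix (Fin r ⊕ Fin r) (Fin r ⊕ Fin r) ℂ) *ᵥ g 1 := by
    ext i; rcases i with i | i <;> simp [foldV, fromBlocks_mulVec]
  have h2 : foldV g 1 ∘ Sum.inr = (fromBlocks 1 0 0 0 : Matrix (Fin r ⊕ Fin r) (Fin r ⊕ Fin r) ℂ) *ᵥ
      g (-1) + (fromBlocks 0 0 0 1 : Matrix (Fin r ⊕ Fin r) (Fin r ⊕ Fin r) ℂ) *ᵥ g 1 := by
    ext i; rcases i with i | i <;> simp [foldV, fromBlocks_mulVec]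
  rw [h1, h2, matA, matB, sub_mulVec, sub_mulVec, mulVec_add, mulVec_mulVec, mulVec_mulVec]
  abel

theorem mem_bcT_iff (U : Matrix (Fin r ⊕ Fin r) (Fin r ⊕ Fin r) ℂ) (g : ℝ → Fin r ⊕ Fin r → ℂ) :
    (g (-1), g 1) ∈ bcT U ↔ (foldV g 0, foldV g 1) ∈ bcS U := by
  have h0 : foldV g 0 ∘ Sum.inl = foldV g 0 ∘ Sum.inr := by
    ext i; rcases i with i | i <;> simp [foldV]
  change matA U *ᵥ g (-1) + matB U *ᵥ g 1 = 0 ↔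
    foldV g 0 ∘ Sum.inl = foldV g 0 ∘ Sum.inr ∧ foldV g 1 ∘ Sum.inl = U *ᵥ (foldV g 1 ∘ Sum.inr)
  rw [bcT_iff_bcS, sub_eq_zero]
  exact ⟨fun h => ⟨h0, h⟩, fun h => h.2⟩

end FoldVec

/-! ### The folding map between the `L₂` spaces -/

section FoldL2

variable {r : ℕ}

theorem fold_eq_toLp_foldV (y : ℝ → EuclideanSpace ℂ (Fin r ⊕ Fin r)) (x : ℝ) :
    fold y x = WithLp.toLp 2 (foldV (fun t => WithLp.ofLp (y t)) x) := rfl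

theorem fold_congr_ae {y z : ℝ → EuclideanSpace ℂ (Fin r ⊕ Fin r)}
    (h : ∀ᵐ x ∂volume.restrict (Ioo (-1 : ℝ) 1), y x = z x) :
    ∀ᵐ x ∂volume.restrict (Ioo (0 : ℝ) 1), fold y x = fold z x := by
  filter_upwards [ae_Ioo_neg_one_one_iff.1 h] with x hx
  simp only [fold, hx.1, hx.2]

theorem fold_eq_iff {y z : ℝ → EuclideanSpace ℂ (Fin r ⊕ Fin r)} {x : ℝ} :
    fold y x = fold z x ↔ y x = z x ∧ y (-x) = z (-x) := by
  rw [fold_eq_toLp_foldV, fold_eq_toLp_foldV, (WithLp.toLp_injective 2).eq_iff, foldV_eq_iff]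
  exact and_congr ⟨fun h => WithLp.ofLp_injective 2 h, fun h => congrArg _ h⟩
    ⟨fun h => WithLp.ofLp_injective 2 h, fun h => congrArg _ h⟩

theorem enorm_sq_fold (y : ℝ → EuclideanSpace ℂ (Fin r ⊕ Fin r)) (x : ℝ) :
    ‖fold y x‖ₑ ^ (2 : ℝ) = ‖y (-x)‖ₑ ^ (2 : ℝ) + ‖y x‖ₑ ^ (2 : ℝ) := by
  have h : ‖fold y x‖₊ ^ 2 = ‖y (-x)‖₊ ^ 2 + ‖y x‖₊ ^ 2 := by
    rw [← NNReal.coe_inj]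
    push_cast
    simp only [EuclideanSpace.norm_sq_eq, Fintype.sum_sum_type, fold, Sum.elim_inl, Sum.elim_inr]
    ring
  simp only [enorm_eq_nnnorm, ENNReal.rpow_ofNat]
  exact_mod_cast congrArg ((↑) : NNReal → ENNReal) h

theorem aestronglyMeasurable_Ioo_neg_one_one_iff {F : Type*} [TopologicalSpace F]
    [TopologicalSpace.PseudoMetrizableSpace F] {y : ℝ → F} :
    AEStronglyMeasurable y (volume.restrict (Ioo (-1 : ℝ) 1)) ↔
      AEStronglyMeasurable (fun x => y (-x)) (volume.restrict (Ioo (0 : ℝ) 1)) ∧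
        AEStronglyMeasurable y (volume.restrict (Ioo (0 : ℝ) 1)) := by
  rw [volume_restrict_Ioo_neg_one_one, aestronglyMeasurable_add_measure_iff,
    measurableEmbedding_neg_real.aestronglyMeasurable_map_iff]
  rfl

theorem eLpNorm_fold {y : ℝ → EuclideanSpace ℂ (Fin r ⊕ Fin r)}
    (hy : AEStronglyMeasurable y (volume.restrict (Ioo (-1 : ℝ) 1))) :
    eLpNorm (fold y) 2 (volume.restrict (Ioo (0 : ℝ) 1)) =
      eLpNorm y 2 (volume.restrict (Ioo (-1 : ℝ) 1)) := by
  rw [eLpNorm_eq_lintegral_rpow_enorm_toReal two_ne_zero ENNReal.ofNat_ne_top,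
    eLpNorm_eq_lintegral_rpow_enorm_toReal two_ne_zero ENNReal.ofNat_ne_top]
  congr 1
  simp only [ENNReal.toReal_ofNat, enorm_sq_fold]
  rw [volume_restrict_Ioo_neg_one_one, lintegral_add_measure,
    measurableEmbedding_neg_real.lintegral_map, lintegral_add_right']
  exact ((aestronglyMeasurable_Ioo_neg_one_one_iff.1 hy).2.enorm.pow_const _)

theorem aestronglyMeasurable_euclidean_iff {m : Type} [Fintype m] {μ : Measure ℝ}
    {y : ℝ → EuclideanSpace ℂ m} :
    AEStronglyMeasurable y μ ↔ ∀ i, AEStronglyMeasurable (fun x => y x i) μ := by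
  constructor
  · exact fun h i => (EuclideanSpace.proj (𝕜 := ℂ) i).continuous.comp_aestronglyMeasurable h
  · intro h
    have h1 : AEStronglyMeasurable (fun x i => y x i) μ :=
      (aemeasurable_pi_iff.2 fun i => (h i).aemeasurable).aestronglyMeasurable
    exact (PiLp.continuous_toLp 2 (fun _ : m => ℂ)).comp_aestronglyMeasurable h1

theorem aestronglyMeasurable_fold {y : ℝ → EuclideanSpace ℂ (Fin r ⊕ Fin r)}
    (hy : AEStronglyMeasurable y (volume.restrict (Ioo (-1 : ℝ) 1))) :
    AEStronglyMeasurable (fold y) (volume.restrict (Ioo (0 : ℝ) 1)) := by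
  obtain ⟨h1, h2⟩ := aestronglyMeasurable_Ioo_neg_one_one_iff.1 hy
  rw [aestronglyMeasurable_euclidean_iff] at *
  rintro ((i | i) | (i | i))
  · exact h2 (Sum.inl i)
  · exact h1 (Sum.inr i)
  · exact h1 (Sum.inl i)
  · exact h2 (Sum.inr i)

theorem memLp_fold {y : ℝ → EuclideanSpace ℂ (Fin r ⊕ Fin r)}
    (hy : MemLp y 2 (volume.restrict (Ioo (-1 : ℝ) 1))) :
    MemLp (fold y) 2 (volume.restrict (Ioo (0 : ℝ) 1)) :=
  ⟨aestronglyMeasurable_fold hy.1, (eLpNorm_fold hy.1).trans_lt hy.2⟩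

/-- The folding map, as a linear isometry. -/
def foldIsometry (r : ℕ) :
    L2 (-1) 1 (Fin r ⊕ Fin r) →ₗᵢ[ℂ] L2 0 1 ((Fin r ⊕ Fin r) ⊕ (Fin r ⊕ Fin r)) where
  toFun y := (memLp_fold (Lp.memLp y)).toLp (fold y)
  map_add' y z := by
    refine Lp.ext ?_
    filter_upwards [(memLp_fold (Lp.memLp (y + z))).coeFn_toLp,
      (memLp_fold (Lp.memLp y)).coeFn_toLp, (memLp_fold (Lp.memLp z)).coeFn_toLp,
      Lp.coeFn_add ((memLp_fold (Lp.memLp y)).toLp (fold y))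
        ((memLp_fold (Lp.memLp z)).toLp (fold z)), fold_congr_ae (Lp.coeFn_add y z)]
      with x h1 h2 h3 h4 h5
    rw [h1, h4, Pi.add_apply, h2, h3, h5]
    ext i
    rcases i with (i | i) | (i | i) <;> rfl
  map_smul' c y := by
    refine Lp.ext ?_
    filter_upwards [(memLp_fold (Lp.memLp (c • y))).coeFn_toLp,
      (memLp_fold (Lp.memLp y)).coeFn_toLp,
      Lp.coeFn_smul c ((memLp_fold (Lp.memLp y)).toLp (fold y)),
      fold_congr_ae (Lp.coeFn_smul c y)] with x h1 h2 h3 h4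
    rw [h1, RingHom.id_apply, h3, Pi.smul_apply, h2, h4]
    ext i
    rcases i with (i | i) | (i | i) <;> rfl
  norm_map' y := by
    change ‖(memLp_fold (Lp.memLp y)).toLp (fold y)‖ = ‖y‖
    rw [Lp.norm_toLp, eLpNorm_fold (Lp.memLp y).1, Lp.norm_def]

theorem foldIsometry_ae (y : L2 (-1) 1 (Fin r ⊕ Fin r)) :
    ∀ᵐ x ∂volume.restrict (Ioo (0 : ℝ) 1), foldIsometry r y x = fold y x :=
  (memLp_fold (Lp.memLp y)).coeFn_toLp

theorem foldIsometry_surjective : Function.Surjective (foldIsometry r) := by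
  intro f
  set y : ℝ → EuclideanSpace ℂ (Fin r ⊕ Fin r) := fun x =>
    WithLp.toLp 2 (unfoldV (fun t => WithLp.ofLp (f t)) x) with hy
  have hfold : ∀ᵐ x ∂volume.restrict (Ioo (0 : ℝ) 1), fold y x = f x := by
    rw [ae_restrict_iff' measurableSet_Ioo]
    refine ae_of_all _ fun x hx => ?_
    rw [fold_eq_toLp_foldV]
    exact congrArg (WithLp.toLp 2) (foldV_unfoldV_of_pos (fun t => WithLp.ofLp (f t)) hx.1)
  have hf := Lp.memLp f
  have hmf : AEStronglyMeasurable (fold y) (volume.restrict (Ioo (0 : ℝ) 1)) :=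
    hf.1.congr (hfold.mono fun x hx => hx.symm)
  have hmeas : AEStronglyMeasurable y (volume.restrict (Ioo (-1 : ℝ) 1)) := by
    rw [aestronglyMeasurable_Ioo_neg_one_one_iff]
    rw [aestronglyMeasurable_euclidean_iff] at hmf
    constructor <;> rw [aestronglyMeasurable_euclidean_iff] <;> rintro (i | i)
    · exact hmf (Sum.inr (Sum.inl i))
    · exact hmf (Sum.inl (Sum.inr i))
    · exact hmf (Sum.inl (Sum.inl i))
    · exact hmf (Sum.inr (Sum.inr i))
  have hmem : MemLp y 2 (volume.restrict (Ioo (-1 : ℝ) 1)) :=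
    ⟨hmeas, by rw [← eLpNorm_fold hmeas, eLpNorm_congr_ae hfold]; exact hf.2⟩
  refine ⟨hmem.toLp y, Lp.ext ?_⟩
  filter_upwards [foldIsometry_ae (hmem.toLp y), fold_congr_ae hmem.coeFn_toLp, hfold]
    with x h1 h2 h3
  rw [h1, h2, h3]

/-- The unitary folding map. -/
def foldEquiv (r : ℕ) :
    L2 (-1) 1 (Fin r ⊕ Fin r) ≃ₗᵢ[ℂ] L2 0 1 ((Fin r ⊕ Fin r) ⊕ (Fin r ⊕ Fin r)) :=
  LinearIsometryEquiv.ofSurjective (foldIsometry r) foldIsometry_surjective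

theorem foldEquiv_ae (y : L2 (-1) 1 (Fin r ⊕ Fin r)) :
    ∀ᵐ x ∂volume.restrict (Ioo (0 : ℝ) 1), foldEquiv r y x = fold y x :=
  foldIsometry_ae y

theorem ae_eq_toLp_iff (y : L2 (-1) 1 (Fin r ⊕ Fin r)) (g : ℝ → Fin r ⊕ Fin r → ℂ) :
    (∀ᵐ x ∂volume.restrict (Ioo (-1 : ℝ) 1), y x = WithLp.toLp 2 (g x)) ↔
      ∀ᵐ x ∂volume.restrict (Ioo (0 : ℝ) 1), foldEquiv r y x = WithLp.toLp 2 (foldV g x) := by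
  rw [ae_Ioo_neg_one_one_iff]
  refine eventually_congr ?_
  filter_upwards [foldEquiv_ae y] with x hx
  rw [hx, ← fold_eq_iff (z := fun x => WithLp.toLp 2 (g x))]
  rfl

/-- In the converse direction f₁(0) = f₂(0) is what makes the unfolded function absolutely
continuous across 0. -/
theorem mem_diracGraph_fold_iff (q : ℝ → Matrix (Fin r) (Fin r) ℂ)
    (U : Matrix (Fin r ⊕ Fin r) (Fin r ⊕ Fin r) ℂ) (y z : L2 (-1) 1 (Fin r ⊕ Fin r)) :
    (y, z) ∈ diracGraph (-1) 1 (diracJ (Fin r)) (diracPotential q) (bcT U) ↔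
      (foldEquiv r y, foldEquiv r z) ∈ diracGraph 0 1 (diracJ (Fin r ⊕ Fin r))
        (diracPotential (foldPotential q)) (bcS U) := by
  constructor
  · rintro ⟨g, g', hp, hy, hz, hb⟩
    refine ⟨foldV g, foldD g', isPrimOn_foldV_iff.2 hp, (ae_eq_toLp_iff y g).1 hy, ?_,
      (mem_bcT_iff U g).1 hb⟩
    simp only [dirac_foldV]
    exact (ae_eq_toLp_iff z _).1 hz
  · rintro ⟨f, f', hp, hy, hz, hb⟩
    have h0 : ∀ i, f 0 (Sum.inl i) = f 0 (Sum.inr i) := fun i => congrFun hb.1 i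
    refine ⟨unfoldV f, unfoldD f', isPrimOn_unfoldV hp h0, (ae_eq_toLp_iff y _).2 ?_,
      (ae_eq_toLp_iff z _).2 ?_, (mem_bcT_iff U _).2 ?_⟩
    · filter_upwards [hy, ae_restrict_mem measurableSet_Ioo] with x h1 hx
      rw [foldV_unfoldV_of_pos f hx.1]
      exact h1
    · filter_upwards [hz, ae_restrict_mem measurableSet_Ioo] with x h1 hx
      rw [← dirac_foldV, foldV_unfoldV_of_pos f hx.1, foldD_unfoldD_of_pos f' hx.1]
      exact h1
    · rwa [foldV_unfoldV h0 le_rfl, foldV_unfoldV h0 zero_le_one]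

theorem mem_graph_opT_iff (q : ℝ → Matrix (Fin r) (Fin r) ℂ)
    (U : Matrix (Fin r ⊕ Fin r) (Fin r ⊕ Fin r) ℂ) (y z : L2 (-1) 1 (Fin r ⊕ Fin r)) :
    (y, z) ∈ (opT q U).graph ↔
      (foldEquiv r y, foldEquiv r z) ∈ (opS (foldPotential q) U).graph := by
  rw [opT, opS, graph_diracOperator (by norm_num), graph_diracOperator zero_lt_one,
    mem_diracGraph_fold_iff]

theorem isEigenvalue_opT_iff (q : ℝ → Matrix (Fin r) (Fin r) ℂ)
    (U : Matrix (Fin r ⊕ Fin r) (Fin r ⊕ Fin r) ℂ) (z : ℂ) :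
    IsEigenvalue (opT q U) z ↔ IsEigenvalue (opS (foldPotential q) U) z := by
  rw [isEigenvalue_iff_graph, isEigenvalue_iff_graph, (foldEquiv r).surjective.exists]
  refine exists_congr fun y => ?_
  rw [mem_graph_opT_iff, map_smul, Ne, Ne, LinearIsometryEquiv.map_eq_zero_iff]

theorem isEigenvalueLabelling_opT_iff (q : ℝ → Matrix (Fin r) (Fin r) ℂ)
    (U : Matrix (Fin r ⊕ Fin r) (Fin r ⊕ Fin r) ℂ) (lam : ℤ → ℝ) :
    IsEigenvalueLabelling (opT q U) lam ↔ IsEigenvalueLabelling (opS (foldPotential q) U) lam := by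
  constructor <;> rintro ⟨h1, h2, h3, h4⟩
  · exact ⟨h1, fun z => (isEigenvalue_opT_iff q U z).symm.trans (h2 z), h3, h4⟩
  · exact ⟨h1, fun z => (isEigenvalue_opT_iff q U z).trans (h2 z), h3, h4⟩

end FoldL2

/-! ### Norming matrices -/

section Norming

variable {n : Type} [Fintype n] [DecidableEq n]

/-- The defining property of a norming matrix amounts to two matrix equations. -/
theorem isNormingMatrix_iff {K G C : Matrix n n ℂ} (hKC : K * C = 0)
    (hG : ∀ v : Matrix n Unit ℂ, K * v = 0 → vᴴ * (G * C) = vᴴ) (A : Matrix n n ℂ) :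
    IsNormingMatrix K G A ↔ A = C := by
  set E := LinearMap.ker (toEuclideanLin K) with hE
  -- The map c is C with values in E, and b is the compression of G to E. The second hypothesis says
  -- that GCv - v is orthogonal to E for every v, that is, b ∘ c = P.
  let c : EuclideanSpace ℂ n →ₗ[ℂ] E := (toEuclideanLin C).codRestrict E fun v => by
    rw [hE, LinearMap.mem_ker]
    apply (WithLp.ofLp_injective 2)
    simp [hKC]
  let b : E →ₗ[ℂ] E := E.orthogonalProjectionOnto.toLinearMap ∘ₗ toEuclideanLin G ∘ₗ E.subtype
  have hbc : ∀ v, b (c v) = E.orthogonalProjectionOnto v := by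
    intro v
    rw [← sub_eq_zero]
    have h1 : b (c v) - E.orthogonalProjectionOnto v =
        E.orthogonalProjectionOnto (toEuclideanLin G (toEuclideanLin C v) - v) := by
      rw [map_sub]; rfl
    rw [h1, Submodule.orthogonalProjectionOnto_eq_zero_iff, Submodule.mem_orthogonal]
    intro k hk
    have hk' : K * (Matrix.of fun i (_ : Unit) => k i) = 0 := by
      have := congrArg WithLp.ofLp (LinearMap.mem_ker.1 hk)
      ext i j
      exact congrFun this i
    have h2 := hG _ hk'
    have h3 : star (WithLp.ofLp k) ᵥ* (G * C) = star (WithLp.ofLp k) := by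
      ext i
      exact congrFun (congrFun h2 ()) i
    rw [EuclideanSpace.inner_eq_star_dotProduct, dotProduct_comm]
    simp only [WithLp.ofLp_sub, dotProduct_sub, toEuclideanLin, ofLp_toLpLin, toLin'_apply,
      mulVec_mulVec]
    rw [dotProduct_mulVec, h3, sub_self]
  -- P fixes E, so c restricted to E is a right inverse of b; in finite dimension b is then
  -- bijective.
  have hsurj : Function.Surjective b := fun e => ⟨c e, by
    rw [hbc, Submodule.orthogonalProjectionOnto_mem_subspace_eq_self]⟩
  have hinj : Function.Injective b := LinearMap.injective_iff_surjective.2 hsurj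
  have hbij : Function.Bijective b := ⟨hinj, hsurj⟩
  constructor
  · rintro ⟨B, hB, hA⟩
    have hBb : ∀ v, B v = b v := hB
    apply toEuclideanLin.injective
    ext1 v
    rw [hA v]
    have : B.symm (E.orthogonalProjectionOnto v) = c v := by
      rw [LinearEquiv.symm_apply_eq, hBb, hbc]
    rw [this]
    rfl
  · rintro rfl
    refine ⟨LinearEquiv.ofBijective b hbij, fun v => rfl, fun v => ?_⟩
    have : (LinearEquiv.ofBijective b hbij).symm (E.orthogonalProjectionOnto v) = c v :=
      (LinearEquiv.symm_apply_eq _).2 (hbc v).symm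
    rw [this]
    rfl

end Norming

/-! ### The spectral data of `T_{q,U}` -/

section SpectralDataT

variable {r : ℕ} {q : ℝ → Matrix (Fin r) (Fin r) ℂ} {k : Type}

theorem potentialIntegrable_foldPotential
    (hq : ∀ i k, IntervalIntegrable (fun x => q x i k) volume (-1) 1) :
    PotentialIntegrable (foldPotential q) := by
  have h : ∀ i k, IntervalIntegrable (fun x => q x i k) volume 0 1 ∧
      IntervalIntegrable (fun x => star (q (-x) i k)) volume 0 1 := by
    intro i k
    have hP : IsPrimOn (-1) 1 (fun x => ∫ t in (-1 : ℝ)..x, q t i k) (fun x => q x i k) :=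
      ⟨hq i k, fun x _ => by simp⟩
    obtain ⟨h1, h2⟩ := isPrimOn_neg_one_one_iff.1 hP
    refine ⟨h1.1, ?_⟩
    have h3 := (h2.clm_comp zero_le_one (-(Complex.conjCLE : ℂ →L[ℝ] ℂ))).1
    simpa using h3
  rintro (i | i) (j | j) <;>
    simp only [foldPotential, fromBlocks_apply₁₁, fromBlocks_apply₁₂,
      fromBlocks_apply₂₁, fromBlocks_apply₂₂, Matrix.zero_apply, conjTranspose_apply]
  · exact intervalIntegrable_const
  · exact (h i j).1
  · exact (h j i).2
  · exact intervalIntegrable_const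

/-- The columnwise folding of a matrix function on `(-1,1)`. -/
def foldM (Y : ℝ → Matrix (Fin r ⊕ Fin r) k ℂ) (x : ℝ) :
    Matrix ((Fin r ⊕ Fin r) ⊕ (Fin r ⊕ Fin r)) k ℂ :=
  Matrix.of fun i j => foldV (fun t p => Y t p j) x i

theorem isCauchySolution_foldM {z : ℂ} {Y : ℝ → Matrix (Fin r ⊕ Fin r) (Fin r ⊕ Fin r) ℂ}
    (H : IsCauchySolution (-1) 1 0 (diracJ (Fin r)) (diracPotential q) z 1 Y) :
    IsCauchySolution 0 1 0 (diracJ (Fin r ⊕ Fin r)) (diracPotential (foldPotential q)) z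
      (fromRows (1 : Matrix (Fin r ⊕ Fin r) (Fin r ⊕ Fin r) ℂ) 1) (foldM Y) := by
  obtain ⟨⟨Y', hp, he⟩, h0⟩ := H
  refine ⟨⟨fun x => Matrix.of fun i j => foldD (fun t p => Y' t p j) x i, fun i j =>
    (isPrimOn_foldV_iff (g := fun t p => Y t p j) (g' := fun t p => Y' t p j)).2
      (fun i => isPrimitiveOn_iff.1 (hp i j)) i, ?_⟩, ?_⟩
  · filter_upwards [ae_Ioo_neg_one_one_iff.1 he] with x hx
    ext i j
    have h1 := congrFun (dirac_foldV q (fun t p => Y t p j) (fun t p => Y' t p j) x) i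
    have h2 : foldV (fun x => diracJ (Fin r) *ᵥ (fun p => Y' x p j) +
        diracPotential q x *ᵥ fun p => Y x p j) x = foldV (fun x p => (z • Y x) p j) x := by
      rw [foldV_eq_iff]
      constructor <;> ext i
      · exact congrFun (congrFun hx.1 i) j
      · exact congrFun (congrFun hx.2 i) j
    refine h1.trans ((congrFun h2 i).trans ?_)
    rcases i with (i | i) | (i | i) <;> rfl
  · ext i j
    rcases i with (i | i) | (i | i) <;> simp [foldM, foldV, h0]

/-- Unfolds the solution on [0,1] that starts at (I, I)ᵀ, whose equal blocks supply the matching at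
0. -/
theorem exists_isCauchySolution (hV : PotentialIntegrable (foldPotential q)) (z : ℂ) :
    ∃ Y : ℝ → Matrix (Fin r ⊕ Fin r) (Fin r ⊕ Fin r) ℂ,
      IsCauchySolution (-1) 1 0 (diracJ (Fin r)) (diracPotential q) z 1 Y := by
  obtain ⟨F, hF, hF0⟩ := exists_isDiracSol hV z
    (fromRows 1 1 : Matrix ((Fin r ⊕ Fin r) ⊕ (Fin r ⊕ Fin r)) (Fin r ⊕ Fin r) ℂ)
  obtain ⟨⟨F', hp, he⟩, -⟩ := isCauchySolution_iff.2 ⟨hF, hF0⟩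
  refine ⟨fun x => Matrix.of fun i j => unfoldV (fun t p => F t p j) x i,
    ⟨fun x => Matrix.of fun i j => unfoldD (fun t p => F' t p j) x i, fun i j =>
      isPrimOn_unfoldV (f := fun t p => F t p j) (f' := fun t p => F' t p j) (fun i => hp i j)
        (fun i => by simp [hF0]) i, ?_⟩, ?_⟩
  · rw [ae_Ioo_neg_one_one_iff]
    filter_upwards [he, ae_restrict_mem measurableSet_Ioo] with x hx hx01
    have key : ∀ j, foldV (fun x => diracJ (Fin r) *ᵥ unfoldD (fun t p => F' t p j) x +
        diracPotential q x *ᵥ unfoldV (fun t p => F t p j) x) x =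
        foldV (fun x p => z * unfoldV (fun t p => F t p j) x p) x := by
      intro j
      rw [← dirac_foldV, foldD_unfoldD_of_pos _ hx01.1, foldV_unfoldV_of_pos _ hx01.1]
      ext i
      refine (congrFun (congrFun hx i) j).trans ?_
      have h1 := congrFun (foldV_unfoldV_of_pos (fun t p => F t p j) hx01.1) i
      rw [Matrix.smul_apply, smul_eq_mul, ← h1]
      rcases i with (i | i) | (i | i) <;> rfl
    constructor <;> ext i j
    · exact congrFun (foldV_eq_iff.1 (key j)).1 i
    · exact congrFun (foldV_eq_iff.1 (key j)).2 i
  · ext i j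
    rcases i with i | i <;> simp [unfoldV, hF0]

/-- The folded initial value (I, I)ᵀ is κ⁻¹J a*, so uniqueness identifies the fold of Y with κ⁻¹φ.
-/
theorem foldM_eq (hV : PotentialIntegrable (foldPotential q)) {z : ℂ}
    {Y : ℝ → Matrix (Fin r ⊕ Fin r) (Fin r ⊕ Fin r) ℂ}
    (H : IsCauchySolution (-1) 1 0 (diracJ (Fin r)) (diracPotential q) z 1 Y) {x : ℝ}
    (hx : x ∈ Icc (0 : ℝ) 1) :
    foldM Y x = phiScalar⁻¹ • (fundSol (foldPotential q) z x * phiInit (Fin r ⊕ Fin r)) := by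
  obtain ⟨h1, h2⟩ := isCauchySolution_iff.1 (isCauchySolution_foldM H)
  rw [h1.eq_fundSol_mul hV hx, h2, ← Matrix.mul_smul, phiInit_eq]
  congr 1
  ext i j
  rcases i with i | i <;> simp [phiScalar_ne_zero]

theorem matA_mul_add_matB_mul (hV : PotentialIntegrable (foldPotential q)) {z : ℂ}
    {Y : ℝ → Matrix (Fin r ⊕ Fin r) (Fin r ⊕ Fin r) ℂ}
    (H : IsCauchySolution (-1) 1 0 (diracJ (Fin r)) (diracPotential q) z 1 Y)
    (U : Matrix (Fin r ⊕ Fin r) (Fin r ⊕ Fin r) ℂ) :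
    matA U * Y (-1) + matB U * Y 1 = phiScalar⁻¹ • charMat (foldPotential q) U z := by
  have h1 : matA U * Y (-1) + matB U * Y 1 = bcMat U * foldM Y 1 := by
    rw [← fromRows_toRows (foldM Y 1), bcMat, fromCols_mul_fromRows, Matrix.one_mul,
      Matrix.neg_mul, ← sub_eq_add_neg]
    ext i j
    exact congrFun (bcT_iff_bcS U (fun t p => Y t p j)) i
  rw [h1, foldM_eq hV H (right_mem_Icc.2 zero_le_one), Matrix.mul_smul, charMat]

theorem foldM_conjTranspose_mul (Y : ℝ → Matrix (Fin r ⊕ Fin r) k ℂ) (x : ℝ) :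
    (foldM Y x)ᴴ * foldM Y x = (Y x)ᴴ * Y x + (Y (-x))ᴴ * Y (-x) := by
  ext i j
  simp [Matrix.mul_apply, Fintype.sum_sum_type, foldM, foldV]
  ring

theorem integral_neg_one_one {u : ℝ → ℂ} (hu : IntervalIntegrable u volume (-1) 1) :
    ∫ x in (-1 : ℝ)..1, u x = ∫ x in (0 : ℝ)..1, (u x + u (-x)) := by
  have hP : IsPrimOn (-1) 1 (fun x => ∫ t in (-1 : ℝ)..x, u t) u := ⟨hu, fun x _ => by simp⟩
  obtain ⟨h1, h2⟩ := isPrimOn_neg_one_one_iff.1 hP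
  have e1 := h1.2 1 (by simp)
  have e2 := h2.2 1 (by simp)
  have h3 : IntervalIntegrable (fun x => u (-x)) volume 0 1 := by simpa [Pi.neg_def] using h2.1.neg
  simp only [intervalIntegral.integral_same, neg_zero, intervalIntegral.integral_neg] at e1 e2
  rw [intervalIntegral.integral_add h1.1 h3, e1]
  linear_combination -e2

/-- The factor |κ|⁻² = 2 cancels the ½ in the definition of the Gram matrix. -/
theorem gramMatrix_eq_phiGram (hV : PotentialIntegrable (foldPotential q)) {t : ℝ}
    {Y : ℝ → Matrix (Fin r ⊕ Fin r) (Fin r ⊕ Fin r) ℂ}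
    (H : IsCauchySolution (-1) 1 0 (diracJ (Fin r)) (diracPotential q) t 1 Y) :
    gramMatrix Y = phiGram (foldPotential q) t := by
  have hc : ∀ i j, ContinuousOn (fun x => Y x i j) (Icc (-1) 1) := fun i j => by
    obtain ⟨⟨Y', hp, -⟩, -⟩ := H
    exact IsPrimOn.continuousOn (by norm_num) (hp i j)
  ext i j
  have hst : star (t : ℂ) = t := Complex.conj_ofReal t
  have h1 := conjTranspose_mul_fundGram_mul hV t t (phiInit (Fin r ⊕ Fin r))
    (phiInit (Fin r ⊕ Fin r)) i j
  rw [hst] at h1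
  have hint : IntervalIntegrable (fun s => ((Y s)ᴴ * Y s) i j) volume (-1) 1 := by
    refine ContinuousOn.intervalIntegrable ?_
    rw [uIcc_of_le (by norm_num)]
    exact continuousOn_conjTranspose_mul hc hc i j
  have hs : star phiScalar⁻¹ * phiScalar⁻¹ = 2 := by
    have h : (Real.sqrt 2 : ℂ) * Real.sqrt 2 = 2 := by
      rw [← Complex.ofReal_mul, Real.mul_self_sqrt zero_le_two]; norm_num
    simp [phiScalar]
    linear_combination (-Complex.I * Complex.I) * h - 2 * Complex.I_mul_I
  rw [phiGram, h1, gramMatrix, Matrix.of_apply, integral_neg_one_one hint,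
    ← intervalIntegral.integral_const_mul]
  refine intervalIntegral.integral_congr fun x hx => ?_
  rw [uIcc_of_le zero_le_one] at hx
  have h2 := congrFun (congrFun (foldM_conjTranspose_mul Y x) i) j
  rw [foldM_eq hV H hx, conjTranspose_smul, Matrix.smul_mul, Matrix.mul_smul, smul_smul, hs] at h2
  rw [Matrix.add_apply, Matrix.smul_apply, smul_eq_mul] at h2
  rw [← h2]
  ring

/-- The nonzero factor κ⁻¹ leaves the kernel of the boundary matrix unchanged, so the two equations
for the residues of S are those that characterise the norming matrices of T. -/
theorem isSpectralDataT_iff (hV : PotentialIntegrable (foldPotential q))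
    {U : Matrix (Fin r ⊕ Fin r) (Fin r ⊕ Fin r) ℂ}
    {d : ℤ → ℝ × Matrix (Fin r ⊕ Fin r) (Fin r ⊕ Fin r) ℂ}
    (hd : IsEigenvalueLabelling (opS (foldPotential q) U) (fun j => (d j).1))
    (hC : ∀ j, charMat (foldPotential q) U (d j).1 * (d j).2 = 0 ∧
      ∀ v : Matrix (Fin r ⊕ Fin r) Unit ℂ, charMat (foldPotential q) U (d j).1 * v = 0 →
        vᴴ * (phiGram (foldPotential q) (d j).1 * (d j).2) = vᴴ)
    (d' : ℤ → ℝ × Matrix (Fin r ⊕ Fin r) (Fin r ⊕ Fin r) ℂ) :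
    IsSpectralDataT q U d' ↔ d' = d := by
  have key : ∀ j Y, IsCauchySolution (-1) 1 0 (diracJ (Fin r)) (diracPotential q)
      ((d j).1 : ℂ) 1 Y → ∀ A, IsNormingMatrix (matA U * Y (-1) + matB U * Y 1) (gramMatrix Y) A ↔
        A = (d j).2 := by
    intro j Y hY A
    rw [matA_mul_add_matB_mul hV hY, gramMatrix_eq_phiGram hV hY]
    refine isNormingMatrix_iff ?_ (fun v hv => (hC j).2 v ?_) A
    · rw [Matrix.smul_mul, (hC j).1, smul_zero]
    · rw [Matrix.smul_mul] at hv
      exact (smul_eq_zero.1 hv).resolve_left (inv_ne_zero phiScalar_ne_zero)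
  rw [IsSpectralDataT, isEigenvalueLabelling_opT_iff]
  constructor
  · rintro ⟨h1, h2⟩
    have h3 := h1.unique hd
    funext j
    have h4 : (d' j).1 = (d j).1 := congrFun h3 j
    obtain ⟨Y, hY, hA⟩ := h2 j
    rw [h4] at hY
    exact Prod.ext h4 ((key j Y hY _).1 hA)
  · rintro rfl
    refine ⟨hd, fun j => ?_⟩
    obtain ⟨Y, hY⟩ := exists_isCauchySolution hV ((d' j).1 : ℂ)
    exact ⟨Y, hY, (key j Y hY _).2 rfl⟩

end SpectralDataT

end DiracFolding

end

theorem lemma3p1 (r : ℕ) (hr : 0 < r) (p : ENNReal) (hp : 1 ≤ p) (hp' : p ≠ ⊤)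
    (q : ℝ → Matrix (Fin r) (Fin r) ℂ)
    (hq : ∀ i k, MeasureTheory.MemLp (fun x => q x i k) p
      (MeasureTheory.volume.restrict (Set.Ioo (-1 : ℝ) 1)))
    (U : Matrix (Fin r ⊕ Fin r) (Fin r ⊕ Fin r) ℂ)
    (hU : U ∈ Matrix.unitaryGroup (Fin r ⊕ Fin r) ℂ) :
    -- the folding map is unitary and carries `T_{q,U}` to `S_{V,U}`
    (∃ W : DiracFolding.L2 (-1) 1 (Fin r ⊕ Fin r) ≃ₗᵢ[ℂ]
          DiracFolding.L2 0 1 ((Fin r ⊕ Fin r) ⊕ (Fin r ⊕ Fin r)),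
      (∀ y, ∀ᵐ x ∂MeasureTheory.volume.restrict (Set.Ioo (0 : ℝ) 1),
        W y x = DiracFolding.fold y x) ∧
      (∀ y, y ∈ (DiracFolding.opT q U).domain ↔
        W y ∈ (DiracFolding.opS (DiracFolding.foldPotential q) U).domain) ∧
      ∀ (y : (DiracFolding.opT q U).domain)
        (f : (DiracFolding.opS (DiracFolding.foldPotential q) U).domain),
        (f : DiracFolding.L2 0 1 ((Fin r ⊕ Fin r) ⊕ (Fin r ⊕ Fin r))) = W y →
        DiracFolding.opS (DiracFolding.foldPotential q) U f = W (DiracFolding.opT q U y)) ∧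
    -- each operator has exactly one sequence of spectral data, and the two coincide
    ∃ d : ℤ → ℝ × Matrix (Fin r ⊕ Fin r) (Fin r ⊕ Fin r) ℂ,
      (∀ d', DiracFolding.IsSpectralDataT q U d' ↔ d' = d) ∧
      (∀ d', DiracFolding.IsSpectralDataS (DiracFolding.foldPotential q) U d' ↔ d' = d) := by
  have hV : DiracFolding.PotentialIntegrable (DiracFolding.foldPotential q) := by
    refine DiracFolding.potentialIntegrable_foldPotential fun i k => ?_
    rw [intervalIntegrable_iff_integrableOn_Ioo_of_le (by norm_num)]
    -- On a bounded interval L_p is contained in L₁, and integrability is all that the argument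
    -- needs from q.
    exact (hq i k).integrable hp
  -- The existence of eigenvalues uses a diagonal entry of M, hence r > 0.
  have : Nonempty (Fin r) := ⟨⟨0, hr⟩⟩
  refine ⟨⟨DiracFolding.foldEquiv r, DiracFolding.foldEquiv_ae, fun y => ?_, fun y f hyf => ?_⟩, ?_⟩
  · rw [LinearPMap.mem_domain_iff, LinearPMap.mem_domain_iff,
      (DiracFolding.foldEquiv r).surjective.exists]
    exact exists_congr fun z => DiracFolding.mem_graph_opT_iff q U y z
  · have h1 := (DiracFolding.mem_graph_opT_iff q U y _).1 (LinearPMap.mem_graph _ y)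
    rw [← hyf] at h1
    exact LinearPMap.mem_graph_snd_inj _ (LinearPMap.mem_graph _ f) h1 rfl
  · obtain ⟨d, hS, hlab, hC⟩ := DiracFolding.exists_unique_spectralDataS hV hU
    exact ⟨d, DiracFolding.isSpectralDataT_iff hV hlab hC, hS⟩
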